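/- Let $(M,g)$ be a connected four-dimensional Lorentzian spin manifold of signature $(+,-,-,-)$ (oriented and time-oriented, with a $\mathrm{Spin}_0(1,3)$-structure), with real rank-$4$ spinor bundle $S(M)$, Clifford relation $v\cdot v=-g(v,v)$, Clifford volume element $\operatorname{vol}$ and the invariant symplectic form $\langle-,-\rangle$ on spinors satisfying $\langle v\cdot s,t\rangle=-\langle s,v\cdot t\rangle$. Let $\kappa(s,t)$ be the (polarised) Dirac current, $g(\kappa(s,t),v)=\langle s,v\cdot t\rangle$, and $\sigma$ the spin representation. Let $a,b\in C^\infty(M)$ and let $\varphi$ be a smooth vector field. With $\nabla$ the Levi-Civita (spin) connection, put $$\beta^\Phi_v s=v\cdot(a+b\operatorname{vol})\cdot s-(\varphi\wedge v)\cdot\operatorname{vol}\cdot s+2g(\varphi,v)\operatorname{vol}\cdot s ,$$ $$\mathfrak k_{\bar 0}=\{X\in\mathfrak X(M)\mid \mathscr L_Xg=0,\ \mathscr L_Xa=\mathscr L_Xb=0,\ \mathscr L_X\varphi=0\},\qquad \mathfrak k_{\bar 1}=\{\varepsilon\in\Gamma(S(M))\mid \nabla_v\varepsilon=\beta^\Phi_v\varepsilon\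 \text{for all } v\},$$ and let $\mathfrak k=\mathfrak k_{\bar 0}\oplus\mathfrak k_{\bar 1}$ be the Killing superalgebra, with bracket the commutator of vector fields on $\mathfrak k_{\bar 0}$, $[X,\varepsilon]=\nabla_X\varepsilon+\sigma(A_X)\varepsilon$ with $A_X=-\nabla X$, and $[\varepsilon,\varepsilon']=\kappa(\varepsilon,\varepsilon')$; these brackets take values in $\mathfrak k$ and make it a Lie superalgebra. Fix $o\in M$ and let $V=T_oM$, $S=S_o(M)$, and let $\mathfrak p=V\oplus S\oplus\mathfrak{so}(V)$ (degrees $-2,-1,0$) be the Poincaré superalgebra, with $[A,B]=AB-BA$, $[A,s]=\sigma(A)s$, $[A,v]=Av$, $[s,s]=\kappa(s,s)$, $[v,s]=0$, $[v,w]=0$. The evaluation $(X,\varepsilon)\mapsto(X|_o,\varepsilon|_o,A_X|_o)$ is an injective linear map $\mathfrak k\to\mathfrak p$. Let $V'=\{X|_o: X\in\mathfrak k_{\bar 0}\}$, $S'=\{\varepsilon|_o:\varepsilon\in\mathfrak k_{\bar 1}\}$ and $\mathfrak h=\{A_X|_o: X\in\mathfrak k_{\bar 0},\ X|_o=0\}\subset\mathfrak{so}(V)$.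 Then $\mathfrak a=\mathfrak h\oplus S'\oplus V'$ is a $\mathbb Z$-graded subalgebra of $\mathfrak p$, and $\mathfrak k$ is a filtered deformation of $\mathfrak a$: for the filtration $\mathfrak k^{i}=\mathfrak k$ $(i\le-2)$, $\mathfrak k^{-1}=\{X\in\mathfrak k_{\bar0}: X|_o=0\}\oplus\mathfrak k_{\bar 1}$, $\mathfrak k^0=\{X\in\mathfrak k_{\bar0}: X|_o=0\}$, $\mathfrak k^{i}=0$ $(i>0)$, it is a filtered Lie superalgebra whose associated graded Lie superalgebra is isomorphic to $\mathfrak a$. More precisely, there are linear maps $\Sigma:V'\to\mathfrak{so}(V)$ such that each $(v,\Sigma_v)$ equals $(X,A_X)|_o$ for some $X\in\mathfrak k_{\bar 0}$, and for every such $\Sigma$ the bracket of $\mathfrak k$, transported to $\mathfrak h\oplus S'\oplus V'$ by the linear isomorphism sending $(v,s,A)$ to the element of $\mathfrak k$ with value $(v,s,A+\Sigma_v)$ at $o$, is $$[A,B]=AB-BA,\quad [A,s]=\sigma(A)s,\quad [A,v]=Av+\big([A,\Sigma_v]-\Sigma_{Av}\big),$$ $$[s,s]=\kappa(s,s)+\big(\gamma^\Phi(s,s)-\Sigma_{\kappa(s,s)}\big),\quad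 [v,s]=\beta^\Phi_vs+\sigma(\Sigma_v)s,$$ $$[v,w]=\alpha(v,w)+\big([\Sigma_v,\Sigma_w]+R(v,w)-\Sigma_{\alpha(v,w)}\big),\qquad \alpha(v,w)=\Sigma_vw-\Sigma_wv,$$ where $\gamma^\Phi(s,s)v=-2\kappa(\beta^\Phi_vs,s)$, $R(X,Y)=\nabla_{[X,Y]}-[\nabla_X,\nabla_Y]$, and the terms in parentheses lie in $\mathfrak h$, while $\beta^\Phi_vs+\sigma(\Sigma_v)s\in S'$ and $\alpha(v,w)\in V'$. Moreover, if $\dim S'>\tfrac12\dim S=2$, then the Lie algebra $\mathfrak k_{\bar 0}$ of infinitesimal automorphisms of $(M,g,a,b,\varphi)$ acts locally transitively around every point of $M$, i.e. its values span the tangent space at all points of a neighbourhood of that point. -/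

import Mathlib

open scoped Manifold ContDiff Topology
open Bundle

noncomputable section

namespace KSA

/-! ### Clifford algebra and spinors of four-dimensional Minkowski space -/

/-- The diagonal entries of the "mostly minus" Minkowski inner product. -/
def mink : Fin 4 → ℝ := ![1, -1, -1, -1]

/-- The irreducible real Clifford module `S = ℝ⁴` of `ℝ^{1,3}`. -/
abbrev Spinor : Type := Fin 4 → ℝ

/-- Real gamma matrices: `Γ_μ Γ_ν + Γ_ν Γ_μ = -2 η_{μν}`. -/
def gammaMatrix : Fin 4 → Matrix (Fin 4) (Fin 4) ℝ :=
  ![!![0, 0, 0, 1; 0, 0, 1, 0; 0, -1, 0, 0; -1, 0, 0, 0],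
    !![0, 0, 1, 0; 0, 0, 0, 1; 1, 0, 0, 0; 0, 1, 0, 0],
    !![1, 0, 0, 0; 0, 1, 0, 0; 0, 0, -1, 0; 0, 0, 0, -1],
    !![0, 0, 0, 1; 0, 0, -1, 0; 0, -1, 0, 0; 1, 0, 0, 0]]

/-- Clifford multiplication by the `μ`-th vector of an orthonormal basis. -/
def gamma (μ : Fin 4) : Module.End ℝ Spinor := Matrix.toLin' (gammaMatrix μ)

/-- Clifford multiplication by the volume element `e₀ ∧ e₁ ∧ e₂ ∧ e₃`. -/
def vol : Module.End ℝ Spinor := gamma 0 * gamma 1 * gamma 2 * gamma 3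

/-- A symplectic form on the spinor module for which Clifford multiplication by vectors is skew.
(It is unique up to a nonzero real factor.) -/
structure SpinorForm where
  form : Spinor →ₗ[ℝ] Spinor →ₗ[ℝ] ℝ
  alt : ∀ s, form s s = 0
  nondeg : ∀ s, (∀ t, form s t = 0) → s = 0
  clifford_skew : ∀ μ s t, form (gamma μ s) t = -form s (gamma μ t)

/-! ### Lie superalgebras, gradings, filtrations -/

/-- The sign `(-1)^{ij}`. -/
def superSign (i j : ZMod 2) : ℝ := if i = 1 ∧ j = 1 then -1 else 1

section Super

variable {L : Type*} [AddCommGroup L] [Module ℝ L]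

/-- `br` is the bracket of a real Lie superalgebra with even part `par 0` and odd part `par 1`. -/
structure IsLieSuperalgebra (par : ZMod 2 → Submodule ℝ L) (br : L →ₗ[ℝ] L →ₗ[ℝ] L) : Prop where
  internal : DirectSum.IsInternal par
  bracket_mem : ∀ i j x y, x ∈ par i → y ∈ par j → br x y ∈ par (i + j)
  skew : ∀ i j x y, x ∈ par i → y ∈ par j → br x y = -(superSign i j • br y x)
  jacobi : ∀ i j x y z, x ∈ par i → y ∈ par j →
    br x (br y z) = br (br x y) z + superSign i j • br y (br x z)

/-- A `ℤ`-graded Lie superalgebra whose parity is the degree mod 2. -/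
structure IsGradedLieSuperalgebra (par : ZMod 2 → Submodule ℝ L) (deg : ℤ → Submodule ℝ L)
    (br : L →ₗ[ℝ] L →ₗ[ℝ] L) : Prop extends IsLieSuperalgebra par br where
  deg_internal : DirectSum.IsInternal deg
  deg_bracket_mem : ∀ i j x y, x ∈ deg i → y ∈ deg j → br x y ∈ deg (i + j)
  deg_le_par : ∀ i, deg i ≤ par (i : ZMod 2)

/-- A filtered Lie superalgebra `⋯ ⊇ F (-2) ⊇ F (-1) ⊇ F 0 ⊇ ⋯` (by sub-superspaces). -/
structure IsFilteredLieSuperalgebra (par : ZMod 2 → Submodule ℝ L) (F : ℤ → Submodule ℝ L)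
    (br : L →ₗ[ℝ] L →ₗ[ℝ] L) : Prop extends IsLieSuperalgebra par br where
  antitone : Antitone F
  exhaustive : ∀ x, ∃ i, x ∈ F i
  separated : ∀ x, (∀ i, x ∈ F i) → x = 0
  fil_bracket_mem : ∀ i j x y, x ∈ F i → y ∈ F j → br x y ∈ F (i + j)
  homogeneous : ∀ i, F i = (F i ⊓ par 0) ⊔ (F i ⊓ par 1)

/-- The `i`-th piece `F i / F (i + 1)` of the associated graded space of a filtration. -/
abbrev Gr (F : ℤ → Submodule ℝ L) (i : ℤ) : Type _ := F i ⧸ (F (i + 1)).submoduleOf (F i)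

/-- The class in `F i / F (i + 1)` of an element of `F i`. -/
def Gr.mk (F : ℤ → Submodule ℝ L) (i : ℤ) (x : L) (hx : x ∈ F i) : Gr F i :=
  Submodule.Quotient.mk ⟨x, hx⟩

/-- The filtered Lie superalgebra `(L, par, F, br)` is a filtered deformation of the graded Lie
superalgebra `(L', par', deg', br')`: its associated graded Lie superalgebra, with the bracket
`[x mod F (i+1), y mod F (j+1)] = [x, y] mod F (i+j+1)`, is isomorphic to the latter. -/
def IsFilteredDeformation {L' : Type*} [AddCommGroup L'] [Module ℝ L']
    (par : ZMod 2 → Submodule ℝ L) (F : ℤ → Submodule ℝ L) (br : L →ₗ[ℝ] L →ₗ[ℝ] L)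
    (par' : ZMod 2 → Submodule ℝ L') (deg' : ℤ → Submodule ℝ L')
    (br' : L' →ₗ[ℝ] L' →ₗ[ℝ] L') : Prop :=
  IsFilteredLieSuperalgebra par F br ∧ IsGradedLieSuperalgebra par' deg' br' ∧
  ∃ f : ∀ i, Gr F i ≃ₗ[ℝ] deg' i,
    (∀ i p x (hx : x ∈ F i), x ∈ par p → (f i (Gr.mk F i x hx) : L') ∈ par' p) ∧
    ∀ i j x y (hx : x ∈ F i) (hy : y ∈ F j) (hxy : br x y ∈ F (i + j)),
      (f (i + j) (Gr.mk F (i + j) (br x y) hxy) : L') =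
        br' (f i (Gr.mk F i x hx)) (f j (Gr.mk F j y hy))

end Super

/-- The grading of `V ⊕ S ⊕ H` with `V`, `S`, `H` in degrees `-2`, `-1`, `0`. -/
def tripleDeg (V S H : Type*) [AddCommGroup V] [Module ℝ V] [AddCommGroup S] [Module ℝ S]
    [AddCommGroup H] [Module ℝ H] (i : ℤ) : Submodule ℝ (V × S × H) :=
  if i = -2 then Submodule.prod ⊤ ⊥
  else if i = -1 then Submodule.prod ⊥ (Submodule.prod ⊤ ⊥)
  else if i = 0 then Submodule.prod ⊥ (Submodule.prod ⊥ ⊤)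
  else ⊥

/-- The parity of `V ⊕ S ⊕ H`: `V ⊕ H` is even and `S` is odd. -/
def triplePar (V S H : Type*) [AddCommGroup V] [Module ℝ V] [AddCommGroup S] [Module ℝ S]
    [AddCommGroup H] [Module ℝ H] (p : ZMod 2) : Submodule ℝ (V × S × H) :=
  if p = 0 then Submodule.prod ⊤ (Submodule.prod ⊥ ⊤) else Submodule.prod ⊥ (Submodule.prod ⊤ ⊥)

/-! ### Lorentzian four-manifolds and spin structures -/

abbrev E4 : Type := EuclideanSpace ℝ (Fin 4)

/-- The tangent space. -/
abbrev T {M : Type*} [TopologicalSpace M] [ChartedSpace E4 M] (x : M) : Type :=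
  TangentSpace (𝓡 4) x

/-- Smooth vector fields. -/
abbrev VField (M : Type*) [TopologicalSpace M] [ChartedSpace E4 M] [IsManifold (𝓡 4) ∞ M] :
    Type _ :=
  ContMDiffSection (𝓡 4) E4 ∞ (fun x : M => T x)

variable {M : Type*} [TopologicalSpace M] [ChartedSpace E4 M] [IsManifold (𝓡 4) ∞ M]

variable (M) in
/-- A smooth Lorentzian metric of signature `(+,-,-,-)`. -/
structure LorentzMetric where
  val : ∀ x : M, T x →L[ℝ] T x →L[ℝ] ℝ
  symm : ∀ x v w, val x v w = val x w v
  signature : ∀ x, ∃ e : Fin 4 → T x, ∀ μ ν, val x (e μ) (e ν) = if μ = ν then mink μ else 0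
  contMDiff : ContMDiff (𝓡 4) ((𝓡 4).prod 𝓘(ℝ, E4 →L[ℝ] E4 →L[ℝ] ℝ)) ∞
    (fun x => TotalSpace.mk' (E4 →L[ℝ] E4 →L[ℝ] ℝ) x (val x))

/-- The metric at a point as a bilinear form. -/
def LorentzMetric.bilin (g : LorentzMetric M) (x : M) : LinearMap.BilinForm ℝ (T x) :=
  LinearMap.mk₂ ℝ (fun v w => g.val x v w) (by simp) (by simp) (by simp) (by simp)

/-- The Lie algebra `𝔰𝔬(T_x M)` of skew-symmetric endomorphisms. -/
def LorentzMetric.so (g : LorentzMetric M) (x : M) : Submodule ℝ (Module.End ℝ (T x)) where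
  carrier := {A | ∀ v w, g.bilin x (A v) w = -g.bilin x v (A w)}
  add_mem' := by
    intro A B hA hB v w
    simp only [LinearMap.add_apply, map_add, hA v w, hB v w, neg_add]
  zero_mem' := by
    intro v w
    simp
  smul_mem' := by
    intro c A hA v w
    simp only [LinearMap.smul_apply, map_smul, hA v w, smul_neg]

/-- The commutator `[A, B] = AB - BA` on `𝔰𝔬(T_x M)`. -/
def LorentzMetric.comm (g : LorentzMetric M) (x : M) (A B : g.so x) : g.so x :=
  ⟨(A : Module.End ℝ (T x)) * B - (B : Module.End ℝ (T x)) * A, by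
    intro v w
    have hA := A.2
    have hB := B.2
    simp only [LinearMap.sub_apply, Module.End.mul_apply, map_sub]
    rw [hA, hB, hB, hA]
    ring⟩

/-- A spin structure on `(M, g)`, presented by an open cover `baseSet i` with smooth orthonormal
frames `frame i` over it and lifts of the frame changes to the spin group, satisfying the cocycle
condition (the fields inherited from `VectorBundleCore`).

`coordChange i j x : S → S` covers the Lorentz transformation relating the two frames
(`covers`). Commuting with `vol` says that this transformation has determinant one, and
preserving the symplectic form says that it preserves time orientation and that the lift is
normalised: the linear maps so described are exactly the elements of
`Spin₀(1,3) ≅ SL(2,ℂ)` in the spin representation. The inherited `VectorBundleCore` is then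
the spinor bundle `S(M)`. -/
structure SpinStructure (g : LorentzMetric M) (Ω : SpinorForm) (ι : Type*) extends
    VectorBundleCore ℝ M Spinor ι where
  contMDiffOn_coordChange : ∀ i j, ContMDiffOn (𝓡 4) 𝓘(ℝ, Spinor →L[ℝ] Spinor) ∞
    (coordChange i j) (baseSet i ∩ baseSet j)
  frame : ι → Fin 4 → ∀ x : M, T x
  contMDiffOn_frame : ∀ i μ, ContMDiffOn (𝓡 4) ((𝓡 4).prod 𝓘(ℝ, E4)) ∞
    (fun x => TotalSpace.mk' E4 x (frame i μ x)) (baseSet i)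
  orthonormal : ∀ i, ∀ x ∈ baseSet i, ∀ μ ν,
    g.val x (frame i μ x) (frame i ν x) = if μ = ν then mink μ else 0
  covers : ∀ i j, ∀ x ∈ baseSet i ∩ baseSet j, ∀ (v : T x) (s : Spinor),
    coordChange i j x (∑ μ, (mink μ * g.val x v (frame i μ x)) • gamma μ s) =
      ∑ μ, (mink μ * g.val x v (frame j μ x)) • gamma μ (coordChange i j x s)
  preserves_vol : ∀ i j, ∀ x ∈ baseSet i ∩ baseSet j, ∀ s : Spinor,
    coordChange i j x (vol s) = vol (coordChange i j x s)
  preserves_form : ∀ i j, ∀ x ∈ baseSet i ∩ baseSet j, ∀ s t : Spinor,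
    Ω.form (coordChange i j x s) (coordChange i j x t) = Ω.form s t

/-- The Koszul expression: the Levi-Civita connection satisfies `2 g(∇_X Y, Z) = koszul g X Y Z`. -/
def koszul (g : LorentzMetric M) (X Y Z : ∀ x : M, T x) (x : M) : ℝ :=
  mvfderiv (𝓡 4) (fun y => g.val y (Y y) (Z y)) x (X x)
  + mvfderiv (𝓡 4) (fun y => g.val y (Z y) (X y)) x (Y x)
  - mvfderiv (𝓡 4) (fun y => g.val y (X y) (Y y)) x (Z x)
  + g.val x (VectorField.mlieBracket (𝓡 4) X Y x) (Z x)
  - g.val x (VectorField.mlieBracket (𝓡 4) Y Z x) (X x)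
  + g.val x (VectorField.mlieBracket (𝓡 4) Z X x) (Y x)

namespace SpinStructure

variable {g : LorentzMetric M} {Ω : SpinorForm} {ι : Type*} (P : SpinStructure g Ω ι)

instance : P.toVectorBundleCore.IsContMDiff (𝓡 4) ∞ := ⟨P.contMDiffOn_coordChange⟩

/-- Smooth sections of the spinor bundle. The fibre over `x` is `S`, through the frame with index
`P.indexAt x`. -/
abbrev SpinorField : Type _ := ContMDiffSection (𝓡 4) Spinor ∞ P.toVectorBundleCore.Fiber

/-- The orthonormal frame chosen around `x`, defined near `x`. -/
def e (x : M) (μ : Fin 4) : ∀ y : M, T y := P.frame (P.indexAt x) μ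

/-- The `μ`-th component of a tangent vector at `x` relative to the frame chosen at `x`. -/
def coord (x : M) (μ : Fin 4) : T x →ₗ[ℝ] ℝ := mink μ • g.bilin x (P.e x μ x)

/-- Clifford multiplication `T_x M → End S_x`. -/
def cliff (x : M) : T x →ₗ[ℝ] Module.End ℝ Spinor :=
  ∑ μ, (P.coord x μ).smulRight (gamma μ)

/-- The spin representation of `𝔰𝔬(T_x M)` on `S_x` (extended linearly to all endomorphisms):
`σ(A) = ⅛ ∑_μ η^{μμ} [e_μ, A e_μ]`, so that `σ(v ∧ w) = ¼ [v, w]`. -/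
def sigma (x : M) : Module.End ℝ (T x) →ₗ[ℝ] Module.End ℝ Spinor where
  toFun A := (8 : ℝ)⁻¹ • ∑ μ, mink μ •
    (gamma μ * P.cliff x (A (P.e x μ x)) - P.cliff x (A (P.e x μ x)) * gamma μ)
  map_add' A B := by
    rw [← smul_add, ← Finset.sum_add_distrib]
    refine congrArg (fun t => (8 : ℝ)⁻¹ • t) (Finset.sum_congr rfl fun μ _ => ?_)
    rw [← smul_add, LinearMap.add_apply, map_add, mul_add, add_mul]
    refine congrArg (fun t => mink μ • t) ?_
    abel
  map_smul' c A := by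
    simp only [RingHom.id_apply, LinearMap.smul_apply, map_smul, mul_smul_comm, smul_mul_assoc,
      Finset.smul_sum]
    refine Finset.sum_congr rfl fun μ _ => ?_
    module

/-- The Dirac current, polarised: `g(κ(s, t), v) = ⟨s, v · t⟩`. -/
def kappa (x : M) : Spinor →ₗ[ℝ] Spinor →ₗ[ℝ] T x :=
  LinearMap.mk₂ ℝ (fun s t => ∑ μ, (mink μ * Ω.form s (gamma μ t)) • P.e x μ x)
    (fun s s' t => by
      simp only [map_add, LinearMap.add_apply, mul_add, add_smul, Finset.sum_add_distrib])
    (fun c s t => by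
      simp only [map_smul, LinearMap.smul_apply, smul_eq_mul, Finset.smul_sum, smul_smul,
        mul_left_comm])
    (fun s t t' => by
      simp only [map_add, mul_add, add_smul, Finset.sum_add_distrib])
    (fun c s t => by
      simp only [map_smul, smul_eq_mul, Finset.smul_sum, smul_smul, mul_left_comm])

/-- The Levi-Civita connection `v ↦ ∇_v Y` at `x`, by Koszul's formula relative to the orthonormal
frame chosen around `x`. -/
def nabla (Y : ∀ y : M, T y) (x : M) : Module.End ℝ (T x) :=
  ∑ μ, (P.coord x μ).smulRight
    (∑ ν, (mink ν * (2⁻¹ * koszul g (P.e x μ) Y (P.e x ν) x)) • P.e x ν x)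

/-- `A_ξ = -∇ξ` at `x`. -/
def aMap (ξ : ∀ y : M, T y) (x : M) : Module.End ℝ (T x) := -P.nabla ξ x

/-- The connection one-form `θ(v) : e_μ ↦ ∇_v e_μ` of the chosen frame at `x`. -/
def connForm (x : M) (v : T x) : Module.End ℝ (T x) :=
  ∑ μ, (P.coord x μ).smulRight (P.nabla (P.e x μ) x v)

/-- The Riemann tensor, with the sign convention `R(X, Y) = ∇_{[X, Y]} - [∇_X, ∇_Y]`. -/
def riemann (x : M) (u v : T x) : Module.End ℝ (T x) :=
  ∑ μ, ∑ ν, ∑ ρ, (P.coord x μ u * P.coord x ν v) • (P.coord x ρ).smulRight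
    (P.nabla (P.e x ρ) x (VectorField.mlieBracket (𝓡 4) (P.e x μ) (P.e x ν) x)
      - P.nabla (fun y => P.nabla (P.e x ρ) y (P.e x ν y)) x (P.e x μ x)
      + P.nabla (fun y => P.nabla (P.e x ρ) y (P.e x μ y)) x (P.e x ν x))

/-- The components of a spinor field in the `i`-th frame. -/
def comp (i : ι) (ε : P.SpinorField) (x : M) : Spinor := P.coordChange (P.indexAt x) i x (ε x)

/-- The value of a spinor field at a point. -/
def evalSpinor (x : M) : P.SpinorField →ₗ[ℝ] Spinor where
  toFun ε := ε x
  map_add' _ _ := rfl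
  map_smul' _ _ := rfl

/-- The spin connection `∇_v ε = v(ε) + σ(θ(v)) ε` at `x`, computed in the frame chosen
around `x`. -/
def spinNabla (ε : P.SpinorField) (x : M) (v : T x) : Spinor :=
  mvfderiv (𝓡 4) (P.comp (P.indexAt x) ε) x v + P.sigma x (P.connForm x v) (P.evalSpinor x ε)

/-- The spinorial Lie derivative `ℒ_X ε = ∇_X ε + σ(A_X) ε`. -/
def spinLie (X : VField M) (ε : P.SpinorField) (x : M) : Spinor :=
  P.spinNabla ε x (X x) + P.sigma x (P.aMap X x) (P.evalSpinor x ε)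

end SpinStructure

/-- The value of a vector field at a point. -/
def evalVector (x : M) : VField M →ₗ[ℝ] T x where
  toFun X := X x
  map_add' _ _ := rfl
  map_smul' _ _ := rfl

/-- The remaining background fields: two functions `a`, `b` and a vector field `φ`. -/
structure Fields (M : Type*) [TopologicalSpace M] [ChartedSpace E4 M] [IsManifold (𝓡 4) ∞ M] where
  a : C^∞⟮𝓡 4, M; ℝ⟯
  b : C^∞⟮𝓡 4, M; ℝ⟯
  φ : VField M

/-! ### Auxiliary linearity facts -/

section Aux

variable {g : LorentzMetric M} {Ω : SpinorForm} {ι : Type*} (P : SpinStructure g Ω ι)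

theorem SpinStructure.mdiff_e (x : M) (μ : Fin 4) :
    MDifferentiableAt (𝓡 4) ((𝓡 4).prod 𝓘(ℝ, E4))
      (fun y => TotalSpace.mk' E4 y (P.e x μ y)) x :=
  (((P.contMDiffOn_frame (P.indexAt x) μ).contMDiffAt
    ((P.isOpen_baseSet _).mem_nhds (P.mem_baseSet_at x))).mdifferentiableAt (by simp))

theorem LorentzMetric.mdiff_apply (g : LorentzMetric M) {Y Z : ∀ y : M, T y} {x : M}
    (hY : MDifferentiableAt (𝓡 4) ((𝓡 4).prod 𝓘(ℝ, E4)) (fun y => TotalSpace.mk' E4 y (Y y)) x)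
    (hZ : MDifferentiableAt (𝓡 4) ((𝓡 4).prod 𝓘(ℝ, E4)) (fun y => TotalSpace.mk' E4 y (Z y)) x) :
    MDifferentiableAt (𝓡 4) 𝓘(ℝ, ℝ) (fun y => g.val y (Y y) (Z y)) x := by
  have h : MDifferentiableAt (𝓡 4) ((𝓡 4).prod 𝓘(ℝ, ℝ))
      (fun y => TotalSpace.mk' ℝ (E := Bundle.Trivial M ℝ) y (g.val y (Y y) (Z y))) x := by
    apply MDifferentiableAt.clm_bundle_apply₂ (F₁ := E4) (F₂ := E4)
    · exact (g.contMDiff x).mdifferentiableAt (by simp)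
    · exact hY
    · exact hZ
  rw [mdifferentiableAt_totalSpace] at h
  exact h.2

theorem SpinStructure.mdiff_comp (ε : P.SpinorField) (x : M) :
    MDifferentiableAt (𝓡 4) 𝓘(ℝ, Spinor) (P.comp (P.indexAt x) ε) x :=
  haveI : MemTrivializationAtlas (P.toVectorBundleCore.localTriv (P.indexAt x)) :=
    ⟨⟨P.indexAt x, rfl⟩⟩
  (((P.toVectorBundleCore.localTriv (P.indexAt x)).contMDiffAt_section_iff
    (P.mem_baseSet_at x)).1 (ε.contMDiff x)).mdifferentiableAt (by simp)

theorem koszul_add (X Z : ∀ y : M, T y) (Y Y' : VField M) (x : M)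
    (hX : MDifferentiableAt (𝓡 4) ((𝓡 4).prod 𝓘(ℝ, E4)) (fun y => TotalSpace.mk' E4 y (X y)) x)
    (hZ : MDifferentiableAt (𝓡 4) ((𝓡 4).prod 𝓘(ℝ, E4)) (fun y => TotalSpace.mk' E4 y (Z y)) x) :
    koszul g X (Y + Y' : VField M) Z x = koszul g X Y Z x + koszul g X Y' Z x := by
  have h1 : (fun y => g.val y ((Y + Y' : VField M) y) (Z y)) =
      (fun y => g.val y (Y y) (Z y)) + fun y => g.val y (Y' y) (Z y) := by
    ext y; simp
  have h2 : (fun y => g.val y (X y) ((Y + Y' : VField M) y)) =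
      (fun y => g.val y (X y) (Y y)) + fun y => g.val y (X y) (Y' y) := by
    ext y; simp
  unfold koszul
  rw [h1, h2, mvfderiv_add (g.mdiff_apply Y.mdifferentiableAt hZ)
    (g.mdiff_apply Y'.mdifferentiableAt hZ), mvfderiv_add (g.mdiff_apply hX Y.mdifferentiableAt)
    (g.mdiff_apply hX Y'.mdifferentiableAt), ContMDiffSection.coe_add,
    VectorField.mlieBracket_add_right Y.mdifferentiableAt Y'.mdifferentiableAt,
    VectorField.mlieBracket_add_left Y.mdifferentiableAt Y'.mdifferentiableAt]
  simp only [Pi.add_apply, map_add, _root_.add_apply]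
  ring

theorem koszul_smul (X Z : ∀ y : M, T y) (c : ℝ) (Y : VField M) (x : M)
    (hX : MDifferentiableAt (𝓡 4) ((𝓡 4).prod 𝓘(ℝ, E4)) (fun y => TotalSpace.mk' E4 y (X y)) x)
    (hZ : MDifferentiableAt (𝓡 4) ((𝓡 4).prod 𝓘(ℝ, E4)) (fun y => TotalSpace.mk' E4 y (Z y)) x) :
    koszul g X (c • Y : VField M) Z x = c * koszul g X Y Z x := by
  have h1 : (fun y => g.val y ((c • Y : VField M) y) (Z y)) =
      (fun _ : M => c) • (fun y => g.val y (Y y) (Z y)) := by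
    ext y; simp
  have h2 : (fun y => g.val y (X y) ((c • Y : VField M) y)) =
      (fun _ : M => c) • (fun y => g.val y (X y) (Y y)) := by
    ext y; simp
  unfold koszul
  rw [h1, h2, mvfderiv_smul mdifferentiableAt_const (g.mdiff_apply Y.mdifferentiableAt hZ),
    mvfderiv_smul mdifferentiableAt_const (g.mdiff_apply hX Y.mdifferentiableAt),
    ContMDiffSection.coe_smul, VectorField.mlieBracket_const_smul_right Y.mdifferentiableAt,
    VectorField.mlieBracket_const_smul_left Y.mdifferentiableAt]
  simp only [Pi.smul_apply, map_smul, _root_.add_apply, _root_.smul_apply,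
    mvfderiv_const, ContinuousLinearMap.smulRight_apply, _root_.zero_apply,
    smul_eq_mul]
  ring

theorem SpinStructure.aMap_add (Y Y' : VField M) (x : M) :
    P.aMap (Y + Y' : VField M) x = P.aMap Y x + P.aMap Y' x := by
  unfold SpinStructure.aMap SpinStructure.nabla
  rw [← neg_add, ← Finset.sum_add_distrib]
  congr 1
  refine Finset.sum_congr rfl fun μ _ => ?_
  ext v
  simp only [koszul_add _ _ Y Y' x (P.mdiff_e x μ) (P.mdiff_e x _), LinearMap.smulRight_apply,
    LinearMap.add_apply, ← smul_add, ← Finset.sum_add_distrib, ← add_smul, ← mul_add]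

theorem SpinStructure.aMap_smul (c : ℝ) (Y : VField M) (x : M) :
    P.aMap (c • Y : VField M) x = c • P.aMap Y x := by
  unfold SpinStructure.aMap SpinStructure.nabla
  rw [smul_neg, Finset.smul_sum]
  congr 1
  refine Finset.sum_congr rfl fun μ _ => ?_
  ext v
  simp only [koszul_smul _ _ c Y x (P.mdiff_e x μ) (P.mdiff_e x _), LinearMap.smulRight_apply,
    LinearMap.smul_apply, Finset.smul_sum, smul_smul]
  refine Finset.sum_congr rfl fun ν _ => ?_
  congr 1
  ring

theorem SpinStructure.spinNabla_add (ε ε' : P.SpinorField) (x : M) (v : T x) :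
    P.spinNabla (ε + ε') x v = P.spinNabla ε x v + P.spinNabla ε' x v := by
  have h : P.comp (P.indexAt x) (ε + ε') =
      P.comp (P.indexAt x) ε + P.comp (P.indexAt x) ε' := by
    ext1 y
    exact map_add (P.coordChange (P.indexAt y) (P.indexAt x) y) (ε y) (ε' y)
  unfold SpinStructure.spinNabla
  rw [h, mvfderiv_add (P.mdiff_comp ε x) (P.mdiff_comp ε' x), map_add, map_add,
    _root_.add_apply]
  abel

theorem SpinStructure.spinNabla_smul (c : ℝ) (ε : P.SpinorField) (x : M) (v : T x) :
    P.spinNabla (c • ε) x v = c • P.spinNabla ε x v := by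
  have h : P.comp (P.indexAt x) (c • ε) = (fun _ : M => c) • P.comp (P.indexAt x) ε := by
    ext1 y
    exact map_smul (P.coordChange (P.indexAt y) (P.indexAt x) y) c (ε y)
  unfold SpinStructure.spinNabla
  rw [h, mvfderiv_smul mdifferentiableAt_const (P.mdiff_comp ε x), map_smul, map_smul, smul_add]
  simp [mvfderiv_const]

end Aux

/-! ### The Killing superalgebra -/

section Killing

variable {g : LorentzMetric M} {Ω : SpinorForm} {ι : Type*}

/-- `β_v s = v · (a + b vol) · s - (φ ∧ v) · vol · s + 2 g(φ, v) vol · s`, at the point `x`. -/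
def beta (P : SpinStructure g Ω ι) (Φ : Fields M) (x : M) (v : T x) : Module.End ℝ Spinor :=
  P.cliff x v * (Φ.a x • 1 + Φ.b x • vol)
  - ((2 : ℝ)⁻¹ • (P.cliff x (Φ.φ x) * P.cliff x v - P.cliff x v * P.cliff x (Φ.φ x))) * vol
  + (2 * g.val x (Φ.φ x) v) • vol

/-- The even part: vector fields `X` with `ℒ_X g = 0`, `ℒ_X a = ℒ_X b = 0` and `ℒ_X φ = 0`. -/
def k0 (g : LorentzMetric M) (Φ : Fields M) : Submodule ℝ (VField M) where
  carrier := {X | (∀ (Y Z : VField M) (x : M),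
      mvfderiv (𝓡 4) (fun y => g.val y (Y y) (Z y)) x (X x) =
        g.val x (VectorField.mlieBracket (𝓡 4) X Y x) (Z x)
        + g.val x (Y x) (VectorField.mlieBracket (𝓡 4) X Z x)) ∧
    (∀ x, mvfderiv (𝓡 4) Φ.a x (X x) = 0) ∧ (∀ x, mvfderiv (𝓡 4) Φ.b x (X x) = 0) ∧
    ∀ x, VectorField.mlieBracket (𝓡 4) X Φ.φ x = 0}
  add_mem' := by
    rintro X X' ⟨h1, h2, h3, h4⟩ ⟨h1', h2', h3', h4'⟩
    refine ⟨fun Y Z x => ?_, fun x => ?_, fun x => ?_, fun x => ?_⟩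
    · rw [ContMDiffSection.coe_add,
        VectorField.mlieBracket_add_left X.mdifferentiableAt X'.mdifferentiableAt,
        VectorField.mlieBracket_add_left X.mdifferentiableAt X'.mdifferentiableAt,
        Pi.add_apply, map_add, h1 Y Z x, h1' Y Z x]
      simp only [map_add, _root_.add_apply]
      ring
    · rw [ContMDiffSection.coe_add, Pi.add_apply, map_add, h2, h2', add_zero]
    · rw [ContMDiffSection.coe_add, Pi.add_apply, map_add, h3, h3', add_zero]
    · rw [ContMDiffSection.coe_add,
        VectorField.mlieBracket_add_left X.mdifferentiableAt X'.mdifferentiableAt, h4, h4',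
        add_zero]
  zero_mem' := by
    refine ⟨fun Y Z x => ?_, fun x => ?_, fun x => ?_, fun x => ?_⟩ <;>
      simp [VectorField.mlieBracket_zero_left]
  smul_mem' := by
    rintro c X ⟨h1, h2, h3, h4⟩
    refine ⟨fun Y Z x => ?_, fun x => ?_, fun x => ?_, fun x => ?_⟩
    · rw [ContMDiffSection.coe_smul,
        VectorField.mlieBracket_const_smul_left X.mdifferentiableAt,
        VectorField.mlieBracket_const_smul_left X.mdifferentiableAt,
        Pi.smul_apply, map_smul, h1 Y Z x]
      simp only [map_smul, _root_.smul_apply, smul_add]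
    · rw [ContMDiffSection.coe_smul, Pi.smul_apply, map_smul, h2, smul_zero]
    · rw [ContMDiffSection.coe_smul, Pi.smul_apply, map_smul, h3, smul_zero]
    · rw [ContMDiffSection.coe_smul,
        VectorField.mlieBracket_const_smul_left X.mdifferentiableAt, h4, smul_zero]

/-- The odd part: Killing spinors, `D_v ε = ∇_v ε - β_v ε = 0`. -/
def k1 (P : SpinStructure g Ω ι) (Φ : Fields M) : Submodule ℝ P.SpinorField where
  carrier := {ε | ∀ (x : M) (v : T x),
    P.spinNabla ε x v - beta P Φ x v (P.evalSpinor x ε) = 0}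
  add_mem' := by
    intro ε ε' h h' x v
    rw [P.spinNabla_add, map_add, map_add, add_sub_add_comm, h, h', add_zero]
  zero_mem' := by
    intro x v
    have h := P.spinNabla_smul 0 (0 : P.SpinorField) x v
    rw [zero_smul, zero_smul] at h
    rw [h, map_zero, map_zero, sub_zero]
  smul_mem' := by
    intro c ε h x v
    rw [P.spinNabla_smul, map_smul, map_smul, ← smul_sub, h, smul_zero]

variable (P : SpinStructure g Ω ι) (Φ : Fields M)

/-- The vector space `𝔨 = 𝔨₀ ⊕ 𝔨₁` underlying the Killing superalgebra. -/
abbrev K : Type _ := k0 g Φ × k1 P Φ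

/-- Even and odd part of `𝔨`. -/
def kPar (p : ZMod 2) : Submodule ℝ (K P Φ) :=
  if p = 0 then Submodule.prod ⊤ ⊥ else Submodule.prod ⊥ ⊤

/-- `br` is the bracket of the Killing superalgebra: the commutator of vector fields on `𝔨₀`, the
spinorial Lie derivative on `𝔨₀ ⊗ 𝔨₁` and the (polarised) Dirac current on `𝔨₁`. -/
structure IsKillingBracket (br : K P Φ →ₗ[ℝ] K P Φ →ₗ[ℝ] K P Φ) : Prop where
  even_even : ∀ X Y : k0 g Φ, (br (X, 0) (Y, 0)).2 = 0 ∧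
    ∀ x, ((br (X, 0) (Y, 0)).1 : VField M) x =
      VectorField.mlieBracket (𝓡 4) (X : VField M) (Y : VField M) x
  even_odd : ∀ (X : k0 g Φ) (ε : k1 P Φ), (br (X, 0) (0, ε)).1 = 0 ∧
    ∀ x, P.evalSpinor x (br (X, 0) (0, ε)).2 = P.spinLie X ε x
  odd_even : ∀ (X : k0 g Φ) (ε : k1 P Φ), br (0, ε) (X, 0) = -br (X, 0) (0, ε)
  odd_odd : ∀ ε ε' : k1 P Φ, (br (0, ε) (0, ε')).2 = 0 ∧
    ∀ x, ((br (0, ε) (0, ε')).1 : VField M) x =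
      P.kappa x (P.evalSpinor x ε) (P.evalSpinor x ε')

/-! ### The Poincaré superalgebra at a point and its graded subspace -/

/-- The underlying space `V ⊕ S ⊕ 𝔰𝔬(V)` of the Poincaré superalgebra, `V = T_o M`, `S = S_o(M)`. -/
abbrev Poincare (g : LorentzMetric M) (o : M) : Type _ := T o × Spinor × g.so o

/-- The bracket of the Poincaré superalgebra: `[A, B] = AB - BA`, `[A, s] = σ(A) s`, `[A, v] = A v`,
`[s, t] = κ(s, t)`, `[v, s] = 0`, `[v, w] = 0`. -/
def poincareBracket (o : M) : Poincare g o →ₗ[ℝ] Poincare g o →ₗ[ℝ] Poincare g o :=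
  LinearMap.mk₂ ℝ (fun x y =>
    ((x.2.2 : Module.End ℝ (T o)) y.1 - (y.2.2 : Module.End ℝ (T o)) x.1
        + P.kappa o x.2.1 y.2.1,
      P.sigma o x.2.2 y.2.1 - P.sigma o y.2.2 x.2.1,
      g.comm o x.2.2 y.2.2))
    (fun x x' y => by
      refine Prod.ext ?_ (Prod.ext ?_ (Subtype.ext ?_))
      · simp only [Prod.fst_add, Prod.snd_add, Submodule.coe_add, map_add, LinearMap.add_apply]
        abel
      · simp only [Prod.fst_add, Prod.snd_add, Submodule.coe_add, map_add, LinearMap.add_apply]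
        abel
      · simp only [Prod.snd_add, Submodule.coe_add, LorentzMetric.comm, add_mul, mul_add]
        abel)
    (fun c x y => by
      refine Prod.ext ?_ (Prod.ext ?_ (Subtype.ext ?_))
      · simp only [Prod.smul_fst, Prod.smul_snd, Submodule.coe_smul, map_smul,
          LinearMap.smul_apply, smul_sub, smul_add]
      · simp only [Prod.smul_fst, Prod.smul_snd, Submodule.coe_smul, map_smul,
          LinearMap.smul_apply, smul_sub]
      · simp only [Prod.smul_snd, Submodule.coe_smul, LorentzMetric.comm, smul_mul_assoc,
          mul_smul_comm, smul_sub])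
    (fun x y y' => by
      refine Prod.ext ?_ (Prod.ext ?_ (Subtype.ext ?_))
      · simp only [Prod.fst_add, Prod.snd_add, Submodule.coe_add, map_add, LinearMap.add_apply]
        abel
      · simp only [Prod.fst_add, Prod.snd_add, Submodule.coe_add, map_add, LinearMap.add_apply]
        abel
      · simp only [Prod.snd_add, Submodule.coe_add, LorentzMetric.comm, add_mul, mul_add]
        abel)
    (fun c x y => by
      refine Prod.ext ?_ (Prod.ext ?_ (Subtype.ext ?_))
      · simp only [Prod.smul_fst, Prod.smul_snd, Submodule.coe_smul, map_smul,
          LinearMap.smul_apply, smul_sub, smul_add]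
      · simp only [Prod.smul_fst, Prod.smul_snd, Submodule.coe_smul, map_smul,
          LinearMap.smul_apply, smul_sub]
      · simp only [Prod.smul_snd, Submodule.coe_smul, LorentzMetric.comm, smul_mul_assoc,
          mul_smul_comm, smul_sub])

/-- `V'`: the values at `o` of the vector fields in `𝔨₀`. -/
def V' (g : LorentzMetric M) (Φ : Fields M) (o : M) : Submodule ℝ (T o) :=
  (k0 g Φ).map (evalVector o)

/-- `S'`: the values at `o` of the Killing spinors. -/
def S' (o : M) : Submodule ℝ Spinor := (k1 P Φ).map (P.evalSpinor o)

/-- `𝔥`: the endomorphisms `A_ξ|_o ∈ 𝔰𝔬(V)`, for `ξ ∈ 𝔨₀` vanishing at `o`. -/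
def h (o : M) : Submodule ℝ (g.so o) where
  carrier := {A | ∃ ξ ∈ k0 g Φ, ξ o = 0 ∧ P.aMap ξ o = A}
  add_mem' := by
    rintro A B ⟨ξ, hξ, h0, hA⟩ ⟨ζ, hζ, h0', hB⟩
    refine ⟨ξ + ζ, add_mem hξ hζ, ?_, ?_⟩
    · rw [ContMDiffSection.coe_add, Pi.add_apply, h0, h0', add_zero]
    · rw [P.aMap_add, hA, hB]; rfl
  zero_mem' := by
    refine ⟨0, zero_mem _, rfl, ?_⟩
    have h := P.aMap_smul 0 (0 : VField M) o
    rw [zero_smul, zero_smul] at h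
    rw [h]; rfl
  smul_mem' := by
    rintro c A ⟨ξ, hξ, h0, hA⟩
    refine ⟨c • ξ, Submodule.smul_mem _ c hξ, ?_, ?_⟩
    · rw [ContMDiffSection.coe_smul, Pi.smul_apply, h0, smul_zero]
    · rw [P.aMap_smul, hA]; rfl

instance (o : M) : AddCommGroup (V' g Φ o) := Submodule.addCommGroup _

instance (o : M) : AddCommGroup (S' P Φ o) := Submodule.addCommGroup _

instance (o : M) : AddCommGroup (h P Φ o) := Submodule.addCommGroup _

/-- The graded vector space `𝔞 = V' ⊕ S' ⊕ 𝔥`. -/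
abbrev Alg (o : M) : Type _ := V' g Φ o × S' P Φ o × h P Φ o

/-- The inclusion of `𝔞` in the Poincaré superalgebra. -/
def incl (o : M) : Alg P Φ o →ₗ[ℝ] Poincare g o :=
  (V' g Φ o).subtype.prodMap ((S' P Φ o).subtype.prodMap (h P Φ o).subtype)

/-- The filtration of `𝔨` at `o`: `𝔨 ⊇ 𝔨_o ⊕ 𝔨₁ ⊇ 𝔨_o ⊇ 0` in degrees `-2`, `-1`, `0`, `1`,
where `𝔨_o ⊆ 𝔨₀` consists of the vector fields vanishing at `o`. -/
def kFil (o : M) (i : ℤ) : Submodule ℝ (K P Φ) :=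
  if i ≤ -2 then ⊤
  else if i = -1 then Submodule.prod (LinearMap.ker ((evalVector o).comp (k0 g Φ).subtype)) ⊤
  else if i = 0 then Submodule.prod (LinearMap.ker ((evalVector o).comp (k0 g Φ).subtype)) ⊥
  else ⊥

/-- `Sig : V' → 𝔰𝔬(V)` is a splitting of `0 → 𝔥 → 𝔨₀ → V' → 0`: every `(v, Sig v)` is the value
`(ξ, A_ξ)|_o` of some `ξ ∈ 𝔨₀`. -/
def IsSplitting (o : M) (Sig : V' g Φ o →ₗ[ℝ] g.so o) : Prop :=
  ∀ v : V' g Φ o, ∃ ξ ∈ k0 g Φ, ξ o = (v : T o) ∧ P.aMap ξ o = Sig v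

/-- The bracket of `𝔨`, transported to `𝔞` by the linear isomorphism `f : 𝔞 → 𝔨` which a splitting
`Sig` defines, is the bracket `brA` of `𝔞` plus the terms
`α : ∧²V' → V'`, `β : V' ⊗ S' → S'`, `γ : ⊙²S' → 𝔥`, `lam : 𝔥 ⊗ V' → 𝔥` of degree 2 and
`δ : ∧²V' → 𝔥` of degree 4, where
`α(v, w) = Σ_v w - Σ_w v`, `β(v, s) = β_v s + σ(Σ_v) s`, `lam(A, v) = [A, Σ_v] - Σ_{A v}`,
`γ(s, s) v = -2 κ(β_v s, s) - Σ_{κ(s, s)} v`, `δ(v, w) = [Σ_v, Σ_w] + R(v, w) - Σ_{α(v, w)}`. -/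
def HasDeformedForm (o : M) (br : K P Φ →ₗ[ℝ] K P Φ →ₗ[ℝ] K P Φ)
    (brA : Alg P Φ o →ₗ[ℝ] Alg P Φ o →ₗ[ℝ] Alg P Φ o) (Sig : V' g Φ o →ₗ[ℝ] g.so o) : Prop :=
  ∃ (f : Alg P Φ o ≃ₗ[ℝ] K P Φ)
    (α : V' g Φ o →ₗ[ℝ] V' g Φ o →ₗ[ℝ] V' g Φ o)
    (β : V' g Φ o →ₗ[ℝ] S' P Φ o →ₗ[ℝ] S' P Φ o)
    (γ : S' P Φ o →ₗ[ℝ] S' P Φ o →ₗ[ℝ] h P Φ o)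
    (lam : h P Φ o →ₗ[ℝ] V' g Φ o →ₗ[ℝ] h P Φ o)
    (δ : V' g Φ o →ₗ[ℝ] V' g Φ o →ₗ[ℝ] h P Φ o),
    (∀ (v : V' g Φ o) (s : S' P Φ o) (A : h P Φ o), ((f (v, s, A)).1 : VField M) o = (v : T o) ∧
      P.aMap ((f (v, s, A)).1 : VField M) o = (A : g.so o) + Sig v ∧
      P.evalSpinor o (f (v, s, A)).2 = s) ∧
    (∀ v w : V' g Φ o, (α v w : T o) =
      (Sig v : Module.End ℝ (T o)) w - (Sig w : Module.End ℝ (T o)) v) ∧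
    (∀ (v : V' g Φ o) (s : S' P Φ o), (β v s : Spinor) = beta P Φ o v s + P.sigma o (Sig v) s) ∧
    (∀ (s t : S' P Φ o) (u : V' g Φ o), (u : T o) = P.kappa o s t → ∀ v : T o,
      ((γ s t : g.so o) : Module.End ℝ (T o)) v =
        -P.kappa o (beta P Φ o v s) t - P.kappa o s (beta P Φ o v t)
          - (Sig u : Module.End ℝ (T o)) v) ∧
    (∀ (A : h P Φ o) (v u : V' g Φ o), (u : T o) = ((A : g.so o) : Module.End ℝ (T o)) v →
      (lam A v : g.so o) = g.comm o A (Sig v) - Sig u) ∧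
    (∀ v w : V' g Φ o, ((δ v w : g.so o) : Module.End ℝ (T o)) =
      g.comm o (Sig v) (Sig w) + P.riemann o v w
        - Sig (α v w)) ∧
    ∀ x y : Alg P Φ o, f.symm (br (f x) (f y)) = brA x y +
      (α x.1 y.1, β x.1 y.2.1 - β y.1 x.2.1,
        lam x.2.2 y.1 - lam y.2.2 x.1 + γ x.2.1 y.2.1 + δ x.1 y.1)

/-- `𝔨₀` acts locally transitively around `o`: it spans the tangent space at all points of a
neighbourhood of `o`. -/
def LocallyTransitiveAround (g : LorentzMetric M) (Φ : Fields M) (o : M) : Prop :=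
  ∃ U ∈ 𝓝 o, ∀ p ∈ U, V' g Φ p = ⊤

end Killing
end KSA
end

noncomputable section

namespace KSA

section

/-! ### Clifford algebra of the model -/

/-! Three things carry the theorem: the brackets close on `k0` and `k1` and satisfy the super Jacobi
identity; an element of 𝔨 is determined by its value (X, ε, A_X) at one point; and on these values
the bracket is the Poincaré bracket plus terms of higher filtration degree.

Operators on spinors are compared by one principle, `eq_zero_of_commute_gamma` and its version for
fields `operator_eq_zero`. The commutant of the Clifford action is ℝ, and a scalar that is skew for
the symplectic form is zero; hence two operators obeying the same Leibniz rules for functions,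
Clifford multiplication and the pairing coincide. This shows that σ is a representation, that the
spin connection does not depend on the frame, that its curvature is σ(R), and that the Lie
derivative along a Killing vector is compatible with commutators and with ∇ (`sLie_lieV`,
`sLie_scov`). The even-even and even-odd brackets then close formally, because X ∈ 𝔨₀ preserves
everything from which ∇ − β is built.

The substantial point is that the current κ of a Killing spinor ε preserves g, a, b and φ
(`curr_self_mem_k0`). It is Killing because ⟨β_v s, v·t⟩ + ⟨s, v·β_v t⟩ = 0. For the other fields
one takes the integrability condition, in which σ(R(X, Y))ε equals the curvature of −β. In its
Clifford trace the Bianchi identity reduces the left side to a Ricci contraction acting as a vector;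
in the double trace the symmetry of that contraction leaves a scalar. Both disappear on pairing with
ε or with vol·ε, and what remains says precisely that κ annihilates a and b and commutes with φ.
Polarisation treats two spinors. The Jacobi identity of three odd elements reduces to the cubic
identity β_κ s + σ(A_κ)s = 0 with κ = κ(s, s).

Determination at a point is unique continuation. The components of ε, and those of the pair (X, ∇X),
solve closed first-order linear systems, so Grönwall's inequality makes their zero sets open, and M
is connected.

The evaluation `kEval` differs from a homomorphism only by β, γ and R, which raise the filtration
degree; so the leading symbols multiply as in 𝔞 (`IsFilteredHom.isFilteredDeformation`). A splitting
Σ embeds 𝔞 in the Poincaré superalgebra by adding Σ_v to the 𝔰𝔬-part, with the same image as 𝔨;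
reading off the components gives the deformed bracket.

For transitivity, dim S' is the same at all points. If the currents of S' did not span, some v ≠ 0
would be orthogonal to them all, so v· would map S' into its symplectic complement, which is smaller
than S'; then v· has a kernel and v is null. All currents κ(s, s) are null and orthogonal to v,
hence proportional to v, hence orthogonal to a spacelike u ⊥ v as well; the same argument makes u
null, a contradiction. -/

theorem gamma_zero_apply (s : Spinor) : gamma 0 s = ![s 3, s 2, -s 1, -s 0] := by
  ext i; fin_cases i <;>
    simp [gamma, gammaMatrix, Matrix.toLin'_apply, Matrix.mulVec, dotProduct, Fin.sum_univ_four]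

theorem gamma_one_apply (s : Spinor) : gamma 1 s = ![s 2, s 3, s 0, s 1] := by
  ext i; fin_cases i <;>
    simp [gamma, gammaMatrix, Matrix.toLin'_apply, Matrix.mulVec, dotProduct, Fin.sum_univ_four]

theorem gamma_two_apply (s : Spinor) : gamma 2 s = ![s 0, s 1, -s 2, -s 3] := by
  ext i; fin_cases i <;>
    simp [gamma, gammaMatrix, Matrix.toLin'_apply, Matrix.mulVec, dotProduct, Fin.sum_univ_four]

theorem gamma_three_apply (s : Spinor) : gamma 3 s = ![s 3, -s 2, -s 1, s 0] := by
  ext i; fin_cases i <;>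
    simp [gamma, gammaMatrix, Matrix.toLin'_apply, Matrix.mulVec, dotProduct, Fin.sum_univ_four]

theorem vol_apply (s : Spinor) : vol s = ![-s 2, s 3, s 0, -s 1] := by
  simp only [vol, Module.End.mul_apply, gamma_zero_apply, gamma_one_apply, gamma_two_apply,
    gamma_three_apply]
  ext i; fin_cases i <;> simp

theorem vol_gamma (μ : Fin 4) : vol * gamma μ = -(gamma μ * vol) := by
  refine LinearMap.ext fun s => ?_
  ext i
  fin_cases μ <;> fin_cases i <;>
    simp [gamma_zero_apply, gamma_one_apply, gamma_two_apply, gamma_three_apply, vol_apply]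

theorem vol_mul_vol : vol * vol = -1 := by
  refine LinearMap.ext fun s => ?_
  ext i
  fin_cases i <;> simp [vol_apply]

/-- An endomorphism of the spinor module which commutes with Clifford multiplication is a scalar. -/
theorem eq_smul_one_of_commute_gamma {t : Module.End ℝ Spinor}
    (ht : ∀ μ, t * gamma μ = gamma μ * t) : ∃ c : ℝ, t = c • 1 := by
  obtain ⟨A, rfl⟩ : ∃ A, t = Matrix.toLin' A := ⟨LinearMap.toMatrix' t, by simp⟩
  have key : ∀ μ i j, (A * gammaMatrix μ) i j = (gammaMatrix μ * A) i j := fun μ i j => by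
    have h := ht μ
    rw [gamma, Module.End.mul_eq_comp, Module.End.mul_eq_comp, ← Matrix.toLin'_mul,
      ← Matrix.toLin'_mul] at h
    rw [Matrix.toLin'.injective h]
  have k0 := fun i j => key 0 i j
  have k1 := fun i j => key 1 i j
  have k2 := fun i j => key 2 i j
  have k3 := fun i j => key 3 i j
  -- The commutation relations become linear equations in the sixteen entries of `A`, whose only
  -- solutions are multiples of the identity.
  simp [Matrix.mul_apply, Fin.sum_univ_four, gammaMatrix, Fin.forall_fin_succ] at k0 k1 k2 k3
  refine ⟨A 0 0, ?_⟩
  have hA : A = A 0 0 • 1 := by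
    ext i j
    fin_cases i <;> fin_cases j <;> simp <;> linarith
  conv_lhs => rw [hA]
  rw [map_smul, Matrix.toLin'_one]
  rfl

/-! ### The invariant symplectic form -/

namespace SpinorForm
variable (Ω : SpinorForm)

theorem neg (s t : Spinor) : Ω.form s t = -Ω.form t s := by
  have h := Ω.alt (s + t)
  simp only [map_add, LinearMap.add_apply, Ω.alt] at h
  linarith

/-- Moving four skew factors across gives the sign +1 and reverses their order; reversing four
anticommuting factors is an even permutation, so the product is `vol` again. -/
theorem form_vol (s t : Spinor) : Ω.form (vol s) t = Ω.form s (vol t) := by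
  have h : vol t = gamma 3 (gamma 2 (gamma 1 (gamma 0 t))) := by
    simp only [gamma_zero_apply, gamma_one_apply, gamma_two_apply, gamma_three_apply, vol_apply]
    ext i; fin_cases i <;> simp
  rw [h]
  simp only [vol, Module.End.mul_apply, Ω.clifford_skew, neg_neg]

/-- The symplectic form is a nonzero multiple of the standard one. -/
theorem exists_eq : ∃ c : ℝ, c ≠ 0 ∧ ∀ s t : Spinor,
    Ω.form s t = c * (s 2 * t 1 - s 1 * t 2 + s 3 * t 0 - s 0 * t 3) := by
  obtain ⟨w, hw⟩ : ∃ w : Fin 4 → Fin 4 → ℝ,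
      ∀ s t : Spinor, Ω.form s t = ∑ i, ∑ j, s i * t j * w i j := by
    refine ⟨fun i j => Ω.form (Pi.single i 1) (Pi.single j 1), fun s t => ?_⟩
    conv_lhs => rw [pi_eq_sum_univ' s, pi_eq_sum_univ' t]
    simp only [map_sum, map_smul, LinearMap.sum_apply, LinearMap.smul_apply, smul_eq_mul,
      Finset.mul_sum, mul_assoc]
    rw [Finset.sum_comm]
    exact Finset.sum_congr rfl fun i _ => Finset.sum_congr rfl fun j _ => mul_left_comm _ _ _
  -- Skewness of the four generators, tested on basis spinors, determines the Gram matrix `w` from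
  -- the single entry `w 2 1`.
  have hs := fun μ i j => Ω.clifford_skew μ (Pi.single i 1) (Pi.single j 1)
  have ha := fun i j => Ω.neg (Pi.single i 1) (Pi.single j 1)
  have hs0 := hs 0
  have hs1 := hs 1
  have hs2 := hs 2
  have hs3 := hs 3
  clear hs
  simp [Fin.forall_fin_succ, hw, Fin.sum_univ_four, gamma_zero_apply, gamma_one_apply,
    gamma_two_apply, gamma_three_apply] at hs0 hs1 hs2 hs3 ha
  have key : ∀ s t : Spinor,
      Ω.form s t = w 2 1 * (s 2 * t 1 - s 1 * t 2 + s 3 * t 0 - s 0 * t 3) := by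
    intro s t
    rw [hw]
    have hw' : ∀ i j, w i j = w 2 1 * (![![0, 0, 0, -1], ![0, 0, -1, 0], ![0, 1, 0, 0],
        ![1, 0, 0, 0]] i j : ℝ) := by
      intro i j
      fin_cases i <;> fin_cases j <;> simp <;> linarith
    simp only [Fin.sum_univ_four]
    rw [hw' 0 0, hw' 0 1, hw' 0 2, hw' 0 3, hw' 1 0, hw' 1 1, hw' 1 2, hw' 1 3, hw' 2 0,
      hw' 2 2, hw' 2 3, hw' 3 0, hw' 3 1, hw' 3 2, hw' 3 3]
    simp
    ring
  refine ⟨w 2 1, fun h0 => ?_, key⟩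
  have h1 := Ω.nondeg (Pi.single 0 1) fun t => by rw [key, h0, zero_mul]
  simpa using congrFun h1 0

end SpinorForm

/-- Commutant uniqueness: a skew endomorphism commuting with Clifford multiplication vanishes. -/
theorem eq_zero_of_commute_gamma (Ω : SpinorForm) {t : Module.End ℝ Spinor}
    (ht : ∀ μ, t * gamma μ = gamma μ * t) (hΩ : ∀ s s', Ω.form (t s) s' + Ω.form s (t s') = 0) :
    t = 0 := by
  obtain ⟨c, rfl⟩ := eq_smul_one_of_commute_gamma ht
  obtain ⟨k, hk, h⟩ := Ω.exists_eq
  -- For a scalar c, skewness reads 2c·Ω(s, s') = 0, and these two basis spinors have a nonzero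
  -- pairing.
  have h1 := hΩ (Pi.single 3 1) (Pi.single 0 1)
  simp [h] at h1
  have : c = 0 := by
    have : c * k = 0 := by linarith
    simpa [hk] using this
  simp [this]

/-! ### Vectors and the spin representation in components -/

/-- Clifford multiplication by a vector given by its components. -/
def clM (v : Fin 4 → ℝ) : Module.End ℝ Spinor := ∑ μ, v μ • gamma μ

theorem clM_apply (v : Fin 4 → ℝ) (s : Spinor) : clM v s =
    ![v 0 * s 3 + v 1 * s 2 + v 2 * s 0 + v 3 * s 3, v 0 * s 2 + v 1 * s 3 + v 2 * s 1 - v 3 * s 2,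
      -(v 0 * s 1) + v 1 * s 0 - v 2 * s 2 - v 3 * s 1,
      -(v 0 * s 0) + v 1 * s 1 - v 2 * s 3 + v 3 * s 0] := by
  simp only [clM, Fin.sum_univ_four, LinearMap.add_apply, LinearMap.smul_apply, gamma_zero_apply,
    gamma_one_apply, gamma_two_apply, gamma_three_apply]
  ext i
  fin_cases i <;> simp <;> ring

/-- The Minkowski inner product. -/
def etaM (v w : Fin 4 → ℝ) : ℝ := ∑ μ, mink μ * v μ * w μ

theorem clM_anticomm (v w : Fin 4 → ℝ) :
    clM v * clM w + clM w * clM v = (-2 * etaM v w) • 1 := by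
  refine LinearMap.ext fun s => ?_
  ext i
  fin_cases i <;> simp [clM_apply, etaM, mink, Fin.sum_univ_four] <;> ring

theorem vol_clM (v : Fin 4 → ℝ) : vol * clM v = -(clM v * vol) := by
  simp only [clM, Finset.mul_sum, Finset.sum_mul, mul_smul_comm, smul_mul_assoc, vol_gamma,
    smul_neg, Finset.sum_neg_distrib]

theorem SpinorForm.form_clM (Ω : SpinorForm) (v : Fin 4 → ℝ) (s t : Spinor) :
    Ω.form (clM v s) t = -Ω.form s (clM v t) := by
  simp only [clM, LinearMap.sum_apply, LinearMap.smul_apply, map_sum, map_smul, Ω.clifford_skew,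
    smul_neg, Finset.sum_neg_distrib]

/-- The spin representation of an endomorphism, `A μ` being the components of the image of the
`μ`-th basis vector. -/
def sgM (A : Fin 4 → Fin 4 → ℝ) : Module.End ℝ Spinor :=
  (8 : ℝ)⁻¹ • ∑ μ, mink μ • (gamma μ * clM (A μ) - clM (A μ) * gamma μ)

theorem SpinorForm.form_sgM (Ω : SpinorForm) (A : Fin 4 → Fin 4 → ℝ) (s t : Spinor) :
    Ω.form (sgM A s) t = -Ω.form s (sgM A t) := by
  simp only [sgM, LinearMap.sum_apply, LinearMap.smul_apply, map_sum, map_smul,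
    LinearMap.sub_apply, Module.End.mul_apply, map_sub, Ω.clifford_skew, Ω.form_clM, neg_neg,
    ← smul_neg, ← Finset.sum_neg_distrib, neg_sub]

/-- The relation [σ(A), v] = A v that characterises the spin representation. `hA` is skewness with
the index lowered by the metric, so only six entries of `A` are independent and the identity is
checked entrywise. -/
theorem sgM_clM {A : Fin 4 → Fin 4 → ℝ} (hA : ∀ μ ν, mink ν * A μ ν = -(mink μ * A ν μ))
    (v : Fin 4 → ℝ) :
    sgM A * clM v - clM v * sgM A = clM fun ν => ∑ μ, v μ * A μ ν := by
  have h := fun μ ν => hA μ ν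
  simp [mink, Fin.forall_fin_succ] at h
  have h00 : A 0 0 = 0 := by linarith
  have h11 : A 1 1 = 0 := by linarith
  have h22 : A 2 2 = 0 := by linarith
  have h33 : A 3 3 = 0 := by linarith
  have h10 : A 1 0 = A 0 1 := by linarith
  have h20 : A 2 0 = A 0 2 := by linarith
  have h30 : A 3 0 = A 0 3 := by linarith
  have h21 : A 2 1 = -A 1 2 := by linarith
  have h31 : A 3 1 = -A 1 3 := by linarith
  have h32 : A 3 2 = -A 2 3 := by linarith
  refine LinearMap.ext fun s => ?_
  ext i
  fin_cases i <;>
  · simp [sgM, clM_apply, Fin.sum_univ_four, gamma_zero_apply, gamma_one_apply,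
      gamma_two_apply, gamma_three_apply, mink, h00, h11, h22, h33, h10, h20, h30, h21, h31, h32]
    ring

end

section

/-! ### Pointwise geometry of a Lorentzian metric -/

variable {M : Type*} [TopologicalSpace M] [ChartedSpace E4 M]

theorem finrank_tangent (x : M) : Module.finrank ℝ (T x) = 4 :=
  (finrank_euclideanSpace_fin : Module.finrank ℝ E4 = 4)

instance (x : M) : FiniteDimensional ℝ (T x) := inferInstanceAs (FiniteDimensional ℝ E4)

variable [IsManifold (𝓡 4) ∞ M]

theorem mink_mul_self (μ : Fin 4) : mink μ * mink μ = 1 := by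
  fin_cases μ <;> simp [mink]

theorem mink_ne_zero (μ : Fin 4) : mink μ ≠ 0 := by
  fin_cases μ <;> simp [mink]

/-- Four tangent vectors form an orthonormal frame. -/
def LorentzMetric.IsONFrame (g : LorentzMetric M) {x : M} (f : Fin 4 → T x) : Prop :=
  ∀ μ ν, g.val x (f μ) (f ν) = if μ = ν then mink μ else 0

/-- The components of a tangent vector in an orthonormal frame. -/
def LorentzMetric.cmp (g : LorentzMetric M) {x : M} (f : Fin 4 → T x) (v : T x) (μ : Fin 4) : ℝ :=
  mink μ * g.val x v (f μ)

namespace LorentzMetric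
variable {g : LorentzMetric M} {x : M} {f : Fin 4 → T x}

@[simp] theorem cmp_add (v w : T x) (μ : Fin 4) :
    g.cmp f (v + w) μ = g.cmp f v μ + g.cmp f w μ := by
  simp [cmp, mul_add]

@[simp] theorem cmp_smul (c : ℝ) (v : T x) (μ : Fin 4) :
    g.cmp f (c • v) μ = c * g.cmp f v μ := by
  simp [cmp, mul_left_comm]

@[simp] theorem cmp_sub (v w : T x) (μ : Fin 4) :
    g.cmp f (v - w) μ = g.cmp f v μ - g.cmp f w μ := by
  simp [cmp, mul_sub]

@[simp] theorem cmp_zero (μ : Fin 4) : g.cmp f (0 : T x) μ = 0 := by simp [cmp]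

theorem cmp_sum {κ : Type*} (s : Finset κ) (v : κ → T x) (μ : Fin 4) :
    g.cmp f (∑ i ∈ s, v i) μ = ∑ i ∈ s, g.cmp f (v i) μ := by
  simp [cmp, Finset.mul_sum]

theorem IsONFrame.cmp_self (hf : g.IsONFrame f) (μ ν : Fin 4) :
    g.cmp f (f μ) ν = if μ = ν then 1 else 0 := by
  rw [cmp, hf]
  split_ifs with h
  · rw [h, mink_mul_self]
  · simp

theorem IsONFrame.linearIndependent (hf : g.IsONFrame f) : LinearIndependent ℝ f := by
  rw [Fintype.linearIndependent_iff]
  intro c hc μ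
  have h := congrArg (fun v => g.cmp f v μ) hc
  simpa [cmp_sum, hf.cmp_self] using h

theorem IsONFrame.sum_cmp (hf : g.IsONFrame f) (v : T x) : ∑ μ, g.cmp f v μ • f μ = v := by
  have hb : ⊤ ≤ Submodule.span ℝ (Set.range f) :=
    (hf.linearIndependent.span_eq_top_of_card_eq_finrank
      (by rw [finrank_tangent, Fintype.card_fin])).ge
  obtain ⟨c, rfl⟩ := (Submodule.mem_span_range_iff_exists_fun ℝ).1 (hb (Submodule.mem_top (x := v)))
  refine Finset.sum_congr rfl fun μ _ => ?_
  congr 1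
  simp [cmp_sum, hf.cmp_self]

theorem IsONFrame.ext (hf : g.IsONFrame f) {v w : T x} (h : ∀ μ, g.cmp f v μ = g.cmp f w μ) :
    v = w := by
  rw [← hf.sum_cmp v, ← hf.sum_cmp w]
  simp only [h]

theorem IsONFrame.val_eq (hf : g.IsONFrame f) (v w : T x) :
    g.val x v w = etaM (g.cmp f v) (g.cmp f w) := by
  conv_lhs => rw [← hf.sum_cmp w]
  simp only [map_sum, map_smul, smul_eq_mul, etaM]
  refine Finset.sum_congr rfl fun μ _ => ?_
  rw [cmp, cmp, ← mul_assoc, ← mul_assoc, mink_mul_self, one_mul]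
  ring

theorem val_left (v : T x) (μ : Fin 4) :
    g.val x v (f μ) = mink μ * g.cmp f v μ := by
  rw [cmp, ← mul_assoc, mink_mul_self, one_mul]

theorem eq_of_val (v w : T x) (h : ∀ u, g.val x v u = g.val x w u) : v = w := by
  obtain ⟨f, hf⟩ := g.signature x
  exact IsONFrame.ext (f := f) hf fun μ => by simp [cmp, h]

/-- The metric recovers a vector from its inner products with an orthonormal frame. -/
theorem IsONFrame.eq_sum (hf : g.IsONFrame f) {v : T x} {c : Fin 4 → ℝ}
    (h : ∀ μ, g.val x v (f μ) = c μ) : v = ∑ μ, (mink μ * c μ) • f μ := by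
  rw [← hf.sum_cmp v]
  simp [cmp, h]

theorem bilin_apply (v w : T x) : g.bilin x v w = g.val x v w := rfl

theorem mem_so {A : Module.End ℝ (T x)} :
    A ∈ g.so x ↔ ∀ v w, g.val x (A v) w = -g.val x v (A w) := Iff.rfl

/-- Components of a skew endomorphism are skew. -/
theorem cmp_skew {A : Fin 4 → T x}
    (hA : ∀ μ ν, g.val x (A μ) (f ν) = -g.val x (f μ) (A ν)) (μ ν : Fin 4) :
    mink ν * g.cmp f (A μ) ν = -(mink μ * g.cmp f (A ν) μ) := by
  rw [← val_left, ← val_left, hA, g.symm]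

end LorentzMetric

/-! ### Clifford action, spin representation and Dirac current on a fibre -/

namespace SpinStructure
variable {g : LorentzMetric M} {Ω : SpinorForm} {ι : Type*} (P : SpinStructure g Ω ι)

theorem isONFrame {i : ι} {x : M} (hx : x ∈ P.baseSet i) :
    g.IsONFrame (fun μ => P.frame i μ x) := P.orthonormal i x hx

theorem isONFrame_e (x : M) : g.IsONFrame (fun μ => P.e x μ x) :=
  P.orthonormal _ x (P.mem_baseSet_at x)

theorem coord_apply (x : M) (μ : Fin 4) (v : T x) :
    P.coord x μ v = g.cmp (fun μ => P.e x μ x) v μ := by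
  simp [coord, LorentzMetric.cmp, LorentzMetric.bilin_apply, g.symm x v]

theorem cliff_apply (x : M) (v : T x) :
    P.cliff x v = clM (g.cmp (fun μ => P.e x μ x) v) := by
  simp [cliff, clM, coord_apply]

theorem sum_coord (x : M) (v : T x) : ∑ μ, P.coord x μ v • P.e x μ x = v := by
  simp only [coord_apply]
  exact (P.isONFrame_e x).sum_cmp v

theorem cliff_e (x : M) (μ : Fin 4) : P.cliff x (P.e x μ x) = gamma μ := by
  rw [cliff_apply, clM]
  have h := (P.isONFrame_e x).cmp_self μ
  simp [h]

theorem sigma_apply (x : M) (A : Module.End ℝ (T x)) :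
    P.sigma x A = sgM (fun μ => g.cmp (fun μ => P.e x μ x) (A (P.e x μ x))) := by
  simp only [sigma, sgM, cliff_apply]
  rfl

theorem cliff_anticomm (x : M) (v w : T x) :
    P.cliff x v * P.cliff x w + P.cliff x w * P.cliff x v = (-2 * g.val x v w) • 1 := by
  rw [cliff_apply, cliff_apply, clM_anticomm, (P.isONFrame_e x).val_eq]

theorem vol_cliff (x : M) (v : T x) : vol * P.cliff x v = -(P.cliff x v * vol) := by
  rw [cliff_apply, vol_clM]

theorem form_cliff (x : M) (v : T x) (s t : Spinor) :
    Ω.form (P.cliff x v s) t = -Ω.form s (P.cliff x v t) := by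
  rw [cliff_apply, Ω.form_clM]

theorem form_sigma (x : M) (A : Module.End ℝ (T x)) (s t : Spinor) :
    Ω.form (P.sigma x A s) t = -Ω.form s (P.sigma x A t) := by
  rw [sigma_apply, Ω.form_sgM]

theorem cmp_map {x : M} {f : Fin 4 → T x} (hf : g.IsONFrame f) (A : Module.End ℝ (T x)) (v : T x)
    (ν : Fin 4) : g.cmp f (A v) ν = ∑ μ, g.cmp f v μ * g.cmp f (A (f μ)) ν := by
  conv_lhs => rw [← hf.sum_cmp v]
  simp [LorentzMetric.cmp_sum]

theorem sigma_cliff {x : M} {A : Module.End ℝ (T x)} (hA : A ∈ g.so x) (v : T x) :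
    P.sigma x A * P.cliff x v - P.cliff x v * P.sigma x A = P.cliff x (A v) := by
  rw [sigma_apply, cliff_apply, cliff_apply, sgM_clM]
  · congr 1
    ext ν
    rw [cmp_map (P.isONFrame_e x)]
  · exact LorentzMetric.cmp_skew fun μ ν => hA _ _

theorem sigma_cliff_apply {x : M} {A : Module.End ℝ (T x)} (hA : A ∈ g.so x) (v : T x)
    (s : Spinor) :
    P.sigma x A (P.cliff x v s) = P.cliff x (A v) s + P.cliff x v (P.sigma x A s) := by
  rw [← P.sigma_cliff hA v]
  simp

theorem vol_cliff_apply (x : M) (v : T x) (s : Spinor) :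
    vol (P.cliff x v s) = -P.cliff x v (vol s) := LinearMap.congr_fun (P.vol_cliff x v) s

/-- `vol` anticommutes with vectors, hence commutes with the products of two vectors that make up σ.
-/
theorem sigma_vol {x : M} (A : Module.End ℝ (T x)) (s : Spinor) :
    P.sigma x A (vol s) = vol (P.sigma x A s) := by
  have h : ∀ μ, gamma μ = P.cliff x (P.e x μ x) := fun μ => (P.cliff_e x μ).symm
  simp only [sigma, LinearMap.coe_mk, AddHom.coe_mk, h, LinearMap.smul_apply, LinearMap.sum_apply,
    LinearMap.sub_apply, Module.End.mul_apply, map_smul, map_sum, map_sub, vol_cliff_apply,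
    map_neg, neg_neg]

/-- A skew endomorphism of the spinors at `x` commuting with Clifford multiplication vanishes. -/
theorem eq_zero_of_commute_cliff (x : M) {t : Module.End ℝ Spinor}
    (ht : ∀ v, t * P.cliff x v = P.cliff x v * t)
    (hΩ : ∀ s s', Ω.form (t s) s' + Ω.form s (t s') = 0) : t = 0 :=
  eq_zero_of_commute_gamma Ω (fun μ => by rw [← P.cliff_e x μ, ht]) hΩ

theorem val_kappa (x : M) (s t : Spinor) (v : T x) :
    g.val x (P.kappa x s t) v = Ω.form s (P.cliff x v t) := by
  simp only [kappa, LinearMap.mk₂_apply, map_sum, map_smul, cliff, LinearMap.sum_apply,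
    LinearMap.smulRight_apply, LinearMap.smul_apply, _root_.sum_apply, _root_.smul_apply,
    smul_eq_mul]
  refine Finset.sum_congr rfl fun μ _ => ?_
  simp only [coord, LinearMap.smul_apply, smul_eq_mul, LorentzMetric.bilin_apply]
  ring

theorem kappa_symm (x : M) (s t : Spinor) : P.kappa x s t = P.kappa x t s :=
  LorentzMetric.eq_of_val _ _ fun v => by
    rw [val_kappa, val_kappa, Ω.neg, form_cliff, neg_neg]

/-- Equivariance of the Dirac current. -/
theorem map_kappa {x : M} {A : Module.End ℝ (T x)} (hA : A ∈ g.so x) (s t : Spinor) :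
    A (P.kappa x s t) = P.kappa x (P.sigma x A s) t + P.kappa x s (P.sigma x A t) :=
  LorentzMetric.eq_of_val _ _ fun v => by
    rw [LorentzMetric.mem_so.1 hA, map_add, _root_.add_apply, val_kappa, val_kappa, val_kappa,
      form_sigma, sigma_cliff_apply P hA, map_add]
    ring

/-- The spin representation is a Lie algebra homomorphism. -/
theorem sigma_comm (x : M) (A B : g.so x) :
    P.sigma x (g.comm x A B) = P.sigma x A * P.sigma x B - P.sigma x B * P.sigma x A := by
  -- Both sides are skew and have the same commutator [A, B]v with Clifford multiplication by v, so
  -- their difference lies in the trivial skew commutant.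
  rw [← sub_eq_zero]
  refine P.eq_zero_of_commute_cliff x (fun v => ?_) fun s s' => ?_
  · refine LinearMap.ext fun s => ?_
    have h0 := P.sigma_cliff_apply (g.comm x A B).2 v s
    have h3 : ((g.comm x A B : g.so x) : Module.End ℝ (T x)) v =
      (A : Module.End ℝ (T x)) ((B : Module.End ℝ (T x)) v)
        - (B : Module.End ℝ (T x)) ((A : Module.End ℝ (T x)) v) := rfl
    rw [h3, map_sub] at h0
    simp only [Module.End.mul_apply, LinearMap.sub_apply, h0, P.sigma_cliff_apply A.2,
      P.sigma_cliff_apply B.2, map_sub, map_add]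
    abel
  · simp only [LinearMap.sub_apply, Module.End.mul_apply, map_sub, form_sigma]
    ring

theorem cliff_swap (x : M) (v w : T x) (s : Spinor) : P.cliff x v (P.cliff x w s) =
    -P.cliff x w (P.cliff x v s) - (2 * g.val x v w) • s := by
  have h := LinearMap.congr_fun (P.cliff_anticomm x v w) s
  simp only [LinearMap.add_apply, Module.End.mul_apply, LinearMap.smul_apply,
    Module.End.one_apply] at h
  rw [eq_sub_of_add_eq h]
  module

/-- The double commutator [[u, w], v] is again a vector. In `sigma_eq_of_frame` its two terms,
traced over a frame, give 4 + 4 = 8 copies of A v, which accounts for the factor 8⁻¹ in σ. -/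
theorem cliff_commutator_cliff (x : M) (u w v : T x) (s : Spinor) :
    (P.cliff x u (P.cliff x w (P.cliff x v s)) - P.cliff x w (P.cliff x u (P.cliff x v s)))
      - P.cliff x v (P.cliff x u (P.cliff x w s) - P.cliff x w (P.cliff x u s)) =
    (4 * g.val x u v) • P.cliff x w s - (4 * g.val x w v) • P.cliff x u s := by
  rw [P.cliff_swap x w v s, P.cliff_swap x u v s]
  simp only [map_sub, map_neg, map_smul]
  rw [P.cliff_swap x u v, P.cliff_swap x w v]
  module

/-- The spin representation computed in any orthonormal frame. -/
theorem sigma_eq_of_frame {x : M} {f : Fin 4 → T x} (hf : g.IsONFrame f)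
    {A : Module.End ℝ (T x)} (hA : A ∈ g.so x) :
    P.sigma x A = (8 : ℝ)⁻¹ • ∑ μ, mink μ • (P.cliff x (f μ) * P.cliff x (A (f μ))
      - P.cliff x (A (f μ)) * P.cliff x (f μ)) := by
  rw [← sub_eq_zero]
  set R := (8 : ℝ)⁻¹ • ∑ μ, mink μ • (P.cliff x (f μ) * P.cliff x (A (f μ))
      - P.cliff x (A (f μ)) * P.cliff x (f μ)) with hR
  have hRs : ∀ s, R s = (8 : ℝ)⁻¹ • ∑ μ, mink μ • (P.cliff x (f μ) (P.cliff x (A (f μ)) s)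
      - P.cliff x (A (f μ)) (P.cliff x (f μ) s)) := fun s => by
    simp [hR]
  -- It suffices that the frame expression obeys [R, v] = A v: among skew operators this relation
  -- characterises σ(A).
  have key : ∀ v s, R (P.cliff x v s) - P.cliff x v (R s) = P.cliff x (A v) s := fun v s => by
    have h1 : ∑ μ, (mink μ * g.val x (f μ) v) • P.cliff x (A (f μ)) s = P.cliff x (A v) s := by
      conv_rhs => rw [← hf.sum_cmp v]
      simp [LorentzMetric.cmp, g.symm x v]
    have h2 : ∑ μ, (mink μ * g.val x (A (f μ)) v) • P.cliff x (f μ) s = -P.cliff x (A v) s := by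
      conv_rhs => rw [← hf.sum_cmp (A v)]
      simp only [LorentzMetric.cmp, map_sum, map_smul, LinearMap.sum_apply, LinearMap.smul_apply,
        ← Finset.sum_neg_distrib]
      refine Finset.sum_congr rfl fun μ _ => ?_
      rw [LorentzMetric.mem_so.1 hA, g.symm x (f μ), mul_neg, neg_smul]
    rw [hRs, hRs, map_smul, map_sum, ← smul_sub, ← Finset.sum_sub_distrib]
    simp only [map_smul, ← smul_sub, P.cliff_commutator_cliff x]
    have h3 : ∀ μ, mink μ • ((4 * g.val x (f μ) v) • P.cliff x (A (f μ)) s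
        - (4 * g.val x (A (f μ)) v) • P.cliff x (f μ) s) =
        (4 : ℝ) • ((mink μ * g.val x (f μ) v) • P.cliff x (A (f μ)) s)
        - (4 : ℝ) • ((mink μ * g.val x (A (f μ)) v) • P.cliff x (f μ) s) := fun μ => by module
    simp only [h3]
    rw [Finset.sum_sub_distrib, ← Finset.smul_sum, ← Finset.smul_sum, h1, h2]
    module
  refine P.eq_zero_of_commute_cliff x (fun v => LinearMap.ext fun s => ?_) fun s s' => ?_
  · have h1 := P.sigma_cliff_apply hA v s
    have h2 := key v s
    simp only [Module.End.mul_apply, LinearMap.sub_apply, map_sub, h1, ← h2]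
    abel
  · have hΩ : Ω.form (R s) s' = -Ω.form s (R s') := by
      simp only [hRs, map_sum, map_smul, LinearMap.sum_apply, LinearMap.smul_apply,
        map_sub, LinearMap.sub_apply, form_cliff, neg_neg,
        ← smul_neg, ← Finset.sum_neg_distrib, neg_sub]
    simp only [LinearMap.sub_apply, map_sub, form_sigma, hΩ]
    ring

end SpinStructure

end

section

variable {M : Type*} [TopologicalSpace M] [ChartedSpace E4 M]

/-! ### Smooth functions and smooth sections -/

/-- Smooth functions. -/
abbrev CF (M : Type*) [TopologicalSpace M] [ChartedSpace E4 M] : Type _ := C^∞⟮𝓡 4, M; ℝ⟯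

theorem natCast_le_infty (n : ℕ) [n.AtLeastTwo] : (OfNat.ofNat n : ℕ∞ω) ≤ ∞ := by
  have : ((n : ℕ∞) : ℕ∞ω) ≤ ∞ := WithTop.coe_le_coe.2 le_top
  exact this

theorem mvfderiv_congr {F : Type*} [NormedAddCommGroup F] [NormedSpace ℝ F] {x : M} {f f' : M → F}
    (h : f =ᶠ[𝓝 x] f') : mvfderiv (𝓡 4) f x = mvfderiv (𝓡 4) f' x := by
  ext v
  have := h.mfderiv_eq (I := 𝓡 4) (I' := 𝓘(ℝ, F))
  exact congrArg (fun L : E4 →L[ℝ] F => L v) this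

theorem contMDiffAt_of_eventuallyEq {F : Type*} [NormedAddCommGroup F] [NormedSpace ℝ F]
    {V : M → Type*} [TopologicalSpace (TotalSpace F V)] [∀ x, TopologicalSpace (V x)]
    [FiberBundle F V] {s : ∀ x, V x} {x : M} (σ : ContMDiffSection (𝓡 4) F ∞ V)
    (h : ∀ᶠ y in 𝓝 x, s y = σ y) :
    ContMDiffAt (𝓡 4) ((𝓡 4).prod 𝓘(ℝ, F)) ∞ (fun y => TotalSpace.mk' F y (s y)) x :=
  (σ.contMDiff x).congr_of_eventuallyEq (h.mono fun y hy => congrArg (TotalSpace.mk' F y) hy)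

section Sections

variable {F : Type*} [NormedAddCommGroup F] [NormedSpace ℝ F] {V : M → Type*}
  [TopologicalSpace (TotalSpace F V)] [∀ x, TopologicalSpace (V x)] [FiberBundle F V]
  [∀ x, AddCommGroup (V x)] [∀ x, Module ℝ (V x)] [VectorBundle ℝ F V]

instance : SMul (CF M) (ContMDiffSection (𝓡 4) F ∞ V) :=
  ⟨fun f s => ⟨fun x => f x • s x, f.contMDiff.smul_section s.contMDiff⟩⟩

@[simp] theorem fsmul_apply (f : CF M) (s : ContMDiffSection (𝓡 4) F ∞ V) (x : M) :
    (f • s) x = f x • s x := rfl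

instance : Module (CF M) (ContMDiffSection (𝓡 4) F ∞ V) where
  one_smul s := by ext1 x; exact one_smul _ _
  mul_smul f f' s := by ext1 x; exact mul_smul _ _ _
  smul_zero f := by ext1 x; exact smul_zero _
  smul_add f s t := by ext1 x; exact smul_add _ _ _
  add_smul f f' s := by ext1 x; exact add_smul _ _ _
  zero_smul s := by ext1 x; exact zero_smul _ _

theorem section_sum_apply {κ : Type*} (s : Finset κ) (σ : κ → ContMDiffSection (𝓡 4) F ∞ V)
    (y : M) : (∑ i ∈ s, σ i) y = ∑ i ∈ s, σ i y :=
  map_sum (⟨⟨fun σ : ContMDiffSection (𝓡 4) F ∞ V => σ y, rfl⟩, fun _ _ => rfl⟩ :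
    ContMDiffSection (𝓡 4) F ∞ V →+ V y) _ _

theorem CF.mdiff (f : CF M) (x : M) : MDifferentiableAt (𝓡 4) 𝓘(ℝ, ℝ) f x :=
  (f.contMDiff x).mdifferentiableAt (by simp)

variable [IsManifold (𝓡 4) ∞ M]

theorem exists_bump [T2Space M] {x : M} {U : Set M} (hU : U ∈ 𝓝 x) :
    ∃ χ : CF M, χ =ᶠ[𝓝 x] 1 ∧ tsupport χ ⊆ U := by
  obtain ⟨f, -, hf⟩ := (SmoothBumpFunction.nhds_basis_tsupport (I := 𝓡 4) x).mem_iff.1 hU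
  exact ⟨⟨f, f.contMDiff⟩, f.eventuallyEq_one, hf⟩

/-- A local smooth section agrees near each point with a global one. -/
theorem exists_section_eventuallyEq [T2Space M] {s : ∀ x, V x} {U : Set M} (hU : IsOpen U)
    (hs : ContMDiffOn (𝓡 4) ((𝓡 4).prod 𝓘(ℝ, F)) ∞ (fun x => TotalSpace.mk' F x (s x)) U)
    {x : M} (hx : x ∈ U) :
    ∃ σ : ContMDiffSection (𝓡 4) F ∞ V, ∀ᶠ y in 𝓝 x, σ y = s y := by
  obtain ⟨χ, h1, h2⟩ := exists_bump (hU.mem_nhds hx)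
  refine ⟨⟨(χ : M → ℝ) • s, ContMDiffOn.smul_section_of_tsupport χ.contMDiff.contMDiffOn hU h2 hs⟩, ?_⟩
  filter_upwards [h1] with y hy
  change χ y • s y = s y
  rw [hy, Pi.one_apply, one_smul]

/-- An operation on global sections which is linear over smooth functions at `x` vanishes on
sections vanishing at `x`, given finitely many local sections spanning all others. -/
theorem map_eq_zero_of_linear [T2Space M] {κ : Type*} [Fintype κ] {A : Type*} [AddCommGroup A]
    [Module ℝ A] {U : Set M} (hU : IsOpen U) {x : M} (hx : x ∈ U) {b : κ → ∀ x, V x}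
    (hb : ∀ i, ContMDiffOn (𝓡 4) ((𝓡 4).prod 𝓘(ℝ, F)) ∞ (fun x => TotalSpace.mk' F x (b i x)) U)
    (Ψ : ContMDiffSection (𝓡 4) F ∞ V → A) (hadd : ∀ s t, Ψ (s + t) = Ψ s + Ψ t)
    (hsmul : ∀ (f : CF M) s, Ψ (f • s) = f x • Ψ s)
    (σ : ContMDiffSection (𝓡 4) F ∞ V) {c : κ → M → ℝ}
    (hc : ∀ i, ContMDiffOn (𝓡 4) 𝓘(ℝ, ℝ) ∞ (c i) U)
    (hσ : ∀ y ∈ U, σ y = ∑ i, c i y • b i y) (h0 : ∀ i, c i x = 0) : Ψ σ = 0 := by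
  obtain ⟨χ, h1, h2⟩ := exists_bump (hU.mem_nhds hx)
  have hχx : χ x = 1 := h1.self_of_nhds
  let cc : κ → CF M := fun i => ⟨fun y => χ y * c i y, by
    have := ContMDiffOn.smul_section_of_tsupport (V := Trivial M ℝ) (F := ℝ) (s := c i)
      χ.contMDiff.contMDiffOn hU h2 (by
        intro y hy
        rw [contMDiffWithinAt_totalSpace]
        exact ⟨contMDiffWithinAt_id, hc i y hy⟩)
    intro y
    have h := this y
    rw [contMDiffAt_totalSpace] at h
    exact h.2⟩
  let bb : κ → ContMDiffSection (𝓡 4) F ∞ V := fun i => ⟨(χ : M → ℝ) • b i,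
    ContMDiffOn.smul_section_of_tsupport χ.contMDiff.contMDiffOn hU h2 (hb i)⟩
  have hΨ0 : Ψ 0 = 0 := by simpa using hadd 0 0
  have hsum : ∀ s : Finset κ, Ψ (∑ i ∈ s, cc i • bb i) = ∑ i ∈ s, cc i x • Ψ (bb i) := by
    classical
    intro s
    induction s using Finset.induction_on with
    | empty => simpa using hΨ0
    | insert a s ha ih => rw [Finset.sum_insert ha, Finset.sum_insert ha, hadd, ih, hsmul]
  -- One cutoff factor globalises the coefficients and the other the local frame; neither changes
  -- the value at x, where χ = 1.
  have heq : χ • χ • σ = ∑ i, cc i • bb i := by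
    ext y
    rw [section_sum_apply]
    by_cases hy : y ∈ U
    · change χ y • χ y • σ y = ∑ i, (χ y * c i y) • χ y • b i y
      rw [hσ y hy, Finset.smul_sum, Finset.smul_sum]
      exact Finset.sum_congr rfl fun i _ => by module
    · have : χ y = 0 := image_eq_zero_of_notMem_tsupport fun h => hy (h2 h)
      change χ y • χ y • σ y = ∑ i, (χ y * c i y) • χ y • b i y
      simp [this]
  have h3 : Ψ (χ • χ • σ) = Ψ σ := by rw [hsmul, hsmul, hχx, one_smul, one_smul]
  rw [← h3, heq, hsum]
  refine Finset.sum_eq_zero fun i _ => ?_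
  have : cc i x = χ x * c i x := rfl
  rw [this, h0, mul_zero, zero_smul]

end Sections

/-! ### Vector fields -/

section

variable [IsManifold (𝓡 4) ∞ M]
variable (X Y Z : VField M) (f f' : CF M) (x : M)

/-- The directional derivative of a function along a vector field. -/
def dirD : CF M := ⟨fun x => mvfderiv (𝓡 4) f x (X x), by
  have h := (f.contMDiff.contMDiff_tangentMap (m := ∞) (by simp)).comp X.contMDiff
  exact (contMDiff_snd_tangentBundle_modelSpace ℝ 𝓘(ℝ, ℝ)).comp h⟩

/-- The commutator of vector fields. -/
def lieV : VField M := ⟨fun x => VectorField.mlieBracket (𝓡 4) X Y x, fun x => by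
  have : IsManifold (𝓡 4) (((⊤ : ℕ∞) : ℕ∞ω) + 1) M := by simpa using ‹IsManifold (𝓡 4) ∞ M›
  have : IsManifold (𝓡 4) (minSmoothness ℝ 2) M :=
    IsManifold.of_le (n := ∞) (by simpa using natCast_le_infty 2)
  exact ContMDiffAt.mlieBracket_vectorField (n := ⊤) (m := ⊤) (X.contMDiff x) (Y.contMDiff x)
    (by simp)⟩

theorem dirD_apply : dirD X f x = mvfderiv (𝓡 4) f x (X x) := rfl

@[simp] theorem dirD_add : dirD X (f + f') = dirD X f + dirD X f' := by
  ext x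
  change mvfderiv (𝓡 4) (⇑f + ⇑f') x (X x) = _
  rw [mvfderiv_add (CF.mdiff f x) (CF.mdiff f' x)]
  rfl

@[simp] theorem dirD_sub : dirD X (f - f') = dirD X f - dirD X f' := by
  ext x
  change mvfderiv (𝓡 4) (⇑f - ⇑f') x (X x) = _
  rw [mvfderiv_sub (CF.mdiff f x) (CF.mdiff f' x)]
  rfl

theorem dirD_mul : dirD X (f * f') = dirD X f * f' + f * dirD X f' := by
  ext x
  change mvfderiv (𝓡 4) (⇑f * ⇑f') x (X x) = _
  rw [mvfderiv_mul (CF.mdiff f x) (CF.mdiff f' x)]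
  change f x * dirD X f' x + f' x * dirD X f x = dirD X f x * f' x + f x * dirD X f' x
  ring

theorem lieV_swap : lieV X Y = -lieV Y X := by
  ext1 x
  exact VectorField.mlieBracket_swap_apply

@[simp] theorem lieV_add_left : lieV (X + Y) Z = lieV X Z + lieV Y Z := by
  ext1 x
  exact VectorField.mlieBracket_add_left X.mdifferentiableAt Y.mdifferentiableAt

@[simp] theorem lieV_add_right : lieV X (Y + Z) = lieV X Y + lieV X Z := by
  ext1 x
  exact VectorField.mlieBracket_add_right Y.mdifferentiableAt Z.mdifferentiableAt

theorem lieV_fsmul_right : lieV X (f • Y) = dirD X f • Y + f • lieV X Y := by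
  ext1 x
  exact VectorField.mlieBracket_smul_right (CF.mdiff f x) Y.mdifferentiableAt

theorem lieV_fsmul_left : lieV (f • X) Y = f • lieV X Y - dirD Y f • X := by
  rw [lieV_swap, lieV_fsmul_right, lieV_swap Y X]
  ext1 x
  change -(dirD Y f x • X x + f x • -(lieV X Y x)) = f x • lieV X Y x - dirD Y f x • X x
  module

theorem lieV_jacobi : lieV X (lieV Y Z) = lieV (lieV X Y) Z + lieV Y (lieV X Z) := by
  ext1 x
  have h : ∀ X : VField M, ContMDiffAt (𝓡 4) ((𝓡 4).prod 𝓘(ℝ, E4)) (minSmoothness ℝ 2)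
    (fun y => TotalSpace.mk' E4 y (X y)) x := fun X => (X.contMDiff x).of_le (by simpa using natCast_le_infty 2)
  have : IsManifold (𝓡 4) (minSmoothness ℝ 3) M :=
    IsManifold.of_le (n := ∞) (by simpa using natCast_le_infty 3)
  exact VectorField.leibniz_identity_mlieBracket_apply (h X) (h Y) (h Z)

theorem exists_vfield [T2Space M] (x : M) (v : T x) : ∃ X : VField M, X x = v := by
  let e := trivializationAt E4 (TangentSpace (𝓡 4) : M → Type _) x
  let b := Module.finBasis ℝ E4
  have hx : x ∈ e.baseSet := FiberBundle.mem_baseSet_trivializationAt _ _ x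
  have hs : ContMDiffOn (𝓡 4) ((𝓡 4).prod 𝓘(ℝ, E4)) ∞ (fun y => TotalSpace.mk' E4 y
      (∑ i, ((e.basisAt b hx).repr v i) • e.localFrame b i y)) e.baseSet :=
    ContMDiffOn.sum_section fun i _ => ContMDiffOn.const_smul_section
      (e.contMDiffOn_localFrame_baseSet ∞ b i)
  obtain ⟨X, hX⟩ := exists_section_eventuallyEq e.open_baseSet hs hx
  refine ⟨X, hX.self_of_nhds.trans ?_⟩
  simp only [e.localFrame_apply_of_mem_baseSet b hx]
  exact (e.basisAt b hx).sum_repr v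

/-- Read off from the Jacobi identity for X, Y and f Z: all terms cancel except (XYf − YXf − [X,
Y]f) Z, and Z is chosen nonzero at the point. -/
theorem dirD_lieV [T2Space M] : dirD (lieV X Y) f = dirD X (dirD Y f) - dirD Y (dirD X f) := by
  ext x
  obtain ⟨Z, hZ⟩ := exists_vfield x (EuclideanSpace.single 0 1 : E4)
  have h := lieV_jacobi X Y (f • Z)
  simp only [lieV_fsmul_right, lieV_add_right, lieV_jacobi X Y Z] at h
  have h' : (dirD X (dirD Y f) - dirD Y (dirD X f) - dirD (lieV X Y) f) • Z = 0 := by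
    rw [← sub_eq_zero] at h
    rw [← h]
    module
  have hx := congrArg (fun W : VField M => W x) h'
  change (dirD X (dirD Y f) x - dirD Y (dirD X f) x - dirD (lieV X Y) f x) • Z x = 0 at hx
  have hZ0 : Z x ≠ 0 := fun h0 => by
    rw [hZ] at h0
    have h1 : (EuclideanSpace.single 0 1 : E4) = 0 := h0
    simp at h1
  change _ = dirD X (dirD Y f) x - dirD Y (dirD X f) x
  have := (smul_eq_zero.1 hx).resolve_right hZ0
  linarith

end

end

section

variable {M : Type*} [TopologicalSpace M] [ChartedSpace E4 M] [IsManifold (𝓡 4) ∞ M]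

/-! ### The Levi-Civita connection -/

/-- The inner product of two vector fields. -/
def LorentzMetric.inn (g : LorentzMetric M) (X Y : VField M) : CF M :=
  ⟨fun x => g.val x (X x) (Y x), fun x => by
    have h : ContMDiffAt (𝓡 4) ((𝓡 4).prod 𝓘(ℝ, ℝ)) ∞
        (fun y => TotalSpace.mk' ℝ (E := Bundle.Trivial M ℝ) y (g.val y (X y) (Y y))) x := by
      apply ContMDiffAt.clm_bundle_apply₂ (F₁ := E4) (F₂ := E4)
      · exact g.contMDiff x
      · exact X.contMDiff x
      · exact Y.contMDiff x
    rw [contMDiffAt_totalSpace] at h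
    exact h.2⟩

namespace LorentzMetric
variable (g : LorentzMetric M) (X Y Z : VField M) (f : CF M) (x : M)

theorem inn_apply : g.inn X Y x = g.val x (X x) (Y x) := rfl

theorem inn_symm : g.inn X Y = g.inn Y X := by ext x; exact g.symm x _ _

@[simp] theorem inn_add_left : g.inn (X + Y) Z = g.inn X Z + g.inn Y Z := by
  ext x
  change g.val x (X x + Y x) (Z x) = g.val x (X x) (Z x) + g.val x (Y x) (Z x)
  simp

@[simp] theorem inn_add_right : g.inn X (Y + Z) = g.inn X Y + g.inn X Z := by
  rw [inn_symm, inn_add_left, inn_symm, inn_symm g Z]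

@[simp] theorem inn_neg_left : g.inn (-X) Y = -g.inn X Y := by
  ext x
  change g.val x (-X x) (Y x) = -g.val x (X x) (Y x)
  simp

@[simp] theorem inn_neg_right : g.inn X (-Y) = -g.inn X Y := by
  rw [inn_symm, inn_neg_left, inn_symm]

@[simp] theorem inn_sub_left : g.inn (X - Y) Z = g.inn X Z - g.inn Y Z := by
  rw [sub_eq_add_neg, inn_add_left, inn_neg_left, sub_eq_add_neg]

@[simp] theorem inn_sub_right : g.inn X (Y - Z) = g.inn X Y - g.inn X Z := by
  rw [sub_eq_add_neg, inn_add_right, inn_neg_right, sub_eq_add_neg]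

variable {X Y} in
theorem ext_inn [T2Space M] (h : ∀ Z, g.inn X Z = g.inn Y Z) : X = Y := by
  ext1 x
  refine g.eq_of_val _ _ fun v => ?_
  obtain ⟨Z, rfl⟩ := exists_vfield x v
  exact congrArg (fun f : CF M => f x) (h Z)

/-- The Koszul expression as a function. -/
def kosz : CF M := dirD X (g.inn Y Z) + dirD Y (g.inn Z X) - dirD Z (g.inn X Y)
  + g.inn (lieV X Y) Z - g.inn (lieV Y Z) X + g.inn (lieV Z X) Y

end LorentzMetric

/-! ### Tensoriality and locality of the Koszul expression -/

theorem tensorialAt_koszul_left (g : LorentzMetric M) {x : M} {Y Z : ∀ y : M, T y}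
    (hY : MDifferentiableAt (𝓡 4) ((𝓡 4).prod 𝓘(ℝ, E4)) (fun y => TotalSpace.mk' E4 y (Y y)) x)
    (hZ : MDifferentiableAt (𝓡 4) ((𝓡 4).prod 𝓘(ℝ, E4)) (fun y => TotalSpace.mk' E4 y (Z y)) x) :
    TensorialAt (𝓡 4) E4 (V := fun x : M => T x) (fun X => koszul g X Y Z x) x where
  smul := by
    intro f X hf hX
    have h1 : (fun y => g.val y (Z y) ((f • X) y)) = f * fun y => g.val y (Z y) (X y) := by
      ext y; simp
    have h2 : (fun y => g.val y ((f • X) y) (Y y)) = f * fun y => g.val y (X y) (Y y) := by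
      ext y; simp
    unfold koszul
    rw [h1, h2, mvfderiv_mul hf (g.mdiff_apply hZ hX), mvfderiv_mul hf (g.mdiff_apply hX hY),
      VectorField.mlieBracket_smul_left hf hX, VectorField.mlieBracket_smul_right hf hX]
    simp only [Pi.smul_apply', map_smul, map_add, map_neg, _root_.add_apply, _root_.smul_apply,
      smul_eq_mul, neg_smul, _root_.neg_apply]
    rw [g.symm x (X x) (Z x), g.symm x (X x) (Y x)]
    ring
  add := by
    intro X X' hX hX'
    have h1 : (fun y => g.val y (Z y) ((X + X') y)) =
        (fun y => g.val y (Z y) (X y)) + fun y => g.val y (Z y) (X' y) := by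
      ext y; simp
    have h2 : (fun y => g.val y ((X + X') y) (Y y)) =
        (fun y => g.val y (X y) (Y y)) + fun y => g.val y (X' y) (Y y) := by
      ext y; simp
    unfold koszul
    rw [h1, h2, mvfderiv_add (g.mdiff_apply hZ hX) (g.mdiff_apply hZ hX'),
      mvfderiv_add (g.mdiff_apply hX hY) (g.mdiff_apply hX' hY),
      VectorField.mlieBracket_add_left hX hX', VectorField.mlieBracket_add_right hX hX']
    simp only [Pi.add_apply, map_add, _root_.add_apply]
    ring

/-- Together with the previous statement: the Koszul expression depends on X and Z only through
their values at x, so the fixed frame in the definition of `nabla` may be replaced by arbitrary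
fields in `val_nabla`. -/
theorem tensorialAt_koszul_right (g : LorentzMetric M) {x : M} {X Y : ∀ y : M, T y}
    (hX : MDifferentiableAt (𝓡 4) ((𝓡 4).prod 𝓘(ℝ, E4)) (fun y => TotalSpace.mk' E4 y (X y)) x)
    (hY : MDifferentiableAt (𝓡 4) ((𝓡 4).prod 𝓘(ℝ, E4)) (fun y => TotalSpace.mk' E4 y (Y y)) x) :
    TensorialAt (𝓡 4) E4 (V := fun x : M => T x) (fun Z => koszul g X Y Z x) x where
  smul := by
    intro f Z hf hZ
    have h1 : (fun y => g.val y ((f • Z) y) (X y)) = f * fun y => g.val y (Z y) (X y) := by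
      ext y; simp
    have h2 : (fun y => g.val y (Y y) ((f • Z) y)) = f * fun y => g.val y (Y y) (Z y) := by
      ext y; simp
    unfold koszul
    rw [h1, h2, mvfderiv_mul hf (g.mdiff_apply hZ hX), mvfderiv_mul hf (g.mdiff_apply hY hZ),
      VectorField.mlieBracket_smul_left hf hZ, VectorField.mlieBracket_smul_right hf hZ]
    simp only [Pi.smul_apply', map_smul, map_add, map_neg, _root_.add_apply, _root_.smul_apply,
      smul_eq_mul, neg_smul, _root_.neg_apply]
    rw [g.symm x (Y x) (Z x)]
    ring
  add := by
    intro Z Z' hZ hZ'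
    have h1 : (fun y => g.val y ((Z + Z') y) (X y)) =
        (fun y => g.val y (Z y) (X y)) + fun y => g.val y (Z' y) (X y) := by
      ext y; simp
    have h2 : (fun y => g.val y (Y y) ((Z + Z') y)) =
        (fun y => g.val y (Y y) (Z y)) + fun y => g.val y (Y y) (Z' y) := by
      ext y; simp
    unfold koszul
    rw [h1, h2, mvfderiv_add (g.mdiff_apply hZ hX) (g.mdiff_apply hZ' hX),
      mvfderiv_add (g.mdiff_apply hY hZ) (g.mdiff_apply hY hZ'),
      VectorField.mlieBracket_add_left hZ hZ', VectorField.mlieBracket_add_right hZ hZ']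
    simp only [Pi.add_apply, map_add, _root_.add_apply]
    ring

theorem koszul_congr {g : LorentzMetric M} {x : M} {X X' Y Y' Z Z' : ∀ y : M, T y}
    (hX : X =ᶠ[𝓝 x] X') (hY : Y =ᶠ[𝓝 x] Y') (hZ : Z =ᶠ[𝓝 x] Z') :
    koszul g X Y Z x = koszul g X' Y' Z' x := by
  have h : ∀ {X X' Y Y' : ∀ y : M, T y}, X =ᶠ[𝓝 x] X' → Y =ᶠ[𝓝 x] Y' →
      (fun y => g.val y (X y) (Y y)) =ᶠ[𝓝 x] fun y => g.val y (X' y) (Y' y) := fun h h' => by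
    filter_upwards [h, h'] with y hy hy'
    rw [hy, hy']
  unfold koszul
  rw [mvfderiv_congr (h hY hZ), mvfderiv_congr (h hZ hX), mvfderiv_congr (h hX hY),
    hX.mlieBracket_vectorField_eq hY, hY.mlieBracket_vectorField_eq hZ,
    hZ.mlieBracket_vectorField_eq hX, hX.self_of_nhds, hY.self_of_nhds, hZ.self_of_nhds]

namespace SpinStructure
variable {g : LorentzMetric M} {Ω : SpinorForm} {ι : Type*} (P : SpinStructure g Ω ι)

theorem mdiff_const_e (x : M) (c : Fin 4 → ℝ) :
    MDifferentiableAt (𝓡 4) ((𝓡 4).prod 𝓘(ℝ, E4))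
      (fun y => TotalSpace.mk' E4 y (∑ μ, c μ • P.e x μ y)) x :=
  .sum_section fun μ _ => mdifferentiableAt_const.smul_section (P.mdiff_e x μ)

/-- The characterisation of the Levi-Civita connection by Koszul's formula. -/
theorem val_nabla {x : M} {X Y Z : ∀ y : M, T y}
    (hX : MDifferentiableAt (𝓡 4) ((𝓡 4).prod 𝓘(ℝ, E4)) (fun y => TotalSpace.mk' E4 y (X y)) x)
    (hY : MDifferentiableAt (𝓡 4) ((𝓡 4).prod 𝓘(ℝ, E4)) (fun y => TotalSpace.mk' E4 y (Y y)) x)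
    (hZ : MDifferentiableAt (𝓡 4) ((𝓡 4).prod 𝓘(ℝ, E4)) (fun y => TotalSpace.mk' E4 y (Z y)) x) :
    g.val x (P.nabla Y x (X x)) (Z x) = 2⁻¹ * koszul g X Y Z x := by
  have hX' : X x = (fun y => ∑ μ, P.coord x μ (X x) • P.e x μ y) x := (P.sum_coord x (X x)).symm
  have hZ' : Z x = (fun y => ∑ μ, P.coord x μ (Z x) • P.e x μ y) x := (P.sum_coord x (Z x)).symm
  have hc : ∀ (c : ℝ) μ, MDifferentiableAt (𝓡 4) ((𝓡 4).prod 𝓘(ℝ, E4))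
      (fun y => TotalSpace.mk' E4 y (c • P.e x μ y)) x := fun c μ =>
    mdifferentiableAt_const.smul_section (P.mdiff_e x μ)
  have key : koszul g X Y Z x = ∑ μ, ∑ ν, P.coord x μ (X x) * (P.coord x ν (Z x)
      * koszul g (P.e x μ) Y (P.e x ν) x) := by
    rw [TensorialAt.pointwise₂ (Φ := fun X Z => koszul g X Y Z x)
      (fun _ h => tensorialAt_koszul_left g hY h) (fun _ h => tensorialAt_koszul_right g h hY)
      hX (P.mdiff_const_e x _) hZ (P.mdiff_const_e x _) hX' hZ']
    rw [(tensorialAt_koszul_left g hY (P.mdiff_const_e x _)).sum _ fun μ _ => hc _ μ]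
    refine Finset.sum_congr rfl fun μ _ => ?_
    rw [(tensorialAt_koszul_right g (hc _ μ) hY).sum _ fun ν _ => hc _ ν]
    refine Finset.sum_congr rfl fun ν _ => ?_
    have h1 := (tensorialAt_koszul_left g hY (hc (P.coord x ν (Z x)) ν)).smul
      (f := fun _ => P.coord x μ (X x)) mdifferentiableAt_const (P.mdiff_e x μ)
    have h2 := (tensorialAt_koszul_right g (P.mdiff_e x μ) hY).smul
      (f := fun _ => P.coord x ν (Z x)) mdifferentiableAt_const (P.mdiff_e x ν)
    exact h1.trans (congrArg _ h2)
  rw [key]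
  simp only [nabla, LinearMap.sum_apply, LinearMap.smulRight_apply, map_sum, map_smul,
    _root_.sum_apply, _root_.smul_apply, smul_eq_mul, Finset.mul_sum]
  refine Finset.sum_congr rfl fun μ _ => Finset.sum_congr rfl fun ν _ => ?_
  simp only [coord, LinearMap.smul_apply, smul_eq_mul, LorentzMetric.bilin_apply]
  ring

/-- Lets the local frames of the spin structure be replaced by global fields that agree with them
near the point. -/
theorem nabla_congr {x : M} {Y Y' : ∀ y : M, T y} (h : ∀ᶠ y in 𝓝 x, Y y = Y' y) :
    P.nabla Y x = P.nabla Y' x := by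
  have hk : ∀ X Z, koszul g X Y Z x = koszul g X Y' Z x := fun X Z =>
    koszul_congr (.refl _ _) h (.refl _ _)
  simp only [nabla, hk]

/-- The frame with a given index, extended from a neighbourhood of a point to all of `M`. -/
theorem exists_frame [T2Space M] {i : ι} {x : M} (hx : x ∈ P.baseSet i) :
    ∃ E : Fin 4 → VField M, ∀ᶠ y in 𝓝 x, y ∈ P.baseSet i ∧ ∀ μ, E μ y = P.frame i μ y := by
  choose E hE using fun μ =>
    exists_section_eventuallyEq (P.isOpen_baseSet i) (P.contMDiffOn_frame i μ) hx
  exact ⟨E, ((P.isOpen_baseSet i).eventually_mem hx).and (Filter.eventually_all.2 hE)⟩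

variable [T2Space M]

/-- The Levi-Civita derivative of a vector field along another. -/
def cov (X Y : VField M) : VField M := ⟨fun x => P.nabla Y x (X x), fun x => by
  obtain ⟨E, hE⟩ := P.exists_frame (P.mem_baseSet_at x)
  refine contMDiffAt_of_eventuallyEq (∑ μ, ((mink μ * 2⁻¹ : ℝ) • g.kosz X Y (E μ)) • E μ) ?_
  filter_upwards [hE] with y hy
  have hf : g.IsONFrame fun μ => E μ y := fun μ ν => by
    beta_reduce; rw [hy.2, hy.2]; exact P.isONFrame hy.1 μ ν
  rw [hf.eq_sum fun μ => P.val_nabla (X := X) (Z := E μ) X.mdifferentiableAt Y.mdifferentiableAt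
    (E μ).mdifferentiableAt, section_sum_apply]
  refine Finset.sum_congr rfl fun μ _ => ?_
  rw [fsmul_apply, ← mul_assoc]
  rfl⟩

variable (X Y Z : VField M) (f : CF M) (x : M)

theorem cov_apply : P.cov X Y x = P.nabla Y x (X x) := rfl

theorem inn_cov : g.inn (P.cov X Y) Z = (2⁻¹ : ℝ) • g.kosz X Y Z := by
  ext x
  exact P.val_nabla X.mdifferentiableAt Y.mdifferentiableAt Z.mdifferentiableAt

/-- Torsion-freeness: in the difference of the two Koszul expressions only the bracket of X and Y
survives. -/
theorem cov_sub_cov : P.cov X Y - P.cov Y X = lieV X Y := by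
  refine g.ext_inn fun Z => ?_
  rw [g.inn_sub_left, inn_cov, inn_cov, LorentzMetric.kosz, LorentzMetric.kosz, lieV_swap Y X,
    lieV_swap X Z, lieV_swap Z Y, g.inn_symm X Z, g.inn_symm Z Y, g.inn_symm Y X]
  simp only [g.inn_neg_left]
  module

theorem dirD_inn : dirD X (g.inn Y Z) = g.inn (P.cov X Y) Z + g.inn Y (P.cov X Z) := by
  rw [g.inn_symm Y (P.cov X Z), inn_cov, inn_cov, LorentzMetric.kosz, LorentzMetric.kosz,
    lieV_swap Y X, lieV_swap X Z, lieV_swap Z Y, g.inn_symm X Z, g.inn_symm Z Y, g.inn_symm Y X]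
  simp only [g.inn_neg_left]
  module

@[simp] theorem cov_add_left : P.cov (X + Y) Z = P.cov X Z + P.cov Y Z := by
  ext1 x
  exact map_add (P.nabla Z x) _ _

@[simp] theorem cov_fsmul_left : P.cov (f • X) Y = f • P.cov X Y := by
  ext1 x
  exact map_smul (P.nabla Y x) _ _

@[simp] theorem cov_neg_left : P.cov (-X) Y = -P.cov X Y := by
  ext1 x
  exact map_neg (P.nabla Y x) _

@[simp] theorem cov_sub_left : P.cov (X - Y) Z = P.cov X Z - P.cov Y Z := by
  rw [sub_eq_add_neg, cov_add_left, cov_neg_left, sub_eq_add_neg]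

/-- Torsion-freeness moves Y into the tensorial slot, so additivity and the Leibniz rule in Y follow
from linearity in X and the rules for the commutator. -/
theorem cov_eq : P.cov X Y = P.cov Y X + lieV X Y := by rw [← P.cov_sub_cov]; abel

@[simp] theorem cov_add_right : P.cov X (Y + Z) = P.cov X Y + P.cov X Z := by
  rw [P.cov_eq, cov_add_left, lieV_add_right, P.cov_eq X Y, P.cov_eq X Z]
  abel

theorem cov_fsmul_right : P.cov X (f • Y) = dirD X f • Y + f • P.cov X Y := by
  rw [P.cov_eq, cov_fsmul_left, lieV_fsmul_right, P.cov_eq X Y]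
  module

@[simp] theorem cov_neg_right : P.cov X (-Y) = -P.cov X Y := by
  rw [eq_neg_iff_add_eq_zero, ← cov_add_right, neg_add_cancel]
  have h := P.cov_add_right X 0 0
  simpa using h

@[simp] theorem cov_sub_right : P.cov X (Y - Z) = P.cov X Y - P.cov X Z := by
  rw [sub_eq_add_neg, cov_add_right, cov_neg_right, sub_eq_add_neg]

end SpinStructure

end

section

/-! ### Spinor fields -/

variable {M : Type*} [TopologicalSpace M] [ChartedSpace E4 M]

theorem contMDiffAt_linearMap {s : M → Spinor} {x : M} (L : Module.End ℝ Spinor)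
    (hs : ContMDiffAt (𝓡 4) 𝓘(ℝ, Spinor) ∞ s x) :
    ContMDiffAt (𝓡 4) 𝓘(ℝ, Spinor) ∞ (fun y => L (s y)) x :=
  (LinearMap.toContinuousLinearMap L).contMDiff.contMDiffAt.comp x hs

theorem mvfderiv_linearMap {F F' : Type*} [NormedAddCommGroup F] [NormedSpace ℝ F]
    [NormedAddCommGroup F'] [NormedSpace ℝ F'] [FiniteDimensional ℝ F']
    {s : M → F'} {x : M} (L : F' →ₗ[ℝ] F)
    (hs : MDifferentiableAt (𝓡 4) 𝓘(ℝ, F') s x) (v : T x) :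
    mvfderiv (𝓡 4) (fun y => L (s y)) x v = L (mvfderiv (𝓡 4) s x v) := by
  have h := ((LinearMap.toContinuousLinearMap L).hasMFDerivAt (x := s x)).comp x hs.hasMFDerivAt
  have h' : mfderiv (𝓡 4) 𝓘(ℝ, F) (fun y => L (s y)) x = _ := h.mfderiv
  change mfderiv (𝓡 4) 𝓘(ℝ, F) (fun y => L (s y)) x v = _
  rw [h']
  rfl

theorem mvfderiv_bilin {F₁ F₂ F : Type*} [NormedAddCommGroup F₁] [NormedSpace ℝ F₁]
    [FiniteDimensional ℝ F₁] [NormedAddCommGroup F₂] [NormedSpace ℝ F₂] [FiniteDimensional ℝ F₂]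
    [NormedAddCommGroup F] [NormedSpace ℝ F] {s : M → F₁} {t : M → F₂} {x : M}
    (B : F₁ →ₗ[ℝ] F₂ →ₗ[ℝ] F) (hs : MDifferentiableAt (𝓡 4) 𝓘(ℝ, F₁) s x)
    (ht : MDifferentiableAt (𝓡 4) 𝓘(ℝ, F₂) t x) (v : T x) :
    mvfderiv (𝓡 4) (fun y => B (s y) (t y)) x v =
      B (mvfderiv (𝓡 4) s x v) (t x) + B (s x) (mvfderiv (𝓡 4) t x v) := by
  let B' : F₁ →L[ℝ] F₂ →L[ℝ] F := LinearMap.toContinuousBilinearMap B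
  have hst : HasMFDerivAt (𝓡 4) 𝓘(ℝ, F₁ × F₂) (fun y => (s y, t y)) x
      ((mfderiv (𝓡 4) 𝓘(ℝ, F₁) s x).prod (mfderiv (𝓡 4) 𝓘(ℝ, F₂) t x)) :=
    ⟨hs.hasMFDerivAt.1.prodMk ht.hasMFDerivAt.1, hs.hasMFDerivAt.2.prodMk ht.hasMFDerivAt.2⟩
  have h := HasMFDerivAt.comp x
    (B'.isBoundedBilinearMap.hasFDerivAt (s x, t x)).hasMFDerivAt hst
  have h' : mfderiv (𝓡 4) 𝓘(ℝ, F) (fun y => B (s y) (t y)) x = _ := h.mfderiv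
  change mfderiv (𝓡 4) 𝓘(ℝ, F) (fun y => B (s y) (t y)) x v = _
  rw [h', add_comm]
  rfl

theorem mdifferentiableAt_pi_space {c : M → Fin 4 → ℝ} {x : M}
    (h : ∀ μ, MDifferentiableAt (𝓡 4) 𝓘(ℝ, ℝ) (fun y => c y μ) x) :
    MDifferentiableAt (𝓡 4) 𝓘(ℝ, Fin 4 → ℝ) c x := by
  refine (mdifferentiableAt_iff _ _).2 ⟨continuousAt_pi.2 fun μ => (h μ).continuousAt, ?_⟩
  exact differentiableWithinAt_pi.2 fun μ => ((mdifferentiableAt_iff _ _).1 (h μ)).2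

theorem contMDiffAt_clM {A : Fin 4 → M → ℝ} {s : M → Spinor} {x : M}
    (hA : ∀ ν, ContMDiffAt (𝓡 4) 𝓘(ℝ, ℝ) ∞ (A ν) x)
    (hs : ContMDiffAt (𝓡 4) 𝓘(ℝ, Spinor) ∞ s x) :
    ContMDiffAt (𝓡 4) 𝓘(ℝ, Spinor) ∞ (fun y => clM (fun ν => A ν y) (s y)) x := by
  have h : ContMDiffAt (𝓡 4) 𝓘(ℝ, Spinor) ∞ (fun y => ∑ ν, A ν y • gamma ν (s y)) x :=
    ContMDiffAt.sum fun ν _ => ContMDiffAt.smul (hA ν) (contMDiffAt_linearMap (gamma ν) hs)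
  simpa only [clM, LinearMap.sum_apply, LinearMap.smul_apply] using h

variable [IsManifold (𝓡 4) ∞ M]

/-- A local smooth function agrees near each point with a global one. -/
theorem exists_function_eventuallyEq [T2Space M] {c : M → ℝ} {U : Set M} (hU : IsOpen U)
    (hc : ContMDiffOn (𝓡 4) 𝓘(ℝ, ℝ) ∞ c U) {x : M} (hx : x ∈ U) : ∃ f : CF M, f =ᶠ[𝓝 x] c := by
  obtain ⟨σ, hσ⟩ := exists_section_eventuallyEq (V := Trivial M ℝ) (F := ℝ) (s := c) hU
    (fun y hy => by
      rw [contMDiffWithinAt_totalSpace]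
      exact ⟨contMDiffWithinAt_id, hc y hy⟩) hx
  refine ⟨⟨fun y => σ y, fun y => ?_⟩, hσ⟩
  have h := σ.contMDiff y
  rw [contMDiffAt_totalSpace] at h
  exact h.2

namespace SpinStructure
variable {g : LorentzMetric M} {Ω : SpinorForm} {ι : Type*} (P : SpinStructure g Ω ι)

variable {P} in
theorem SpinorField.ext {ε ε' : P.SpinorField}
    (h : ∀ x, P.evalSpinor x ε = P.evalSpinor x ε') : ε = ε' :=
  ContMDiffSection.ext h

theorem contMDiffAt_section_iff {i : ι} {x : M} (hx : x ∈ P.baseSet i) {s : M → Spinor} :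
    ContMDiffAt (𝓡 4) ((𝓡 4).prod 𝓘(ℝ, Spinor)) ∞
      (fun y => TotalSpace.mk' Spinor (E := P.toVectorBundleCore.Fiber) y (s y)) x ↔
    ContMDiffAt (𝓡 4) 𝓘(ℝ, Spinor) ∞ (fun y => P.coordChange (P.indexAt y) i y (s y)) x :=
  have : MemTrivializationAtlas (P.toVectorBundleCore.localTriv i) := ⟨⟨i, rfl⟩⟩
  (P.toVectorBundleCore.localTriv i).contMDiffAt_section_iff hx

theorem contMDiffAt_comp {i : ι} {x : M} (hx : x ∈ P.baseSet i) (ε : P.SpinorField) :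
    ContMDiffAt (𝓡 4) 𝓘(ℝ, Spinor) ∞ (P.comp i ε) x :=
  (P.contMDiffAt_section_iff hx).1 (ε.contMDiff x)

theorem mdiffAt_comp {i : ι} {x : M} (hx : x ∈ P.baseSet i) (ε : P.SpinorField) :
    MDifferentiableAt (𝓡 4) 𝓘(ℝ, Spinor) (P.comp i ε) x :=
  (P.contMDiffAt_comp hx ε).mdifferentiableAt (by simp)

theorem comp_indexAt (x : M) (ε : P.SpinorField) :
    P.comp (P.indexAt x) ε x = P.evalSpinor x ε :=
  P.coordChange_self _ x (P.mem_baseSet_at x) _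

theorem comp_apply (i : ι) (ε : P.SpinorField) (x : M) :
    P.comp i ε x = P.coordChange (P.indexAt x) i x (P.evalSpinor x ε) := rfl

theorem coordChange_comp_comp {i j : ι} {x : M} (hi : x ∈ P.baseSet i) (hj : x ∈ P.baseSet j)
    (ε : P.SpinorField) : P.coordChange i j x (P.comp i ε x) = P.comp j ε x :=
  P.coordChange_comp _ i j x ⟨⟨P.mem_baseSet_at x, hi⟩, hj⟩ _

theorem comp_add (i : ι) (ε ε' : P.SpinorField) :
    P.comp i (ε + ε') = P.comp i ε + P.comp i ε' := by
  ext1 y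
  exact map_add (P.coordChange (P.indexAt y) i y) (ε y) (ε' y)

theorem comp_fsmul (i : ι) (f : CF M) (ε : P.SpinorField) :
    P.comp i (f • ε) = (f : M → ℝ) • P.comp i ε := by
  ext1 y
  exact map_smul (P.coordChange (P.indexAt y) i y) (f y) (ε y)

/-- The frame change intertwines the Clifford actions. -/
theorem coordChange_clM {i j : ι} {x : M} (hi : x ∈ P.baseSet i) (hj : x ∈ P.baseSet j) (v : T x)
    (s : Spinor) : P.coordChange i j x (clM (g.cmp (fun μ => P.frame i μ x) v) s) =
      clM (g.cmp (fun μ => P.frame j μ x) v) (P.coordChange i j x s) := by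
  simpa [clM, LorentzMetric.cmp] using P.covers i j x ⟨hi, hj⟩ v s

theorem coordChange_cliff {j : ι} {x : M} (hj : x ∈ P.baseSet j) (v : T x) (s : Spinor) :
    P.coordChange (P.indexAt x) j x (P.cliff x v s) =
      clM (g.cmp (fun μ => P.frame j μ x) v) (P.coordChange (P.indexAt x) j x s) := by
  rw [cliff_apply]
  exact P.coordChange_clM (P.mem_baseSet_at x) hj v s

/-- The symplectic pairing of spinor fields. -/
def pair (ε ε' : P.SpinorField) : CF M :=
  ⟨fun x => Ω.form (P.evalSpinor x ε) (P.evalSpinor x ε'), fun x => by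
    have h1 := P.contMDiffAt_comp (P.mem_baseSet_at x) ε
    have h2 := P.contMDiffAt_comp (P.mem_baseSet_at x) ε'
    let B : Spinor →L[ℝ] Spinor →L[ℝ] ℝ := LinearMap.toContinuousBilinearMap Ω.form
    have h3 : ContMDiffAt (𝓡 4) 𝓘(ℝ, ℝ) ∞ (fun y => B (P.comp (P.indexAt x) ε y)
        (P.comp (P.indexAt x) ε' y)) x :=
      (B.contMDiff.contMDiffAt.comp x h1).clm_apply h2
    refine h3.congr_of_eventuallyEq ?_
    filter_upwards [(P.isOpen_baseSet _).mem_nhds (P.mem_baseSet_at x)] with y hy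
    exact (P.preserves_form _ _ y ⟨P.mem_baseSet_at y, hy⟩ _ _).symm⟩

theorem pair_eq_comp (ε ε' : P.SpinorField) {i : ι} {x : M} (hx : x ∈ P.baseSet i) :
    P.pair ε ε' x = Ω.form (P.comp i ε x) (P.comp i ε' x) :=
  (P.preserves_form _ _ x ⟨P.mem_baseSet_at x, hx⟩ _ _).symm

/-- Multiplication of a spinor field by the volume element. -/
def volS (ε : P.SpinorField) : P.SpinorField :=
  ⟨fun x => vol (P.evalSpinor x ε), fun x => by
    rw [P.contMDiffAt_section_iff (P.mem_baseSet_at x)]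
    refine (contMDiffAt_linearMap vol
      (P.contMDiffAt_comp (P.mem_baseSet_at x) ε)).congr_of_eventuallyEq ?_
    filter_upwards [(P.isOpen_baseSet _).mem_nhds (P.mem_baseSet_at x)] with y hy
    exact P.preserves_vol _ _ y ⟨P.mem_baseSet_at y, hy⟩ _⟩

@[simp] theorem eval_volS (ε : P.SpinorField) (x : M) :
    P.evalSpinor x (P.volS ε) = vol (P.evalSpinor x ε) := rfl

theorem comp_volS (ε : P.SpinorField) {i : ι} {x : M} (hx : x ∈ P.baseSet i) :
    P.comp i (P.volS ε) x = vol (P.comp i ε x) :=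
  P.preserves_vol _ _ x ⟨P.mem_baseSet_at x, hx⟩ _

variable [T2Space M]

/-- Clifford multiplication of a spinor field by a vector field. -/
def cm (X : VField M) (ε : P.SpinorField) : P.SpinorField :=
  ⟨fun x => P.cliff x (X x) (P.evalSpinor x ε), fun x => by
    rw [P.contMDiffAt_section_iff (P.mem_baseSet_at x)]
    obtain ⟨E, hE⟩ := P.exists_frame (P.mem_baseSet_at x)
    refine (contMDiffAt_clM (A := fun μ => ⇑(mink μ • g.inn X (E μ)))
      (fun μ => ContMDiffMap.contMDiff _ x)
      (P.contMDiffAt_comp (P.mem_baseSet_at x) ε)).congr_of_eventuallyEq ?_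
    filter_upwards [hE] with y hy
    refine (P.coordChange_cliff hy.1 _ _).trans ?_
    congr 2
    funext μ
    rw [LorentzMetric.cmp, ← hy.2 μ]
    rfl⟩

@[simp] theorem eval_cm (X : VField M) (ε : P.SpinorField) (x : M) :
    P.evalSpinor x (P.cm X ε) = P.cliff x (X x) (P.evalSpinor x ε) := rfl

theorem comp_cm (X : VField M) (ε : P.SpinorField) {i : ι} {x : M} (hx : x ∈ P.baseSet i) :
    P.comp i (P.cm X ε) x = clM (g.cmp (fun μ => P.frame i μ x) (X x)) (P.comp i ε x) :=
  P.coordChange_cliff hx _ _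

/-- The Dirac current of spinor fields. -/
def curr (ε ε' : P.SpinorField) : VField M :=
  ⟨fun x => P.kappa x (P.evalSpinor x ε) (P.evalSpinor x ε'), fun x => by
    obtain ⟨E, hE⟩ := P.exists_frame (P.mem_baseSet_at x)
    refine contMDiffAt_of_eventuallyEq (∑ μ, (mink μ • P.pair ε (P.cm (E μ) ε')) • E μ) ?_
    filter_upwards [hE] with y hy
    have hf : g.IsONFrame fun μ => E μ y := fun μ ν => by
      beta_reduce; rw [hy.2, hy.2]; exact P.isONFrame hy.1 μ ν
    rw [hf.eq_sum fun μ => P.val_kappa y _ _ (E μ y), section_sum_apply]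
    rfl⟩

theorem curr_apply (ε ε' : P.SpinorField) (x : M) :
    P.curr ε ε' x = P.kappa x (P.evalSpinor x ε) (P.evalSpinor x ε') := rfl

theorem inn_curr (ε ε' : P.SpinorField) (X : VField M) :
    g.inn (P.curr ε ε') X = P.pair ε (P.cm X ε') := by
  ext x
  exact P.val_kappa x _ _ _

/-- Commutant uniqueness for operators on spinor fields. -/
theorem operator_eq_zero {i : ι} {x : M} (hx : x ∈ P.baseSet i) (Ψ : P.SpinorField → Spinor)
    (hadd : ∀ ε ε', Ψ (ε + ε') = Ψ ε + Ψ ε') (hsmul : ∀ (f : CF M) ε, Ψ (f • ε) = f x • Ψ ε)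
    (hcm : ∀ X ε, Ψ (P.cm X ε) = clM (g.cmp (fun μ => P.frame i μ x) (X x)) (Ψ ε))
    (hΩ : ∀ ε ε', Ω.form (Ψ ε) (P.comp i ε' x) + Ω.form (P.comp i ε x) (Ψ ε') = 0)
    (ε : P.SpinorField) : Ψ ε = 0 := by
  -- The local spinor frame whose members are constant in the i-th trivialisation.
  let b : Fin 4 → ∀ y, P.toVectorBundleCore.Fiber y := fun a y =>
    P.coordChange i (P.indexAt y) y (Pi.single a 1 : Spinor)
  have hcb : ∀ a, ∀ y ∈ P.baseSet i,
      P.coordChange (P.indexAt y) i y (b a y) = (Pi.single a 1 : Spinor) := fun a y hy => by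
    rw [P.coordChange_comp i (P.indexAt y) i y ⟨⟨hy, P.mem_baseSet_at y⟩, hy⟩,
      P.coordChange_self i y hy]
  have hb : ∀ a, ContMDiffOn (𝓡 4) ((𝓡 4).prod 𝓘(ℝ, Spinor)) ∞
      (fun y => TotalSpace.mk' Spinor y (b a y)) (P.baseSet i) := fun a y hy => by
    refine ContMDiffAt.contMDiffWithinAt ((P.contMDiffAt_section_iff hy).2 ?_)
    refine contMDiffAt_const (c := (Pi.single a 1 : Spinor)) |>.congr_of_eventuallyEq ?_
    filter_upwards [(P.isOpen_baseSet i).mem_nhds hy] with z hz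
    exact hcb a z hz
  choose B hB using fun a => exists_section_eventuallyEq (P.isOpen_baseSet i) (hb a) hx
  have hcB : ∀ a, P.comp i (B a) x = Pi.single a 1 := fun a => by
    rw [← hcb a x hx, ← (hB a).self_of_nhds]; rfl
  have hconst : ∀ (c : ℝ) (ε : P.SpinorField), Ψ (c • ε) = c • Ψ ε := fun c ε =>
    hsmul (ContMDiffMap.const c) ε
  have hneg : ∀ ε, Ψ (-ε) = -Ψ ε := fun ε => by
    have := hconst (-1) ε; simpa using this
  -- Linearity over functions: if ε vanishes at x, so do its coefficients in the local frame, and Ψ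
  -- ε = 0.
  have hzero : ∀ ε : P.SpinorField, P.comp i ε x = 0 → Ψ ε = 0 := fun ε h0 =>
    map_eq_zero_of_linear (P.isOpen_baseSet i) hx hb Ψ hadd hsmul ε
      (c := fun a y => P.comp i ε y a)
      (fun a y hy => by
        have := (contMDiffAt_pi_space.1 (P.contMDiffAt_comp hy ε)) a
        exact this.contMDiffWithinAt)
      (fun y hy => by
        have h1 := P.coordChange_comp_comp hy (P.mem_baseSet_at y) ε
        rw [comp_indexAt] at h1
        refine h1.symm.trans ?_
        have h2 : P.comp i ε y = ∑ a, P.comp i ε y a • (Pi.single a 1 : Spinor) := by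
          ext a; simp [Finset.sum_apply, Pi.single_apply]
        conv_lhs => rw [h2]
        rw [map_sum]
        exact Finset.sum_congr rfl fun a _ => map_smul _ _ _)
      (fun a => by rw [h0]; rfl)
  have hcompsum : ∀ c : Fin 4 → ℝ, P.comp i (∑ a, c a • B a) x = c := fun c => by
    have : P.comp i (∑ a, c a • B a) x = ∑ a, c a • P.comp i (B a) x := by
      simp only [comp_apply, map_sum, map_smul]
    rw [this]
    simp only [hcB]
    ext a; simp [Finset.sum_apply, Pi.single_apply]
  have hcompadd : ∀ ε ε', P.comp i (ε + ε') x = P.comp i ε x + P.comp i ε' x := fun ε ε' => by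
    rw [comp_add]; rfl
  have hcompneg : ∀ ε, P.comp i (-ε) x = -P.comp i ε x := fun ε => by
    rw [comp_apply, comp_apply, map_neg, map_neg]
  have heq : ∀ ε ε', P.comp i ε x = P.comp i ε' x → Ψ ε = Ψ ε' := fun ε ε' h => by
    have := hzero (ε + -ε') (by rw [hcompadd, hcompneg, h, add_neg_cancel])
    rw [hadd, hneg] at this
    exact add_neg_eq_zero.1 this
  -- Ψ therefore factors through the fibre at x as an endomorphism `t`, to which the pointwise
  -- commutant argument applies.
  let t : Module.End ℝ Spinor :=
    { toFun := fun s => Ψ (∑ a, s a • B a)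
      map_add' := fun s s' => by
        rw [← hadd]
        exact heq _ _ (by rw [hcompadd, hcompsum, hcompsum, hcompsum])
      map_smul' := fun c s => by
        rw [RingHom.id_apply, ← hconst]
        refine heq _ _ ?_
        have : P.comp i (c • ∑ a, s a • B a) x = c • P.comp i (∑ a, s a • B a) x := by
          rw [comp_apply, comp_apply, map_smul, map_smul]
        rw [this, hcompsum, hcompsum] }
  have ht : ∀ ε, Ψ ε = t (P.comp i ε x) := fun ε => heq _ _ (hcompsum _).symm
  have h0 : t = 0 := by
    refine eq_zero_of_commute_gamma Ω (fun μ => LinearMap.ext fun s => ?_) fun s s' => ?_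
    · obtain ⟨X, hX⟩ := exists_vfield x (P.frame i μ x)
      have h1 : clM (g.cmp (fun μ => P.frame i μ x) (X x)) = gamma μ := by
        have := (P.isONFrame hx).cmp_self μ
        simp [hX, clM, this]
      have h2 := hcm X (∑ a, s a • B a)
      rw [ht, ht, comp_cm P X _ hx, h1, hcompsum] at h2
      exact h2
    · have := hΩ (∑ a, s a • B a) (∑ a, s' a • B a)
      rw [ht, ht, hcompsum, hcompsum] at this
      exact this
  rw [ht, h0, LinearMap.zero_apply]

end SpinStructure

end

section

variable {M : Type*} [TopologicalSpace M] [ChartedSpace E4 M] [IsManifold (𝓡 4) ∞ M]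

/-! ### The spin connection -/

namespace SpinStructure
variable {g : LorentzMetric M} {Ω : SpinorForm} {ι : Type*} (P : SpinStructure g Ω ι)

/-- The spin connection computed in the frame with index `i`. -/
def snab (i : ι) (ε : P.SpinorField) (x : M) (v : T x) : Spinor :=
  mvfderiv (𝓡 4) (P.comp i ε) x v
    + sgM (fun μ => g.cmp (fun ν => P.frame i ν x) (P.nabla (P.frame i μ) x v)) (P.comp i ε x)

theorem spinNabla_eq_snab (ε : P.SpinorField) (x : M) (v : T x) :
    P.spinNabla ε x v = P.snab (P.indexAt x) ε x v := by
  have h : ∀ μ, P.connForm x v (P.e x μ x) = P.nabla (P.e x μ) x v := fun μ => by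
    simp only [connForm, LinearMap.sum_apply, LinearMap.smulRight_apply, coord_apply]
    have := (P.isONFrame_e x).cmp_self μ
    simp [this]
  rw [spinNabla, snab, sigma_apply, comp_indexAt]
  simp only [h]
  rfl

theorem mdiff_frame {i : ι} {x : M} (hx : x ∈ P.baseSet i) (μ : Fin 4) :
    MDifferentiableAt (𝓡 4) ((𝓡 4).prod 𝓘(ℝ, E4))
      (fun y => TotalSpace.mk' E4 y (P.frame i μ y)) x :=
  ((P.contMDiffOn_frame i μ).contMDiffAt
    ((P.isOpen_baseSet _).mem_nhds hx)).mdifferentiableAt (by simp)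

theorem snab_add {i : ι} {x : M} (hx : x ∈ P.baseSet i) (ε ε' : P.SpinorField) (v : T x) :
    P.snab i (ε + ε') x v = P.snab i ε x v + P.snab i ε' x v := by
  rw [snab, comp_add, mvfderiv_add (P.mdiffAt_comp hx ε) (P.mdiffAt_comp hx ε'), snab, snab,
    Pi.add_apply, map_add, _root_.add_apply]
  abel

theorem snab_fsmul {i : ι} {x : M} (hx : x ∈ P.baseSet i) (f : CF M) (ε : P.SpinorField)
    (v : T x) : P.snab i (f • ε) x v =
      mvfderiv (𝓡 4) f x v • P.comp i ε x + f x • P.snab i ε x v := by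
  rw [snab, comp_fsmul, mvfderiv_smul (CF.mdiff f x) (P.mdiffAt_comp hx ε), snab,
    Pi.smul_apply', map_smul, _root_.add_apply, ContinuousLinearMap.smulRight_apply,
    _root_.smul_apply]
  module

theorem mvfderiv_pair {i : ι} {x : M} (hx : x ∈ P.baseSet i) (ε ε' : P.SpinorField) (v : T x) :
    mvfderiv (𝓡 4) (P.pair ε ε') x v = Ω.form (P.snab i ε x v) (P.comp i ε' x)
      + Ω.form (P.comp i ε x) (P.snab i ε' x v) := by
  have h0 : P.pair ε ε' =ᶠ[𝓝 x] fun y => Ω.form (P.comp i ε y) (P.comp i ε' y) := by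
    filter_upwards [(P.isOpen_baseSet i).mem_nhds hx] with y hy
    exact P.pair_eq_comp ε ε' hy
  rw [mvfderiv_congr h0, mvfderiv_bilin _ (P.mdiffAt_comp hx ε) (P.mdiffAt_comp hx ε'), snab, snab,
    map_add, map_add, LinearMap.add_apply, Ω.form_sgM]
  ring

variable [T2Space M]

/-- Metricity of the Levi-Civita connection for a global and a local vector field. -/
theorem mvfderiv_inn {x : M} {Y Z : ∀ y : M, T y}
    (hY : MDifferentiableAt (𝓡 4) ((𝓡 4).prod 𝓘(ℝ, E4)) (fun y => TotalSpace.mk' E4 y (Y y)) x)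
    (hZ : MDifferentiableAt (𝓡 4) ((𝓡 4).prod 𝓘(ℝ, E4)) (fun y => TotalSpace.mk' E4 y (Z y)) x)
    (v : T x) : mvfderiv (𝓡 4) (fun y => g.val y (Y y) (Z y)) x v =
      g.val x (P.nabla Y x v) (Z x) + g.val x (Y x) (P.nabla Z x v) := by
  obtain ⟨X, rfl⟩ := exists_vfield x v
  have hX : MDifferentiableAt (𝓡 4) ((𝓡 4).prod 𝓘(ℝ, E4))
    (fun y => TotalSpace.mk' E4 y (X y)) x := X.mdifferentiableAt
  rw [g.symm x (Y x), P.val_nabla hX hY hZ, P.val_nabla hX hZ hY]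
  have h : ∀ Y Z : ∀ y : M, T y, (fun y => g.val y (Y y) (Z y)) = fun y => g.val y (Z y) (Y y) :=
    fun Y Z => funext fun y => g.symm y _ _
  unfold koszul
  rw [h X Z, h Z Y, h Y X, VectorField.mlieBracket_swap_apply (V := Y) (W := X),
    VectorField.mlieBracket_swap_apply (V := X) (W := Z),
    VectorField.mlieBracket_swap_apply (V := Z) (W := Y)]
  simp only [map_neg, _root_.neg_apply]
  ring

theorem nabla_frame_skew {i : ι} {x : M} (hx : x ∈ P.baseSet i) (v : T x) (μ ν : Fin 4) :
    g.val x (P.nabla (P.frame i μ) x v) (P.frame i ν x) =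
      -g.val x (P.frame i μ x) (P.nabla (P.frame i ν) x v) := by
  have h := P.mvfderiv_inn (P.mdiff_frame hx μ) (P.mdiff_frame hx ν) v
  have h0 : (fun y => g.val y (P.frame i μ y) (P.frame i ν y)) =ᶠ[𝓝 x]
      fun _ => if μ = ν then mink μ else 0 := by
    filter_upwards [(P.isOpen_baseSet i).mem_nhds hx] with y hy
    exact P.orthonormal i y hy μ ν
  rw [mvfderiv_congr h0, mvfderiv_const] at h
  have h' : (0 : ℝ) = _ := h
  linarith

/-- Leibniz rule for Clifford multiplication. Differentiating the components of Y gives those of ∇_v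
Y plus a term `w` from the motion of the frame; the commutator of σ(θ(v)) with Y is −w and cancels
it. -/
theorem snab_cm {i : ι} {x : M} (hx : x ∈ P.baseSet i) (Y : VField M) (ε : P.SpinorField)
    (v : T x) : P.snab i (P.cm Y ε) x v =
      clM (g.cmp (fun ν => P.frame i ν x) (P.nabla Y x v)) (P.comp i ε x)
        + clM (g.cmp (fun ν => P.frame i ν x) (Y x)) (P.snab i ε x v) := by
  let B : (Fin 4 → ℝ) →ₗ[ℝ] Spinor →ₗ[ℝ] Spinor :=
    LinearMap.mk₂ ℝ (fun v s => clM v s)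
      (fun v w s => by simp [clM, add_smul, Finset.sum_add_distrib])
      (fun c v s => by simp [clM, Finset.smul_sum, smul_smul])
      (fun v s s' => map_add _ _ _) (fun c v s => map_smul _ _ _)
  set c : M → Fin 4 → ℝ := fun y => g.cmp (fun ν => P.frame i ν y) (Y y) with hc
  have hYd : MDifferentiableAt (𝓡 4) ((𝓡 4).prod 𝓘(ℝ, E4))
    (fun y => TotalSpace.mk' E4 y (Y y)) x := Y.mdifferentiableAt
  have hcμ : ∀ μ, MDifferentiableAt (𝓡 4) 𝓘(ℝ, ℝ)
      (fun y => g.val y (Y y) (P.frame i μ y)) x := fun μ =>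
    g.mdiff_apply hYd (P.mdiff_frame hx μ)
  have hcd : MDifferentiableAt (𝓡 4) 𝓘(ℝ, Fin 4 → ℝ) c x :=
    mdifferentiableAt_pi_space fun μ => mdifferentiableAt_const.mul (hcμ μ)
  have h0 : P.comp i (P.cm Y ε) =ᶠ[𝓝 x] fun y => B (c y) (P.comp i ε y) := by
    filter_upwards [(P.isOpen_baseSet i).mem_nhds hx] with y hy
    exact P.comp_cm Y ε hy
  set w : Fin 4 → ℝ := fun μ => mink μ * g.val x (Y x) (P.nabla (P.frame i μ) x v) with hw
  have hdc : mvfderiv (𝓡 4) c x v = g.cmp (fun ν => P.frame i ν x) (P.nabla Y x v) + w := by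
    ext μ
    have h1 := mvfderiv_linearMap (LinearMap.proj μ : (Fin 4 → ℝ) →ₗ[ℝ] ℝ) hcd v
    have h2 : mvfderiv (𝓡 4) (fun y => (LinearMap.proj μ : (Fin 4 → ℝ) →ₗ[ℝ] ℝ) (c y)) x v =
        mink μ * mvfderiv (𝓡 4) (fun y => g.val y (Y y) (P.frame i μ y)) x v := by
      have h3 := mvfderiv_linearMap (mink μ • LinearMap.id : ℝ →ₗ[ℝ] ℝ) (hcμ μ) v
      exact h3
    rw [h2, P.mvfderiv_inn hYd (P.mdiff_frame hx μ)] at h1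
    rw [Pi.add_apply, LorentzMetric.cmp, hw, ← mul_add]
    exact h1.symm
  have hskew := sgM_clM (A := fun μ => g.cmp (fun ν => P.frame i ν x)
    (P.nabla (P.frame i μ) x v)) (LorentzMetric.cmp_skew fun μ ν => P.nabla_frame_skew hx v μ ν)
    (c x)
  have hw' : (fun ν => ∑ μ, c x μ * g.cmp (fun ν => P.frame i ν x)
      (P.nabla (P.frame i μ) x v) ν) = (-1 : ℝ) • w := by
    ext ν
    have h1 : ∀ μ, g.cmp (fun ν => P.frame i ν x) (P.nabla (P.frame i μ) x v) ν =
        -(mink ν * g.val x (P.frame i μ x) (P.nabla (P.frame i ν) x v)) := fun μ => by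
      rw [LorentzMetric.cmp, P.nabla_frame_skew hx, mul_neg]
    have h2 : g.val x (Y x) (P.nabla (P.frame i ν) x v) =
        ∑ μ, c x μ * g.val x (P.frame i μ x) (P.nabla (P.frame i ν) x v) := by
      conv_lhs => rw [← (P.isONFrame hx).sum_cmp (Y x)]
      simp [hc]
    simp only [h1, hw, Pi.smul_apply, smul_eq_mul, h2, Finset.mul_sum]
    exact Finset.sum_congr rfl fun μ _ => by ring
  have hs := LinearMap.congr_fun hskew (P.comp i ε x)
  rw [hw'] at hs
  have hB : ∀ v s, B v s = clM v s := fun _ _ => rfl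
  have hneg : clM ((-1 : ℝ) • w) (P.comp i ε x) = -B w (P.comp i ε x) := by
    rw [neg_one_smul ℝ w, ← hB, map_neg]
    rfl
  rw [LinearMap.sub_apply, Module.End.mul_apply, Module.End.mul_apply, hneg,
    sub_eq_iff_eq_add] at hs
  rw [snab, mvfderiv_congr h0, mvfderiv_bilin B hcd (P.mdiffAt_comp hx ε), P.comp_cm Y ε hx, hdc,
    map_add, LinearMap.add_apply, snab, map_add, hs]
  change _ + B w _ + clM _ _ + (-B w _ + _) = clM _ _ + (clM _ _ + _)
  rw [hB]
  abel

/-- Independence of the frame, without a transformation law for connection forms: the connections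
computed in two frames satisfy the same three Leibniz rules, so their difference is linear over
functions, commutes with Clifford multiplication and is skew. -/
theorem coordChange_snab {i j : ι} {x : M} (hi : x ∈ P.baseSet i) (hj : x ∈ P.baseSet j)
    (ε : P.SpinorField) (v : T x) :
    P.coordChange i j x (P.snab i ε x v) = P.snab j ε x v := by
  rw [← sub_eq_zero]
  refine P.operator_eq_zero hj (fun ε => P.coordChange i j x (P.snab i ε x v) - P.snab j ε x v)
    (fun ε ε' => ?_) (fun f ε => ?_) (fun X ε => ?_) (fun ε ε' => ?_) ε
  · rw [P.snab_add hi, P.snab_add hj, map_add]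
    abel
  · rw [P.snab_fsmul hi, P.snab_fsmul hj, map_add, map_smul, map_smul,
      P.coordChange_comp_comp hi hj]
    module
  · rw [P.snab_cm hi, P.snab_cm hj, map_add, P.coordChange_clM hi hj, P.coordChange_clM hi hj,
      P.coordChange_comp_comp hi hj, map_sub]
    abel
  · have h1 := P.mvfderiv_pair hi ε ε' v
    have h2 := P.mvfderiv_pair hj ε ε' v
    rw [← P.preserves_form i j x ⟨hi, hj⟩, ← P.preserves_form i j x ⟨hi, hj⟩ (P.comp i ε x),
      P.coordChange_comp_comp hi hj, P.coordChange_comp_comp hi hj] at h1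
    simp only [map_sub, LinearMap.sub_apply]
    linarith

/-- The spin connection acting on spinor fields. -/
def scov (X : VField M) (ε : P.SpinorField) : P.SpinorField :=
  ⟨fun x => P.spinNabla ε x (X x), fun x => by
    have hx := P.mem_baseSet_at x
    rw [P.contMDiffAt_section_iff hx]
    obtain ⟨E, hE⟩ := P.exists_frame hx
    -- Near x the components of ε and the frame are replaced by global functions `c` and global
    -- fields `E`; smoothness then follows from that of `dirD`, `cov` and `inn`.
    choose c hc using fun a : Fin 4 => exists_function_eventuallyEq (P.isOpen_baseSet _)
      (fun y hy => ((contMDiffAt_pi_space.1 (P.contMDiffAt_comp hy ε)) a).contMDiffWithinAt) hx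
    have hd : ContMDiffAt (𝓡 4) 𝓘(ℝ, Spinor) ∞ (fun y a => dirD X (c a) y) x :=
      contMDiffAt_pi_space.2 fun a => ContMDiffMap.contMDiff _ x
    have hcomp := P.contMDiffAt_comp hx ε
    have hcl : ∀ (s : M → Spinor) (_ : ContMDiffAt (𝓡 4) 𝓘(ℝ, Spinor) ∞ s x) (μ : Fin 4),
        ContMDiffAt (𝓡 4) 𝓘(ℝ, Spinor) ∞
          (fun y => clM (fun ν => (mink ν • g.inn (P.cov X (E μ)) (E ν)) y) (s y)) x :=
      fun s hs μ => contMDiffAt_clM (fun ν => ContMDiffMap.contMDiff _ x) hs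
    have hsg : ContMDiffAt (𝓡 4) 𝓘(ℝ, Spinor) ∞ (fun y => (8 : ℝ)⁻¹ • ∑ μ, mink μ •
        (gamma μ (clM (fun ν => (mink ν • g.inn (P.cov X (E μ)) (E ν)) y)
            (P.comp (P.indexAt x) ε y))
          - clM (fun ν => (mink ν • g.inn (P.cov X (E μ)) (E ν)) y)
            (gamma μ (P.comp (P.indexAt x) ε y)))) x := by
      have h := contMDiffAt_linearMap ((8 : ℝ)⁻¹ • 1) (ContMDiffAt.sum (t := Finset.univ)
        fun μ _ => contMDiffAt_linearMap (mink μ • 1)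
          ((contMDiffAt_linearMap (gamma μ) (hcl _ hcomp μ)).sub
            (hcl _ (contMDiffAt_linearMap (gamma μ) hcomp) μ)))
      simpa only [LinearMap.smul_apply, Module.End.one_apply] using h
    refine (hd.add hsg).congr_of_eventuallyEq ?_
    filter_upwards [hE, hE.eventually_nhds, Filter.eventually_all.2 fun a => (hc a).eventually_nhds]
      with y hy hy' hcy
    have h1 := P.coordChange_snab (P.mem_baseSet_at y) hy.1 ε (X y)
    rw [← spinNabla_eq_snab] at h1
    refine h1.trans ?_
    have h2 : mvfderiv (𝓡 4) (P.comp (P.indexAt x) ε) y (X y) = fun a => dirD X (c a) y := by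
      ext a
      have h3 := mvfderiv_linearMap (LinearMap.proj a : Spinor →ₗ[ℝ] ℝ) (P.mdiffAt_comp hy.1 ε)
        (X y)
      refine h3.symm.trans ?_
      rw [dirD_apply, mvfderiv_congr (hcy a)]
      rfl
    have h4 : ∀ μ, P.nabla (P.frame (P.indexAt x) μ) y (X y) = P.cov X (E μ) y := fun μ => by
      rw [cov_apply, P.nabla_congr (hy'.mono fun z hz => hz.2 μ)]
    rw [snab, h2]
    simp only [h4]
    refine congrArg₂ (· + ·) rfl ?_
    simp only [sgM, LinearMap.smul_apply, LinearMap.sum_apply, LinearMap.sub_apply,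
      Module.End.mul_apply]
    have h5 : ∀ μ, g.cmp (fun ν => P.frame (P.indexAt x) ν y) (P.cov X (E μ) y) =
        fun ν => (mink ν • g.inn (P.cov X (E μ)) (E ν)) y := fun μ => by
      ext ν
      rw [LorentzMetric.cmp, ← hy.2 ν]
      rfl
    simp only [h5]⟩

@[simp] theorem eval_scov (X : VField M) (ε : P.SpinorField) (x : M) :
    P.evalSpinor x (P.scov X ε) = P.spinNabla ε x (X x) := rfl

variable (X Y : VField M) (f : CF M) (ε ε' : P.SpinorField)

@[simp] theorem scov_add : P.scov X (ε + ε') = P.scov X ε + P.scov X ε' := by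
  refine SpinorField.ext fun x => ?_
  simp only [eval_scov, spinNabla_eq_snab, map_add, P.snab_add (P.mem_baseSet_at x)]

theorem scov_fsmul : P.scov X (f • ε) = dirD X f • ε + f • P.scov X ε := by
  refine SpinorField.ext fun x => ?_
  have h := P.snab_fsmul (P.mem_baseSet_at x) f ε (X x)
  rw [comp_indexAt, ← spinNabla_eq_snab, ← spinNabla_eq_snab] at h
  exact h

theorem scov_cm : P.scov X (P.cm Y ε) = P.cm (P.cov X Y) ε + P.cm Y (P.scov X ε) := by
  refine SpinorField.ext fun x => ?_
  have h := P.snab_cm (P.mem_baseSet_at x) Y ε (X x)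
  rw [comp_indexAt, ← spinNabla_eq_snab, ← spinNabla_eq_snab] at h
  rw [eval_scov, h, map_add, eval_cm, eval_cm, cliff_apply, cliff_apply]
  rfl

theorem dirD_pair : dirD X (P.pair ε ε') = P.pair (P.scov X ε) ε' + P.pair ε (P.scov X ε') := by
  ext x
  have h := P.mvfderiv_pair (P.mem_baseSet_at x) ε ε' (X x)
  rw [comp_indexAt, comp_indexAt, ← spinNabla_eq_snab, ← spinNabla_eq_snab] at h
  exact h

end SpinStructure

end

section

variable {M : Type*} [TopologicalSpace M] [ChartedSpace E4 M] [IsManifold (𝓡 4) ∞ M]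

/-! ### Killing vectors and curvature -/

/-- A vector field along which the Lie derivative of the metric vanishes. -/
def LorentzMetric.IsKilling (g : LorentzMetric M) (X : VField M) : Prop :=
  ∀ Y Z, dirD X (g.inn Y Z) = g.inn (lieV X Y) Z + g.inn Y (lieV X Z)

theorem mem_k0_iff {g : LorentzMetric M} {Φ : Fields M} {X : VField M} : X ∈ k0 g Φ ↔
    g.IsKilling X ∧ dirD X Φ.a = 0 ∧ dirD X Φ.b = 0 ∧ lieV X Φ.φ = 0 := by
  refine and_congr ⟨fun h Y Z => ContMDiffMap.ext (h Y Z), fun h Y Z x =>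
    congrArg (fun f : CF M => f x) (h Y Z)⟩ (and_congr ?_ (and_congr ?_ ?_))
  · exact ⟨fun h => ContMDiffMap.ext h, fun h x => congrArg (fun f : CF M => f x) h⟩
  · exact ⟨fun h => ContMDiffMap.ext h, fun h x => congrArg (fun f : CF M => f x) h⟩
  · exact ⟨fun h => ContMDiffSection.ext h, fun h x => congrArg (fun f : VField M => f x) h⟩

theorem lieV_zero_right (X : VField M) : lieV X 0 = 0 := by
  have h := lieV_add_right X 0 0
  rw [add_zero] at h
  exact left_eq_add.1 h

theorem dirD_zero (X : VField M) : dirD X 0 = 0 := by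
  have h := dirD_add X 0 0
  rw [add_zero] at h
  exact left_eq_add.1 h

section
variable [T2Space M]

theorem LorentzMetric.IsKilling.lieV {g : LorentzMetric M} {X Y : VField M} (hX : g.IsKilling X)
    (hY : g.IsKilling Y) : g.IsKilling (KSA.lieV X Y) := fun Z W => by
  rw [dirD_lieV, hX Z W, hY Z W, dirD_add, dirD_add, hX, hX, hY, hY]
  have h : ∀ Z, KSA.lieV (KSA.lieV X Y) Z =
      KSA.lieV X (KSA.lieV Y Z) - KSA.lieV Y (KSA.lieV X Z) := fun Z => by
    rw [lieV_jacobi X Y Z]; abel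
  rw [h, h, g.inn_sub_left, g.inn_sub_right]
  abel

theorem lieV_mem_k0 {g : LorentzMetric M} {Φ : Fields M} {X Y : VField M} (hX : X ∈ k0 g Φ)
    (hY : Y ∈ k0 g Φ) : lieV X Y ∈ k0 g Φ := by
  rw [mem_k0_iff] at *
  obtain ⟨h1, h2, h3, h4⟩ := hX
  obtain ⟨h1', h2', h3', h4'⟩ := hY
  refine ⟨h1.lieV h1', ?_, ?_, ?_⟩
  · rw [dirD_lieV, h2, h2', dirD_zero, dirD_zero, sub_zero]
  · rw [dirD_lieV, h3, h3', dirD_zero, dirD_zero, sub_zero]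
  · have h := lieV_jacobi X Y Φ.φ
    rw [h4, h4', lieV_zero_right, lieV_zero_right, add_zero] at h
    exact h.symm

namespace SpinStructure
variable {g : LorentzMetric M} {Ω : SpinorForm} {ι : Type*} (P : SpinStructure g Ω ι)

/-- Writing the brackets in ℒ_X g with the torsion-free metric connection leaves exactly the
symmetric part of ∇X. -/
theorem isKilling_iff {X : VField M} :
    g.IsKilling X ↔ ∀ Y Z, g.inn (P.cov Y X) Z = -g.inn Y (P.cov Z X) := by
  refine forall₂_congr fun Y Z => ?_
  rw [P.dirD_inn, ← P.cov_sub_cov, ← P.cov_sub_cov, g.inn_sub_left, g.inn_sub_right, ← sub_eq_zero,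
    eq_neg_iff_add_eq_zero]
  have h : g.inn (P.cov X Y) Z + g.inn Y (P.cov X Z) - (g.inn (P.cov X Y) Z - g.inn (P.cov Y X) Z
    + (g.inn Y (P.cov X Z) - g.inn Y (P.cov Z X))) =
    g.inn (P.cov Y X) Z + g.inn Y (P.cov Z X) := by abel
  rw [h]

theorem aMap_cov (X Z : VField M) (x : M) : P.aMap X x (Z x) = -P.cov Z X x := rfl

theorem isKilling_iff_aMap {X : VField M} : g.IsKilling X ↔ ∀ x, P.aMap X x ∈ g.so x := by
  rw [P.isKilling_iff]
  constructor
  · intro h x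
    rw [LorentzMetric.mem_so]
    intro v w
    obtain ⟨Y, rfl⟩ := exists_vfield x v
    obtain ⟨Z, rfl⟩ := exists_vfield x w
    have := congrArg (fun f : CF M => f x) (h Y Z)
    rw [aMap_cov, aMap_cov, map_neg, map_neg, _root_.neg_apply]
    exact congrArg Neg.neg this
  · intro h Y Z
    ext x
    have := LorentzMetric.mem_so.1 (h x) (Y x) (Z x)
    rw [aMap_cov, aMap_cov, map_neg, map_neg, _root_.neg_apply] at this
    exact neg_injective this

/-- Killing vectors preserve the Levi-Civita connection. -/
theorem lieV_cov {X : VField M} (hX : g.IsKilling X) (Y Z : VField M) :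
    lieV X (P.cov Y Z) = P.cov (lieV X Y) Z + P.cov Y (lieV X Z) := by
  refine g.ext_inn fun W => ?_
  have h1 := hX (P.cov Y Z) W
  have hs : ∀ f : CF M, dirD X ((2⁻¹ : ℝ) • f) = (2⁻¹ : ℝ) • dirD X f := fun f => by
    have h := dirD_mul X (ContMDiffMap.const (2⁻¹ : ℝ)) f
    have h' : dirD X (ContMDiffMap.const (2⁻¹ : ℝ)) = 0 := by
      ext x
      exact congrArg (fun L : T x →L[ℝ] ℝ => L (X x)) (mvfderiv_const (I := 𝓡 4) (2⁻¹ : ℝ))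
    rw [h', zero_mul, zero_add] at h
    exact h
  have hc : ∀ (U : VField M) f, dirD X (dirD U f) = dirD (lieV X U) f + dirD U (dirD X f) :=
    fun U f => by rw [dirD_lieV]; abel
  -- The Koszul expression is built from the metric, derivatives and commutators only; a Killing
  -- vector differentiates each of these by the Leibniz rule.
  have hk : dirD X (g.kosz Y Z W) =
      g.kosz (lieV X Y) Z W + g.kosz Y (lieV X Z) W + g.kosz Y Z (lieV X W) := by
    simp only [LorentzMetric.kosz, dirD_add, dirD_sub, hc, hX _ _, lieV_jacobi X, g.inn_add_left]
    abel
  rw [inn_cov, inn_cov, hs, hk] at h1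
  rw [g.inn_add_left, inn_cov, inn_cov, eq_sub_of_add_eq h1.symm]
  module

/-! ### The Riemann curvature and Killing vectors -/

/-- The curvature `∇_{[X, Y]} Z - ∇_X ∇_Y Z + ∇_Y ∇_X Z`. -/
def curv (X Y Z : VField M) : VField M :=
  P.cov (lieV X Y) Z - P.cov X (P.cov Y Z) + P.cov Y (P.cov X Z)

variable (X Y Z W : VField M) (f : CF M) (x : M)

theorem curv_swap : P.curv Y X Z = -P.curv X Y Z := by
  rw [curv, curv, lieV_swap, cov_neg_left]
  abel

theorem curv_add_left : P.curv (X + Y) Z W = P.curv X Z W + P.curv Y Z W := by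
  simp only [curv, lieV_add_left, cov_add_left, cov_add_right]
  abel

theorem curv_fsmul_left : P.curv (f • X) Y Z = f • P.curv X Y Z := by
  simp only [curv, lieV_fsmul_left, cov_fsmul_left, cov_fsmul_right, cov_sub_left]
  module

theorem curv_add_middle : P.curv X (Y + Z) W = P.curv X Y W + P.curv X Z W := by
  rw [curv_swap, curv_add_left, curv_swap P X Y, curv_swap P X Z]
  abel

theorem curv_fsmul_middle : P.curv X (f • Y) Z = f • P.curv X Y Z := by
  rw [curv_swap, curv_fsmul_left, curv_swap P X Y, smul_neg, neg_neg]

theorem curv_add_right : P.curv X Y (Z + W) = P.curv X Y Z + P.curv X Y W := by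
  simp only [curv, cov_add_right]
  abel

/-- The second derivatives of f combine to [X, Y]f and cancel; the mixed first-order terms cancel in
pairs. -/
theorem curv_fsmul_right : P.curv X Y (f • Z) = f • P.curv X Y Z := by
  simp only [curv, cov_fsmul_right, cov_add_right, dirD_lieV]
  module

/-- The Jacobi identity with every commutator rewritten as ∇_X Y − ∇_Y X. -/
theorem curv_bianchi : P.curv X Y Z + P.curv Y Z X + P.curv Z X Y = 0 := by
  have h := lieV_jacobi X Y Z
  rw [← P.cov_sub_cov X (lieV Y Z), ← P.cov_sub_cov (lieV X Y) Z, ← P.cov_sub_cov Y (lieV X Z),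
    lieV_swap X Z] at h
  simp only [← P.cov_sub_cov Y Z, ← P.cov_sub_cov Z X, ← P.cov_sub_cov X Y, cov_sub_right,
    cov_sub_left, cov_neg_left, cov_neg_right] at h
  rw [← sub_eq_zero] at h
  simp only [curv, ← P.cov_sub_cov X Y, ← P.cov_sub_cov Y Z, ← P.cov_sub_cov Z X, cov_sub_left]
  rw [← neg_eq_zero, ← h]
  abel

theorem inn_curv : g.inn (P.curv X Y Z) W = -g.inn Z (P.curv X Y W) := by
  have h := dirD_lieV X Y (g.inn Z W)
  simp only [P.dirD_inn, dirD_add] at h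
  rw [← sub_eq_zero] at h
  rw [eq_neg_iff_add_eq_zero, ← h]
  simp only [curv, g.inn_add_left, g.inn_sub_left, g.inn_add_right, g.inn_sub_right]
  abel

end SpinStructure

/-- A map on vector fields which is linear over functions at `x` depends only on the value
at `x`. -/
theorem vfield_map_congr {A : Type*} [AddCommGroup A] [Module ℝ A] {x : M} (Ψ : VField M → A)
    (hadd : ∀ s t, Ψ (s + t) = Ψ s + Ψ t) (hsmul : ∀ (f : CF M) s, Ψ (f • s) = f x • Ψ s)
    {X X' : VField M} (h : X x = X' x) : Ψ X = Ψ X' := by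
  let e := trivializationAt E4 (TangentSpace (𝓡 4) : M → Type _) x
  let b := Module.finBasis ℝ E4
  have hx : x ∈ e.baseSet := FiberBundle.mem_baseSet_trivializationAt _ _ x
  have hfr : ∀ i, ContMDiffOn (𝓡 4) ((𝓡 4).prod 𝓘(ℝ, E4)) ∞
      (fun y => TotalSpace.mk' E4 y (e.localFrame b i y)) e.baseSet :=
    fun i => e.contMDiffOn_localFrame_baseSet ∞ b i
  have h0 : Ψ (X + (-1 : CF M) • X') = 0 :=
    map_eq_zero_of_linear e.open_baseSet hx hfr Ψ hadd hsmul _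
      (c := fun i y => e.localFrameCoeff (𝓡 4) b i y ((X + (-1 : CF M) • X') y))
      (fun i => contMDiffOn_baseSet_localFrameCoeff b
        (ContMDiffSection.contMDiff _).contMDiffOn i)
      (fun y hy => Trivialization.eq_sum_localFrameCoeff_smul (s := ⇑(X + (-1 : CF M) • X')) hy)
      (fun i => by
        have : (X + (-1 : CF M) • X') x = 0 := by
          change X x + (-1 : ℝ) • X' x = 0
          rw [h]; module
        rw [this, map_zero])
  rw [hadd, hsmul] at h0
  change Ψ X + (-1 : ℝ) • Ψ X' = 0 at h0
  rw [neg_one_smul, add_neg_eq_zero] at h0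
  exact h0

namespace SpinStructure
variable {g : LorentzMetric M} {Ω : SpinorForm} {ι : Type*} (P : SpinStructure g Ω ι)

theorem vfield_map_eq_sum {A : Type*} [AddCommGroup A] [Module ℝ A] {x : M} (Ψ : VField M → A)
    (hadd : ∀ s t, Ψ (s + t) = Ψ s + Ψ t) (hsmul : ∀ (f : CF M) s, Ψ (f • s) = f x • Ψ s)
    {E : Fin 4 → VField M} (hE : ∀ μ, E μ x = P.e x μ x) (X : VField M) :
    Ψ X = ∑ μ, P.coord x μ (X x) • Ψ (E μ) := by
  have h : X x = (∑ μ, (ContMDiffMap.const (P.coord x μ (X x)) : CF M) • E μ) x := by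
    rw [section_sum_apply]
    simp only [fsmul_apply, hE]
    exact (P.sum_coord x (X x)).symm
  have hm : ∀ c : Fin 4 → CF M, Ψ (∑ μ, c μ • E μ) = ∑ μ, c μ x • Ψ (E μ) := fun c => by
    simp only [Fin.sum_univ_four, hadd, hsmul]
  rw [vfield_map_congr Ψ hadd hsmul h, hm]
  rfl

/-- `riemann` is given by its values on the chosen frame; tensoriality of `curv` in each slot
carries the equality to arbitrary fields. -/
theorem riemann_apply (X Y Z : VField M) (x : M) :
    P.riemann x (X x) (Y x) (Z x) = P.curv X Y Z x := by
  obtain ⟨E, hE⟩ := P.exists_frame (P.mem_baseSet_at x)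
  have hEx : ∀ μ, E μ x = P.e x μ x := hE.self_of_nhds.2
  have hEn : ∀ μ, (P.e x μ) =ᶠ[𝓝 x] E μ := fun μ => hE.mono fun y hy => (hy.2 μ).symm
  have hn : ∀ μ ν, ∀ᶠ y in 𝓝 x, P.nabla (P.e x μ) y (P.e x ν y) = P.cov (E ν) (E μ) y :=
    fun μ ν => by
      filter_upwards [hE, hE.eventually_nhds] with y hy hy'
      rw [cov_apply, hy.2, P.nabla_congr (hy'.mono fun z hz => hz.2 μ)]
      rfl
  have hR : ∀ μ ν ρ,
      P.nabla (P.e x ρ) x (VectorField.mlieBracket (𝓡 4) (P.e x μ) (P.e x ν) x)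
      - P.nabla (fun y => P.nabla (P.e x ρ) y (P.e x ν y)) x (P.e x μ x)
      + P.nabla (fun y => P.nabla (P.e x ρ) y (P.e x μ y)) x (P.e x ν x) =
      P.curv (E μ) (E ν) (E ρ) x := fun μ ν ρ => by
    rw [P.nabla_congr (hn ρ ν), P.nabla_congr (hn ρ μ), P.nabla_congr (hEn ρ),
      Filter.EventuallyEq.mlieBracket_vectorField_eq (hEn μ) (hEn ν), ← hEx μ, ← hEx ν]
    rfl
  have h1 := P.vfield_map_eq_sum (fun X => P.curv X Y Z x)
    (fun s t => congrArg (fun V : VField M => V x) (P.curv_add_left s t Y Z))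
    (fun f s => congrArg (fun V : VField M => V x) (P.curv_fsmul_left s Y Z f)) hEx X
  have h2 := fun μ => P.vfield_map_eq_sum (fun Y => P.curv (E μ) Y Z x)
    (fun s t => congrArg (fun V : VField M => V x) (P.curv_add_middle (E μ) s t Z))
    (fun f s => congrArg (fun V : VField M => V x) (P.curv_fsmul_middle (E μ) s Z f)) hEx Y
  have h3 := fun μ ν => P.vfield_map_eq_sum (fun Z => P.curv (E μ) (E ν) Z x)
    (fun s t => congrArg (fun V : VField M => V x) (P.curv_add_right (E μ) (E ν) s t))
    (fun f s => congrArg (fun V : VField M => V x) (P.curv_fsmul_right (E μ) (E ν) s f)) hEx Z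
  simp only [h2, h3] at h1
  rw [h1]
  simp only [riemann, hR, LinearMap.sum_apply, LinearMap.smul_apply, LinearMap.smulRight_apply,
    Finset.smul_sum, smul_smul, mul_assoc]

theorem riemann_mem_so (x : M) (u v : T x) : P.riemann x u v ∈ g.so x := by
  rw [LorentzMetric.mem_so]
  intro w z
  obtain ⟨X, rfl⟩ := exists_vfield x u
  obtain ⟨Y, rfl⟩ := exists_vfield x v
  obtain ⟨Z, rfl⟩ := exists_vfield x w
  obtain ⟨W, rfl⟩ := exists_vfield x z
  rw [riemann_apply, riemann_apply]
  exact congrArg (fun f : CF M => f x) (P.inn_curv X Y Z W)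

theorem riemann_bianchi (x : M) (u v w : T x) :
    P.riemann x u v w + P.riemann x v w u + P.riemann x w u v = 0 := by
  obtain ⟨X, rfl⟩ := exists_vfield x u
  obtain ⟨Y, rfl⟩ := exists_vfield x v
  obtain ⟨Z, rfl⟩ := exists_vfield x w
  rw [riemann_apply, riemann_apply, riemann_apply]
  exact congrArg (fun f : VField M => f x) (P.curv_bianchi X Y Z)

theorem riemann_swap (x : M) (u v : T x) : P.riemann x v u = -P.riemann x u v := by
  refine LinearMap.ext fun w => ?_
  obtain ⟨X, rfl⟩ := exists_vfield x u
  obtain ⟨Y, rfl⟩ := exists_vfield x v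
  obtain ⟨Z, rfl⟩ := exists_vfield x w
  rw [LinearMap.neg_apply, riemann_apply, riemann_apply, curv_swap]
  rfl

variable {P} {X Y : VField M}

/-- The second covariant derivative of a Killing vector is given by the curvature. -/
theorem cov_cov_of_isKilling (hY : g.IsKilling Y) (X Z : VField M) :
    P.cov Z (P.cov X Y) = P.cov (P.cov Z X) Y + P.curv Y Z X := by
  have h := P.lieV_cov hY Z X
  rw [← P.cov_sub_cov Y (P.cov Z X), ← P.cov_sub_cov Y X, cov_sub_right] at h
  rw [sub_eq_iff_eq_add] at h
  rw [curv, h]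
  abel

/-- `cov_cov_of_isKilling` turns the second derivatives of both fields into curvature, and the
Bianchi identity merges the two curvature terms into one. -/
theorem cov_lieV (hX : g.IsKilling X) (hY : g.IsKilling Y) (Z : VField M) :
    P.cov Z (lieV X Y) = P.cov (P.cov Z X) Y - P.cov (P.cov Z Y) X - P.curv X Y Z := by
  have h := P.curv_bianchi X Y Z
  rw [← P.cov_sub_cov X Y, cov_sub_right, cov_cov_of_isKilling hX, cov_cov_of_isKilling hY,
    P.curv_swap Z X Y]
  rw [add_assoc, add_eq_zero_iff_eq_neg] at h
  rw [h]
  abel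

/-- The term R(X, Y) is the failure of X ↦ A_X to be a homomorphism, and the source of the curvature
in the bracket of two vectors. -/
theorem aMap_lieV (hX : g.IsKilling X) (hY : g.IsKilling Y) (x : M) :
    P.aMap (lieV X Y) x = P.aMap X x * P.aMap Y x - P.aMap Y x * P.aMap X x
      + P.riemann x (X x) (Y x) := by
  refine LinearMap.ext fun w => ?_
  obtain ⟨Z, rfl⟩ := exists_vfield x w
  have h := congrArg (fun V : VField M => V x) (P.cov_lieV hX hY Z)
  change P.cov Z (lieV X Y) x = P.cov (P.cov Z X) Y x - P.cov (P.cov Z Y) X x - P.curv X Y Z x at h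
  rw [aMap_cov, h, LinearMap.add_apply, LinearMap.sub_apply, Module.End.mul_apply,
    Module.End.mul_apply, aMap_cov, aMap_cov, map_neg, map_neg, aMap_cov, aMap_cov, riemann_apply]
  abel

variable (P X Y) in
theorem lieV_eq_aMap (x : M) : lieV X Y x = P.aMap X x (Y x) - P.aMap Y x (X x) := by
  have h := congrArg (fun V : VField M => V x) (P.cov_sub_cov X Y)
  rw [aMap_cov, aMap_cov, ← h]
  change P.cov X Y x - P.cov Y X x = _
  abel

end SpinStructure

end

end

section

variable {M : Type*} [TopologicalSpace M] [ChartedSpace E4 M] [IsManifold (𝓡 4) ∞ M]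

/-! ### The spinorial Lie derivative -/

namespace SpinStructure
variable {g : LorentzMetric M} {Ω : SpinorForm} {ι : Type*} (P : SpinStructure g Ω ι)

theorem connForm_add (x : M) (v w : T x) : P.connForm x (v + w) = P.connForm x v + P.connForm x w := by
  refine LinearMap.ext fun u => ?_
  simp only [connForm, LinearMap.sum_apply, LinearMap.smulRight_apply, map_add, LinearMap.add_apply,
    smul_add, Finset.sum_add_distrib]

theorem connForm_smul (x : M) (c : ℝ) (v : T x) : P.connForm x (c • v) = c • P.connForm x v := by
  refine LinearMap.ext fun u => ?_
  simp only [connForm, LinearMap.sum_apply, LinearMap.smulRight_apply, map_smul,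
    LinearMap.smul_apply, Finset.smul_sum, smul_comm c]

theorem spinNabla_add_vec (ε : P.SpinorField) (x : M) (v w : T x) :
    P.spinNabla ε x (v + w) = P.spinNabla ε x v + P.spinNabla ε x w := by
  rw [spinNabla, spinNabla, spinNabla, connForm_add, map_add, map_add, LinearMap.add_apply]
  abel

theorem spinNabla_smul_vec (ε : P.SpinorField) (x : M) (c : ℝ) (v : T x) :
    P.spinNabla ε x (c • v) = c • P.spinNabla ε x v := by
  rw [spinNabla, spinNabla, connForm_smul, map_smul, map_smul, LinearMap.smul_apply, smul_add]

variable (X Y Z : VField M) (f : CF M) (ε ε' ε'' : P.SpinorField)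

@[simp] theorem pair_add_left : P.pair (ε + ε') ε'' = P.pair ε ε'' + P.pair ε' ε'' := by
  ext x
  change Ω.form _ _ = Ω.form _ _ + Ω.form _ _
  rw [map_add, map_add, LinearMap.add_apply]

@[simp] theorem pair_add_right : P.pair ε (ε' + ε'') = P.pair ε ε' + P.pair ε ε'' := by
  ext x
  change Ω.form _ _ = Ω.form _ _ + Ω.form _ _
  rw [map_add, map_add]

@[simp] theorem pair_sub_left : P.pair (ε - ε') ε'' = P.pair ε ε'' - P.pair ε' ε'' := by
  ext x
  change Ω.form _ _ = Ω.form _ _ - Ω.form _ _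
  rw [map_sub, map_sub, LinearMap.sub_apply]

@[simp] theorem pair_sub_right : P.pair ε (ε' - ε'') = P.pair ε ε' - P.pair ε ε'' := by
  ext x
  change Ω.form _ _ = Ω.form _ _ - Ω.form _ _
  rw [map_sub, map_sub]

variable [T2Space M]

@[simp] theorem cm_add_left : P.cm (X + Y) ε = P.cm X ε + P.cm Y ε :=
  SpinorField.ext fun x => by
    rw [map_add, eval_cm, eval_cm, eval_cm, ← LinearMap.add_apply, ← map_add]; rfl

@[simp] theorem cm_add_right : P.cm X (ε + ε') = P.cm X ε + P.cm X ε' :=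
  SpinorField.ext fun x => by simp only [eval_cm, map_add]

@[simp] theorem cm_sub_left : P.cm (X - Y) ε = P.cm X ε - P.cm Y ε :=
  SpinorField.ext fun x => by
    rw [map_sub, eval_cm, eval_cm, eval_cm, ← LinearMap.sub_apply, ← map_sub]; rfl

@[simp] theorem cm_sub_right : P.cm X (ε - ε') = P.cm X ε - P.cm X ε' :=
  SpinorField.ext fun x => by simp only [eval_cm, map_sub]

theorem scov_volS : P.scov X (P.volS ε) = P.volS (P.scov X ε) :=
  SpinorField.ext fun x => by
    have h : P.comp (P.indexAt x) (P.volS ε) =ᶠ[𝓝 x] fun y => vol (P.comp (P.indexAt x) ε y) := by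
      filter_upwards [(P.isOpen_baseSet _).mem_nhds (P.mem_baseSet_at x)] with y hy
      exact P.comp_volS ε hy
    rw [eval_scov, eval_volS, eval_scov, spinNabla, mvfderiv_congr h,
      mvfderiv_linearMap vol (P.mdiffAt_comp (P.mem_baseSet_at x) ε), eval_volS, sigma_vol,
      spinNabla, map_add]

/-- Commutant uniqueness at a point, in terms of the Clifford action on the fibre. -/
theorem operator_eq_zero_at {x : M} (Ψ : P.SpinorField → Spinor)
    (hadd : ∀ ε ε', Ψ (ε + ε') = Ψ ε + Ψ ε') (hsmul : ∀ (f : CF M) ε, Ψ (f • ε) = f x • Ψ ε)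
    (hcm : ∀ X ε, Ψ (P.cm X ε) = P.cliff x (X x) (Ψ ε))
    (hΩ : ∀ ε ε', Ω.form (Ψ ε) (P.evalSpinor x ε') + Ω.form (P.evalSpinor x ε) (Ψ ε') = 0)
    (ε : P.SpinorField) : Ψ ε = 0 :=
  P.operator_eq_zero (P.mem_baseSet_at x) Ψ hadd hsmul
    (fun X ε => by rw [hcm, cliff_apply]; rfl)
    (fun ε ε' => by rw [comp_indexAt, comp_indexAt]; exact hΩ ε ε') ε

/-- Commutant uniqueness for operators between spinor fields. -/
theorem field_operator_eq_zero (Ψ : P.SpinorField → P.SpinorField)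
    (hadd : ∀ ε ε', Ψ (ε + ε') = Ψ ε + Ψ ε') (hsmul : ∀ (f : CF M) ε, Ψ (f • ε) = f • Ψ ε)
    (hcm : ∀ X ε, Ψ (P.cm X ε) = P.cm X (Ψ ε))
    (hΩ : ∀ ε ε', P.pair (Ψ ε) ε' + P.pair ε (Ψ ε') = 0) : Ψ ε = 0 :=
  SpinorField.ext fun x => by
    refine P.operator_eq_zero_at (x := x) (fun ε => P.evalSpinor x (Ψ ε)) (fun ε ε' => ?_)
      (fun f ε => ?_) (fun X ε => ?_) (fun ε ε' => ?_) ε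
    · rw [hadd, map_add]
    · rw [hsmul]; rfl
    · rw [hcm]; rfl
    · exact congrArg (fun f : CF M => f x) (hΩ ε ε')

/-- The curvature of the spin connection. -/
def scurv : P.SpinorField :=
  P.scov (lieV X Y) ε - P.scov X (P.scov Y ε) + P.scov Y (P.scov X ε)

/-- Spin curvature and σ(R) have the same commutator with a vector field, namely R(X, Y)Z, and are
both skew for the pairing; commutant uniqueness identifies them. -/
theorem eval_scurv (x : M) : P.evalSpinor x (P.scurv X Y ε) =
    P.sigma x (P.riemann x (X x) (Y x)) (P.evalSpinor x ε) := by
  rw [← sub_eq_zero]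
  refine P.operator_eq_zero_at (x := x) (fun ε => P.evalSpinor x (P.scurv X Y ε) -
    P.sigma x (P.riemann x (X x) (Y x)) (P.evalSpinor x ε)) (fun ε ε' => ?_)
      (fun f ε => ?_) (fun Z ε => ?_) (fun ε ε' => ?_) ε
  · have h : P.scurv X Y (ε + ε') = P.scurv X Y ε + P.scurv X Y ε' := by
      simp only [scurv, scov_add]; abel
    rw [h, map_add, map_add, map_add]
    abel
  · have h : P.scurv X Y (f • ε) = f • P.scurv X Y ε := by
      simp only [scurv, scov_fsmul, scov_add, dirD_lieV]
      module
    have h' : ∀ ε : P.SpinorField, P.evalSpinor x (f • ε) = f x • P.evalSpinor x ε := fun ε => rfl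
    rw [h, h', h', map_smul, smul_sub]
  · have h : P.scurv X Y (P.cm Z ε) = P.cm (P.curv X Y Z) ε + P.cm Z (P.scurv X Y ε) := by
      simp only [scurv, scov_cm, scov_add, curv, cm_add_left, cm_sub_left, cm_add_right,
        cm_sub_right]
      abel
    rw [h, map_add, eval_cm, eval_cm, eval_cm, P.sigma_cliff_apply (P.riemann_mem_so x _ _),
      riemann_apply, map_sub]
    abel
  · have h : P.pair (P.scurv X Y ε) ε' + P.pair ε (P.scurv X Y ε') = 0 := by
      have h := dirD_lieV X Y (P.pair ε ε')
      simp only [P.dirD_pair, dirD_add] at h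
      rw [← sub_eq_zero] at h
      rw [← h]
      simp only [scurv, pair_add_left, pair_sub_left, pair_add_right, pair_sub_right]
      abel
    have h1 : Ω.form _ _ + Ω.form _ _ = (0 : ℝ) := congrArg (fun f : CF M => f x) h
    have h2 := P.form_sigma x (P.riemann x (X x) (Y x)) (P.evalSpinor x ε) (P.evalSpinor x ε')
    rw [map_sub, LinearMap.sub_apply, map_sub, h2]
    linarith

variable {X Y}

/-- The Lie derivative of a spinor field along a Killing vector. -/
def sLie (hX : g.IsKilling X) (ε : P.SpinorField) : P.SpinorField :=
  ⟨fun x => P.spinLie X ε x, fun x => by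
    obtain ⟨E, hE⟩ := P.exists_frame (P.mem_baseSet_at x)
    -- In a smooth orthonormal frame σ(A_X) is a Clifford expression in the fields E_μ and ∇_{E_μ}
    -- X, which exhibits smoothness.
    refine contMDiffAt_of_eventuallyEq (P.scov X ε + (8 : ℝ)⁻¹ • ∑ μ, mink μ •
      (P.cm (P.cov (E μ) X) (P.cm (E μ) ε) - P.cm (E μ) (P.cm (P.cov (E μ) X) ε))) ?_
    filter_upwards [hE] with y hy
    have hf : g.IsONFrame fun μ => E μ y := fun μ ν => by
      beta_reduce; rw [hy.2, hy.2]; exact P.isONFrame hy.1 μ ν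
    have h1 := LinearMap.congr_fun (P.sigma_eq_of_frame hf ((P.isKilling_iff_aMap.1 hX) y))
      (P.evalSpinor y ε)
    refine Eq.trans ?_ (rfl : P.evalSpinor y (P.scov X ε + (8 : ℝ)⁻¹ • ∑ μ, mink μ •
      (P.cm (P.cov (E μ) X) (P.cm (E μ) ε) - P.cm (E μ) (P.cm (P.cov (E μ) X) ε))) = _)
    rw [spinLie, h1, map_add, eval_scov]
    simp only [LinearMap.smul_apply, LinearMap.sum_apply, LinearMap.sub_apply,
      Module.End.mul_apply, map_smul, map_sum, map_sub, aMap_cov, map_neg, LinearMap.neg_apply,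
      eval_cm, sub_neg_eq_add, neg_add_eq_sub]
    rfl⟩

theorem eval_sLie (hX : g.IsKilling X) (x : M) : P.evalSpinor x (P.sLie hX ε) =
    P.evalSpinor x (P.scov X ε) + P.sigma x (P.aMap X x) (P.evalSpinor x ε) := rfl

section Leibniz
variable (hX : g.IsKilling X) (hY : g.IsKilling Y)

@[simp] theorem sLie_add : P.sLie hX (ε + ε') = P.sLie hX ε + P.sLie hX ε' :=
  SpinorField.ext fun x => by
    rw [map_add, eval_sLie, eval_sLie, eval_sLie, scov_add, map_add, map_add, map_add]
    abel

theorem sLie_fsmul : P.sLie hX (f • ε) = dirD X f • ε + f • P.sLie hX ε :=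
  SpinorField.ext fun x => by
    have h' : ∀ (f : CF M) (ε : P.SpinorField), P.evalSpinor x (f • ε) = f x • P.evalSpinor x ε :=
      fun f ε => rfl
    rw [map_add, h', h', eval_sLie, eval_sLie, scov_fsmul, map_add, h', h', h', map_smul]
    module

@[simp] theorem sLie_sub : P.sLie hX (ε - ε') = P.sLie hX ε - P.sLie hX ε' := by
  rw [eq_sub_iff_add_eq, ← sLie_add, sub_add_cancel]

theorem sLie_cm : P.sLie hX (P.cm Z ε) = P.cm (lieV X Z) ε + P.cm Z (P.sLie hX ε) :=
  SpinorField.ext fun x => by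
    rw [map_add, eval_sLie, eval_cm, eval_cm, eval_cm, eval_sLie, scov_cm, map_add, eval_cm,
      eval_cm, P.sigma_cliff_apply (P.isKilling_iff_aMap.1 hX x), aMap_cov, ← P.cov_sub_cov]
    change _ = P.cliff x (P.cov X Z x - P.cov Z X x) _ + _
    rw [map_sub, map_neg, LinearMap.sub_apply, LinearMap.neg_apply, map_add]
    abel

theorem sLie_volS : P.sLie hX (P.volS ε) = P.volS (P.sLie hX ε) :=
  SpinorField.ext fun x => by
    rw [eval_sLie, eval_volS, eval_volS, eval_sLie, scov_volS, eval_volS, sigma_vol, map_add]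

theorem dirD_pair_sLie :
    dirD X (P.pair ε ε') = P.pair (P.sLie hX ε) ε' + P.pair ε (P.sLie hX ε') := by
  rw [dirD_pair]
  ext x
  have h := P.form_sigma x (P.aMap X x) (P.evalSpinor x ε) (P.evalSpinor x ε')
  change Ω.form _ _ + Ω.form _ _ = Ω.form _ (P.evalSpinor x ε') + Ω.form (P.evalSpinor x ε) _
  rw [eval_sLie, eval_sLie, map_add, map_add, LinearMap.add_apply, h]
  ring

/-- Commutator of Lie derivatives. Both sides are derivations over the same vector field [X, Y], for
functions, Clifford multiplication and the pairing, so their difference lies in the trivial skew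
commutant. -/
theorem sLie_lieV (hXY : g.IsKilling (lieV X Y)) : P.sLie hXY ε =
    P.sLie hX (P.sLie hY ε) - P.sLie hY (P.sLie hX ε) := by
  rw [← sub_eq_zero]
  refine P.field_operator_eq_zero ε (fun ε => P.sLie hXY ε -
    (P.sLie hX (P.sLie hY ε) - P.sLie hY (P.sLie hX ε))) (fun ε ε' => ?_) (fun f ε => ?_)
    (fun Z ε => ?_) (fun ε ε' => ?_)
  · simp only [sLie_add]
    abel
  · simp only [sLie_fsmul, sLie_add, dirD_lieV]
    module
  · simp only [sLie_cm, sLie_add, lieV_jacobi X Y Z, cm_sub_right, cm_add_left]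
    abel
  · have h := dirD_lieV X Y (P.pair ε ε')
    rw [dirD_pair_sLie P _ _ hXY, dirD_pair_sLie P _ _ hX, dirD_pair_sLie P _ _ hY] at h
    simp only [P.dirD_pair_sLie _ _ hX, P.dirD_pair_sLie _ _ hY, dirD_add] at h
    rw [← sub_eq_zero] at h
    rw [← h]
    simp only [pair_sub_left, pair_sub_right]
    abel

/-- The same uniqueness argument; the Leibniz rules on the two sides agree because X preserves the
Levi-Civita connection (`lieV_cov`). -/
theorem sLie_scov : P.sLie hX (P.scov Z ε) =
    P.scov (lieV X Z) ε + P.scov Z (P.sLie hX ε) := by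
  rw [← sub_eq_zero]
  refine P.field_operator_eq_zero ε (fun ε => P.sLie hX (P.scov Z ε) -
    (P.scov (lieV X Z) ε + P.scov Z (P.sLie hX ε))) (fun ε ε' => ?_) (fun f ε => ?_)
    (fun W ε => ?_) (fun ε ε' => ?_)
  · simp only [sLie_add, scov_add]
    abel
  · simp only [sLie_fsmul, scov_fsmul, sLie_add, scov_add, dirD_lieV]
    module
  · simp only [sLie_cm, scov_cm, sLie_add, scov_add, P.lieV_cov hX, cm_sub_right, cm_add_right,
      cm_add_left]
    abel
  · have h := dirD_lieV X Z (P.pair ε ε')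
    rw [dirD_pair_sLie P _ _ hX] at h
    simp only [P.dirD_pair_sLie _ _ hX, P.dirD_pair, dirD_add] at h
    rw [← sub_eq_zero] at h
    rw [← neg_eq_zero, ← h]
    simp only [pair_sub_left, pair_sub_right, pair_add_left, pair_add_right]
    abel

/-- The current is defined through the metric, the pairing and Clifford multiplication, all of which
the Lie derivative respects. -/
theorem lieV_curr :
    lieV X (P.curr ε ε') = P.curr (P.sLie hX ε) ε' + P.curr ε (P.sLie hX ε') := by
  refine g.ext_inn fun Z => ?_
  have h := hX (P.curr ε ε') Z
  rw [P.inn_curr, P.inn_curr, P.dirD_pair_sLie _ _ hX, sLie_cm, pair_add_right] at h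
  rw [g.inn_add_left, P.inn_curr, P.inn_curr, eq_sub_of_add_eq h.symm]
  abel

end Leibniz

variable (X)
theorem cov_curr :
    P.cov X (P.curr ε ε') = P.curr (P.scov X ε) ε' + P.curr ε (P.scov X ε') := by
  refine g.ext_inn fun Z => ?_
  have h := P.dirD_inn X (P.curr ε ε') Z
  rw [P.inn_curr, P.inn_curr, P.dirD_pair, scov_cm, pair_add_right] at h
  rw [g.inn_add_left, P.inn_curr, P.inn_curr, eq_sub_of_add_eq h.symm]
  abel

theorem curr_symm : P.curr ε ε' = P.curr ε' ε := by
  ext1 x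
  exact P.kappa_symm x _ _

/-- By the Clifford relation φ ∧ v acts as φ·v + g(φ, v), so the coefficient 2 of the last term in
`beta` drops to 1. -/
theorem beta_apply (Φ : Fields M) (x : M) (v : T x) (s : Spinor) : beta P Φ x v s =
    Φ.a x • P.cliff x v s + Φ.b x • P.cliff x v (vol s) - P.cliff x (Φ.φ x) (P.cliff x v (vol s))
      + g.val x (Φ.φ x) v • vol s := by
  have h := P.cliff_swap x v (Φ.φ x) (vol s)
  simp only [beta, LinearMap.add_apply, LinearMap.sub_apply, LinearMap.smul_apply,
    Module.End.mul_apply, Module.End.one_apply, map_add, map_smul, h, g.symm x v]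
  module

/-- The endomorphism `β` acting on spinor fields. -/
def betaS (Φ : Fields M) (X : VField M) (ε : P.SpinorField) : P.SpinorField :=
  Φ.a • P.cm X ε + Φ.b • P.cm X (P.volS ε) - P.cm Φ.φ (P.cm X (P.volS ε))
    + g.inn Φ.φ X • P.volS ε

theorem eval_betaS (Φ : Fields M) (x : M) :
    P.evalSpinor x (P.betaS Φ X ε) = beta P Φ x (X x) (P.evalSpinor x ε) := by
  rw [beta_apply]; rfl

variable {P} in
theorem mem_k1_iff {Φ : Fields M} {ε : P.SpinorField} :
    ε ∈ k1 P Φ ↔ ∀ X, P.scov X ε = P.betaS Φ X ε := by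
  constructor
  · intro h X
    refine SpinorField.ext fun x => ?_
    rw [eval_betaS, eval_scov]
    exact sub_eq_zero.1 (h x (X x))
  · intro h x v
    obtain ⟨X, rfl⟩ := exists_vfield x v
    rw [sub_eq_zero, ← eval_betaS, ← h]
    rfl

-- The Lie derivative along X commutes with ∇ and, since it annihilates a, b and φ, also with β;
-- hence it preserves the Killing spinor equation.
variable {P ε X} in
theorem sLie_mem_k1 {Φ : Fields M} (hX : X ∈ k0 g Φ) (hε : ε ∈ k1 P Φ) :
    P.sLie (mem_k0_iff.1 hX).1 ε ∈ k1 P Φ := by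
  rw [mem_k1_iff] at *
  intro Y
  obtain ⟨h1, h2, h3, h4⟩ := mem_k0_iff.1 hX
  have h := P.sLie_scov Y ε h1
  rw [hε, hε, ← sub_eq_iff_eq_add'] at h
  rw [← h, sub_eq_iff_eq_add']
  have hφ : dirD X (g.inn Φ.φ Y) = g.inn Φ.φ (lieV X Y) := by
    rw [h1, h4]
    ext x
    change g.val x 0 (Y x) + _ = _
    rw [map_zero, _root_.zero_apply, zero_add]
  have hz : ∀ ε, P.cm 0 ε = 0 := fun ε => by
    have := P.cm_sub_left 0 0 ε
    simpa using this
  simp only [betaS, sLie_add, sLie_sub, sLie_fsmul, sLie_cm, sLie_volS, h2, h3, h4, hφ, hz,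
    cm_add_right]
  module

end SpinStructure

end

section

/-! ### Algebraic identities in the spinor module -/

/-- The endomorphism `β` in an orthonormal basis. -/
def betaM (a b : ℝ) (p v : Fin 4 → ℝ) (s : Spinor) : Spinor :=
  a • clM v s + b • clM v (vol s) - clM p (clM v (vol s)) + etaM p v • vol s

/-- The Clifford trace of `β`. -/
def diracM (a b : ℝ) (p : Fin 4 → ℝ) (s : Spinor) : Spinor :=
  -(4 * a) • s - (4 * b) • vol s - clM p (vol s)

theorem clM_single (μ : Fin 4) : clM (Pi.single μ 1) = gamma μ := by
  simp [clM, Pi.single_apply]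

/-- Explicit tables for β along the four basis vectors; with them the Clifford identities below
become polynomial identities in the components. -/
theorem betaM_zero (a b : ℝ) (p : Fin 4 → ℝ) (s : Spinor) : betaM a b p (Pi.single 0 1) s =
    ![a * s 3 - b * s 1 - 2 * p 0 * s 2 + p 1 * s 3 + p 2 * s 1 - p 3 * s 2,
      a * s 2 + b * s 0 + 2 * p 0 * s 3 - p 1 * s 2 - p 2 * s 0 - p 3 * s 3,
      -(a * s 1) - b * s 3 + 2 * p 0 * s 0 + p 1 * s 1 - p 2 * s 3 + p 3 * s 0,
      -(a * s 0) + b * s 2 - 2 * p 0 * s 1 - p 1 * s 0 + p 2 * s 2 + p 3 * s 1] := by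
  simp only [betaM, clM_single, gamma_zero_apply, clM_apply, vol_apply]
  ext i
  fin_cases i <;> simp [etaM, mink, Fin.sum_univ_four] <;> ring

theorem betaM_one (a b : ℝ) (p : Fin 4 → ℝ) (s : Spinor) : betaM a b p (Pi.single 1 1) s =
    ![a * s 2 + b * s 0 - p 0 * s 3 + 2 * p 1 * s 2 - p 2 * s 0 - p 3 * s 3,
      a * s 3 - b * s 1 + p 0 * s 2 - 2 * p 1 * s 3 + p 2 * s 1 - p 3 * s 2,
      a * s 0 - b * s 2 - p 0 * s 1 - 2 * p 1 * s 0 - p 2 * s 2 - p 3 * s 1,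
      a * s 1 + b * s 3 + p 0 * s 0 + 2 * p 1 * s 1 + p 2 * s 3 - p 3 * s 0] := by
  simp only [betaM, clM_single, gamma_one_apply, clM_apply, vol_apply]
  ext i
  fin_cases i <;> simp [etaM, mink, Fin.sum_univ_four] <;> ring

theorem betaM_two (a b : ℝ) (p : Fin 4 → ℝ) (s : Spinor) : betaM a b p (Pi.single 2 1) s =
    ![a * s 0 - b * s 2 - p 0 * s 1 + p 1 * s 0 + 2 * p 2 * s 2 - p 3 * s 1,
      a * s 1 + b * s 3 + p 0 * s 0 - p 1 * s 1 - 2 * p 2 * s 3 - p 3 * s 0,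
      -(a * s 2) - b * s 0 + p 0 * s 3 + p 1 * s 2 - 2 * p 2 * s 0 + p 3 * s 3,
      -(a * s 3) + b * s 1 - p 0 * s 2 - p 1 * s 3 + 2 * p 2 * s 1 + p 3 * s 2] := by
  simp only [betaM, clM_single, gamma_two_apply, clM_apply, vol_apply]
  ext i
  fin_cases i <;> simp [etaM, mink, Fin.sum_univ_four] <;> ring

theorem betaM_three (a b : ℝ) (p : Fin 4 → ℝ) (s : Spinor) : betaM a b p (Pi.single 3 1) s =
    ![a * s 3 - b * s 1 + p 0 * s 2 + p 1 * s 3 + p 2 * s 1 + 2 * p 3 * s 2,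
      -(a * s 2) - b * s 0 + p 0 * s 3 + p 1 * s 2 + p 2 * s 0 - 2 * p 3 * s 3,
      -(a * s 1) - b * s 3 - p 0 * s 0 + p 1 * s 1 - p 2 * s 3 - 2 * p 3 * s 0,
      a * s 0 - b * s 2 - p 0 * s 1 + p 1 * s 0 - p 2 * s 2 + 2 * p 3 * s 1] := by
  simp only [betaM, clM_single, gamma_three_apply, clM_apply, vol_apply]
  ext i
  fin_cases i <;> simp [etaM, mink, Fin.sum_univ_four] <;> ring

theorem diracM_apply (a b : ℝ) (p : Fin 4 → ℝ) (s : Spinor) : diracM a b p s =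
    ![-4 * a * s 0 + 4 * b * s 2 + p 0 * s 1 - p 1 * s 0 + p 2 * s 2 + p 3 * s 1,
      -4 * a * s 1 - 4 * b * s 3 - p 0 * s 0 + p 1 * s 1 - p 2 * s 3 + p 3 * s 0,
      -4 * a * s 2 - 4 * b * s 0 + p 0 * s 3 + p 1 * s 2 + p 2 * s 0 + p 3 * s 3,
      -4 * a * s 3 + 4 * b * s 1 - p 0 * s 2 - p 1 * s 3 - p 2 * s 1 + p 3 * s 2] := by
  have h : ∀ i, diracM a b p s i = -(4 * a) * s i - 4 * b * vol s i - clM p (vol s) i :=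
    fun i => rfl
  ext i
  rw [h, vol_apply, clM_apply]
  fin_cases i <;> simp <;> ring

theorem sum_gamma_betaM (a b : ℝ) (p : Fin 4 → ℝ) (s : Spinor) :
    ∑ μ, mink μ • gamma μ (betaM a b p (Pi.single μ 1) s) = diracM a b p s := by
  simp only [Fin.sum_univ_four, betaM_zero, betaM_one, betaM_two, betaM_three, gamma_zero_apply,
    gamma_one_apply, gamma_two_apply, gamma_three_apply, diracM_apply, mink]
  ext i
  fin_cases i <;> simp <;> ring

theorem betaM_self (a b : ℝ) (p : Fin 4 → ℝ) (s : Spinor) : betaM a b p p s =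
    a • clM p s + b • clM p (vol s) + (2 * etaM p p) • vol s := by
  have h := LinearMap.congr_fun (clM_anticomm p p) (vol s)
  simp only [LinearMap.add_apply, Module.End.mul_apply, LinearMap.smul_apply,
    Module.End.one_apply] at h
  have h' : clM p (clM p (vol s)) = -etaM p p • vol s := by
    have : (2 : ℝ) • clM p (clM p (vol s)) = (2 : ℝ) • (-etaM p p • vol s) := by
      rw [two_smul, h]; module
    exact smul_right_injective _ two_ne_zero this
  rw [betaM, h']
  module

/-- The quadratic part of the Clifford-traced integrability condition. -/
def tracedQuad (a b : ℝ) (p : Fin 4 → ℝ) (ν : Fin 4) (s : Spinor) : Spinor :=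
  diracM a b p (betaM a b p (Pi.single ν 1) s)
    - ∑ μ, mink μ • gamma μ (betaM a b p (Pi.single ν 1) (betaM a b p (Pi.single μ 1) s))

/-- The derivative part of the Clifford-traced integrability condition. -/
def tracedDeriv (a b : Fin 4 → ℝ) (p : Fin 4 → Fin 4 → ℝ) (ν : Fin 4) (s : Spinor) : Spinor :=
  diracM (a ν) (b ν) (p ν) s - ∑ μ, mink μ • gamma μ (betaM (a μ) (b μ) (p μ) (Pi.single ν 1) s)

/-- The quadratic part of the double trace acts as a scalar, like the scalar curvature; both vanish
when s is paired with itself. -/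
theorem sum_gamma_tracedQuad (a b : ℝ) (p : Fin 4 → ℝ) (s : Spinor) :
    ∑ ν, mink ν • gamma ν (tracedQuad a b p ν s) =
      (24 * (a * a + b * b) - 12 * etaM p p) • s := by
  simp only [tracedQuad, map_sub, map_sum, map_smul]
  simp only [Fin.sum_univ_four, betaM_zero, betaM_one, betaM_two, betaM_three,
    gamma_zero_apply, gamma_one_apply, gamma_two_apply, gamma_three_apply, diracM_apply, mink, etaM]
  ext i
  fin_cases i <;>
  · simp
    ring

/-- The double trace sees only da, db and the divergence of φ, in three different Clifford types,
which pairing with s or with vol·s can separate. -/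
theorem sum_gamma_tracedDeriv (a b : Fin 4 → ℝ) (p : Fin 4 → Fin 4 → ℝ) (s : Spinor) :
    ∑ ν, mink ν • gamma ν (tracedDeriv a b p ν s) =
      -(6 : ℝ) • clM (fun μ => mink μ * a μ) s - (6 : ℝ) • clM (fun μ => mink μ * b μ) (vol s)
        + (6 * ∑ μ, p μ μ) • vol s := by
  simp only [tracedDeriv, map_sub, map_sum, map_smul]
  simp only [Fin.sum_univ_four, betaM_zero, betaM_one, betaM_two, betaM_three,
    gamma_zero_apply, gamma_one_apply, gamma_two_apply, gamma_three_apply, diracM_apply, mink,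
    clM_apply, vol_apply]
  ext i
  fin_cases i <;>
  · simp
    ring

/-! ### Pairings of the traced integrability condition with the spinor -/

namespace SpinorForm
variable (Ω : SpinorForm)

/-- For an alternating form ⟨s, L s⟩ = 0 whenever L is self-adjoint. The operators `vol`, v·vol and
vol·v are all self-adjoint, which gives this and the next two statements. -/
theorem form_self_vol (s : Spinor) : Ω.form s (vol s) = 0 := by
  have h := Ω.form_vol s s
  rw [Ω.neg] at h
  linarith

theorem form_self_vol_clM (v : Fin 4 → ℝ) (s : Spinor) : Ω.form s (vol (clM v s)) = 0 := by
  have h := Ω.form_vol s (clM v s)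
  have h' : vol (clM v s) = -clM v (vol s) := LinearMap.congr_fun (vol_clM v) s
  rw [← neg_neg (Ω.form (vol s) _), ← Ω.form_clM, Ω.neg, neg_neg, ← neg_neg (clM v (vol s)),
    ← h', map_neg] at h
  linarith

theorem form_self_clM_vol (v : Fin 4 → ℝ) (s : Spinor) : Ω.form s (clM v (vol s)) = 0 := by
  have h' : vol (clM v s) = -clM v (vol s) := LinearMap.congr_fun (vol_clM v) s
  rw [← neg_eq_zero, ← map_neg, ← h', form_self_vol_clM]

/-- For a Killing spinor with value s the right side is 2η_νν times the ν-th component of ∇_φ κ,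
where κ = κ(s, s). -/
theorem form_vol_tracedQuad (a b : ℝ) (p : Fin 4 → ℝ) (s : Spinor) (ν : Fin 4) :
    Ω.form s (vol (tracedQuad a b p ν s)) = 4 * Ω.form (betaM a b p p s) (gamma ν s) := by
  obtain ⟨c, -, h⟩ := Ω.exists_eq
  rw [betaM_self]
  simp only [tracedQuad, map_sub, map_sum, map_smul, h]
  fin_cases ν <;>
  · simp [Fin.sum_univ_four, betaM_zero, betaM_one, betaM_two, betaM_three,
      gamma_zero_apply, gamma_one_apply, gamma_two_apply, gamma_three_apply, diracM_apply, mink,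
      vol_apply, clM_apply, etaM]
    ring

/-- Subtracting off the double trace with weight 6⁻¹, the inverse of the coefficient in
`sum_gamma_tracedDeriv`, removes da, db and the divergence of φ; only ∇_κ φ is left. -/
theorem form_vol_tracedDeriv (a b : Fin 4 → ℝ) (p : Fin 4 → Fin 4 → ℝ) (s : Spinor) (ν : Fin 4) :
    Ω.form s (vol (tracedDeriv a b p ν s))
    + 6⁻¹ * Ω.form s (vol (gamma ν (∑ ρ, mink ρ • gamma ρ (tracedDeriv a b p ρ s)))) =
      -2 * (mink ν * ∑ μ, mink μ * Ω.form s (gamma μ s) * p μ ν) := by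
  obtain ⟨c, -, h⟩ := Ω.exists_eq
  rw [sum_gamma_tracedDeriv]
  simp only [tracedDeriv, map_sub, map_sum, map_smul, h]
  fin_cases ν <;>
  · simp [Fin.sum_univ_four, betaM_zero, betaM_one, betaM_two, betaM_three,
      gamma_zero_apply, gamma_one_apply, gamma_two_apply, gamma_three_apply, diracM_apply, mink,
      vol_apply, clM_apply]
    ring

/-- The cubic identity behind the Jacobi identity of three Killing spinors. -/
theorem betaM_kappa_add_sgM (a b : ℝ) (p : Fin 4 → ℝ) (s : Spinor) :
    betaM a b p (fun μ => mink μ * Ω.form s (gamma μ s)) s + sgM (fun μ ν =>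
      -2 * (mink ν * Ω.form (betaM a b p (Pi.single μ 1) s) (gamma ν s))) s = 0 := by
  obtain ⟨c, -, h⟩ := Ω.exists_eq
  simp only [h, sgM, LinearMap.smul_apply, LinearMap.sum_apply, LinearMap.sub_apply,
    Module.End.mul_apply, betaM, clM_apply, vol_apply, etaM]
  simp only [Fin.sum_univ_four, gamma_zero_apply, gamma_one_apply, gamma_two_apply,
    gamma_three_apply]
  ext i
  fin_cases i <;>
  · simp [-mul_eq_zero, mink]
    ring

end SpinorForm

theorem sgM_apply {A : Fin 4 → Fin 4 → ℝ} (hA : ∀ μ ν, mink ν * A μ ν = -(mink μ * A ν μ))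
    (s : Spinor) : sgM A s =
    ![2⁻¹ * (A 0 1 * s 1 - A 0 2 * s 3 + A 0 3 * s 0 + A 1 2 * s 2 + A 1 3 * s 1 - A 2 3 * s 3),
      2⁻¹ * (A 0 1 * s 0 - A 0 2 * s 2 - A 0 3 * s 1 + A 1 2 * s 3 - A 1 3 * s 0 + A 2 3 * s 2),
      2⁻¹ * (-(A 0 1 * s 3) - A 0 2 * s 1 + A 0 3 * s 2 - A 1 2 * s 0 - A 1 3 * s 3 - A 2 3 * s 1),
      2⁻¹ * (-(A 0 1 * s 2) - A 0 2 * s 0 - A 0 3 * s 3 - A 1 2 * s 1 + A 1 3 * s 2 + A 2 3 * s 0)] := by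
  have h := fun μ ν => hA μ ν
  simp [mink, Fin.forall_fin_succ] at h
  have h00 : A 0 0 = 0 := by linarith
  have h11 : A 1 1 = 0 := by linarith
  have h22 : A 2 2 = 0 := by linarith
  have h33 : A 3 3 = 0 := by linarith
  have h10 : A 1 0 = A 0 1 := by linarith
  have h20 : A 2 0 = A 0 2 := by linarith
  have h30 : A 3 0 = A 0 3 := by linarith
  have h21 : A 2 1 = -A 1 2 := by linarith
  have h31 : A 3 1 = -A 1 3 := by linarith
  have h32 : A 3 2 = -A 2 3 := by linarith
  ext i
  fin_cases i <;>
  · simp [sgM, clM_apply, Fin.sum_univ_four, gamma_zero_apply, gamma_one_apply,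
      gamma_two_apply, gamma_three_apply, mink, h00, h11, h22, h33, h10, h20, h30, h21, h31, h32]
    ring

/-- A Clifford trace of the spin representation in the presence of the Bianchi identity. -/
theorem sum_gamma_sgM {W : Fin 4 → Fin 4 → Fin 4 → ℝ}
    (hW : ∀ μ ν ρ, mink ρ * W μ ν ρ = -(mink ν * W μ ρ ν))
    (hB : ∀ μ ν ρ, mink ρ * W μ ν ρ + mink μ * W ν ρ μ + mink ν * W ρ μ ν = 0) (s : Spinor) :
    ∑ μ, mink μ • gamma μ (sgM (W μ) s) =
      clM (fun ν => -(2⁻¹ * ∑ μ, mink μ * W μ μ ν)) s := by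
  have hd : ∀ μ ν, W μ ν ν = 0 := fun μ ν => by
    have := hW μ ν ν
    have h0 := mink_ne_zero ν
    have : mink ν * W μ ν ν = 0 := by linarith
    exact (mul_eq_zero.1 this).resolve_left h0
  have h10 : ∀ μ, W μ 1 0 = W μ 0 1 := fun μ => by simpa [mink] using hW μ 1 0
  have h20 : ∀ μ, W μ 2 0 = W μ 0 2 := fun μ => by simpa [mink] using hW μ 2 0
  have h30 : ∀ μ, W μ 3 0 = W μ 0 3 := fun μ => by simpa [mink] using hW μ 3 0
  have h21 : ∀ μ, W μ 2 1 = -W μ 1 2 := fun μ => by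
    have := hW μ 2 1; simp [mink] at this; linarith
  have h31 : ∀ μ, W μ 3 1 = -W μ 1 3 := fun μ => by
    have := hW μ 3 1; simp [mink] at this; linarith
  have h32 : ∀ μ, W μ 3 2 = -W μ 2 3 := fun μ => by
    have := hW μ 3 2; simp [mink] at this; linarith
  -- The cyclic identity amounts to four relations, used to eliminate one component each; what
  -- survives is a Ricci contraction.
  have hB1 : W 2 0 1 = W 1 0 2 - W 0 1 2 := by
    have := hB 0 1 2; simp [mink, h20] at this; linarith
  have hB2 : W 3 0 1 = W 1 0 3 - W 0 1 3 := by
    have := hB 0 1 3; simp [mink, h30] at this; linarith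
  have hB3 : W 3 0 2 = W 2 0 3 - W 0 2 3 := by
    have := hB 0 2 3; simp [mink, h30] at this; linarith
  have hB4 : W 3 1 2 = W 2 1 3 - W 1 2 3 := by
    have := hB 1 2 3; simp [mink, h31] at this; linarith
  simp only [sgM_apply (hW _)]
  simp only [clM_apply, Fin.sum_univ_four, gamma_zero_apply, gamma_one_apply,
    gamma_two_apply, gamma_three_apply]
  ext i
  fin_cases i <;>
  · simp [mink, hd, h10, h20, h30, h21, h31, h32, hB1, hB2, hB3, hB4]
    ring

end

section

variable {M : Type*} [TopologicalSpace M] [ChartedSpace E4 M] [IsManifold (𝓡 4) ∞ M]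

/-! ### Dirac currents of Killing spinors -/

namespace SpinStructure
variable {g : LorentzMetric M} {Ω : SpinorForm} {ι : Type*} (P : SpinStructure g Ω ι)
variable [T2Space M]

theorem beta_eq_betaM (Φ : Fields M) (x : M) (v : T x) (s : Spinor) : beta P Φ x v s =
    betaM (Φ.a x) (Φ.b x) (g.cmp (fun μ => P.e x μ x) (Φ.φ x)) (g.cmp (fun μ => P.e x μ x) v) s := by
  rw [beta_apply, betaM, cliff_apply, cliff_apply, ← (P.isONFrame_e x).val_eq]

theorem cmp_e (x : M) (μ : Fin 4) :
    g.cmp (fun μ => P.e x μ x) (P.e x μ x) = Pi.single μ 1 := by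
  ext ν
  rw [(P.isONFrame_e x).cmp_self μ ν, Pi.single_apply]
  simp only [eq_comm]

theorem beta_add_vec (Φ : Fields M) (x : M) (v w : T x) (s : Spinor) :
    beta P Φ x (v + w) s = beta P Φ x v s + beta P Φ x w s := by
  simp only [beta_apply, map_add, LinearMap.add_apply, smul_add, add_smul]
  abel

/-- The pairing `⟨β_v s, v t⟩ + ⟨s, v β_v t⟩` vanishes. -/
theorem form_beta_self (Φ : Fields M) (x : M) (v : T x) (s t : Spinor) :
    Ω.form (beta P Φ x v s) (P.cliff x v t) + Ω.form s (P.cliff x v (beta P Φ x v t)) = 0 := by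
  simp only [beta_apply, map_add, map_sub, map_smul, LinearMap.add_apply, LinearMap.sub_apply,
    LinearMap.smul_apply, form_cliff, Ω.form_vol, vol_cliff_apply, map_neg, neg_neg, smul_eq_mul]
  ring

/-- Polarisation of `form_beta_self` in v. For Killing spinors this is skewness of ∇κ, that is, the
Killing equation for the current. -/
theorem val_kappa_beta (Φ : Fields M) (x : M) (v w : T x) (s t : Spinor) :
    g.val x (P.kappa x (beta P Φ x v s) t + P.kappa x s (beta P Φ x v t)) w =
      -g.val x v (P.kappa x (beta P Φ x w s) t + P.kappa x s (beta P Φ x w t)) := by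
  have h := P.form_beta_self Φ x (v + w) s t
  have h1 := P.form_beta_self Φ x v s t
  have h2 := P.form_beta_self Φ x w s t
  simp only [beta_add_vec, map_add, LinearMap.add_apply] at h
  rw [g.symm x v, map_add, map_add, _root_.add_apply, _root_.add_apply]
  simp only [val_kappa]
  linarith

/-- The cubic identity, in invariant form. -/
theorem beta_kappa_add_sigma (Φ : Fields M) (x : M) (s : Spinor) {A : Module.End ℝ (T x)}
    (hA : ∀ v, A v = -(P.kappa x (beta P Φ x v s) s + P.kappa x s (beta P Φ x v s))) :
    beta P Φ x (P.kappa x s s) s + P.sigma x A s = 0 := by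
  rw [beta_eq_betaM, sigma_apply]
  have h := Ω.betaM_kappa_add_sgM (Φ.a x) (Φ.b x) (g.cmp (fun μ => P.e x μ x) (Φ.φ x)) s
  have h1 : g.cmp (fun μ => P.e x μ x) (P.kappa x s s) = fun μ => mink μ * Ω.form s (gamma μ s) := by
    ext μ
    rw [LorentzMetric.cmp, val_kappa, cliff_e]
  have h2 : (fun μ => g.cmp (fun μ => P.e x μ x) (A (P.e x μ x))) = fun μ ν =>
      -2 * (mink ν * Ω.form (betaM (Φ.a x) (Φ.b x) (g.cmp (fun μ => P.e x μ x) (Φ.φ x))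
        (Pi.single μ 1) s) (gamma ν s)) := by
    ext μ ν
    rw [hA, P.kappa_symm x s, LorentzMetric.cmp, map_neg, map_add, _root_.neg_apply,
      _root_.add_apply, val_kappa, cliff_e, beta_eq_betaM, cmp_e]
    ring
  rw [h1, h2]
  exact h

/-! ### The integrability condition and the symmetries of the Riemann tensor -/

/-- Covariant differentiation of the endomorphism `β`. -/
theorem scov_betaS (Φ : Fields M) (X Y : VField M) (ε : P.SpinorField) :
    P.scov X (P.betaS Φ Y ε) = P.betaS ⟨dirD X Φ.a, dirD X Φ.b, P.cov X Φ.φ⟩ Y ε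
      + P.betaS Φ (P.cov X Y) ε + P.betaS Φ Y (P.scov X ε) := by
  have hs : ∀ ε ε', P.scov X (ε - ε') = P.scov X ε - P.scov X ε' := fun ε ε' => by
    rw [eq_sub_iff_add_eq, ← scov_add, sub_add_cancel]
  simp only [betaS, scov_add, hs, scov_fsmul, scov_cm, scov_volS, P.dirD_inn, cm_add_right]
  module

theorem betaS_sub (Φ : Fields M) (X Y : VField M) (ε : P.SpinorField) :
    P.betaS Φ (X - Y) ε = P.betaS Φ X ε - P.betaS Φ Y ε := by
  simp only [betaS, cm_sub_left, cm_sub_right, g.inn_sub_right]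
  module

variable {P} in
/-- The integrability condition for Killing spinors. -/
theorem scurv_of_mem_k1 {Φ : Fields M} {ε : P.SpinorField} (hε : ε ∈ k1 P Φ) (X Y : VField M) :
    P.scurv X Y ε = P.betaS Φ X (P.betaS Φ Y ε) - P.betaS Φ Y (P.betaS Φ X ε)
      - P.betaS ⟨dirD X Φ.a, dirD X Φ.b, P.cov X Φ.φ⟩ Y ε
      + P.betaS ⟨dirD Y Φ.a, dirD Y Φ.b, P.cov Y Φ.φ⟩ X ε := by
  rw [mem_k1_iff] at hε
  simp only [scurv, hε, scov_betaS, ← P.cov_sub_cov, betaS_sub]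
  abel

theorem riemann_val_right (x : M) (u v w z : T x) :
    g.val x (P.riemann x u v w) z = -g.val x (P.riemann x u v z) w := by
  rw [LorentzMetric.mem_so.1 (P.riemann_mem_so x u v), g.symm]

theorem riemann_val_left (x : M) (u v w z : T x) :
    g.val x (P.riemann x u v w) z = -g.val x (P.riemann x v u w) z := by
  rw [P.riemann_swap x v u, LinearMap.neg_apply, map_neg, _root_.neg_apply]

/-- Pair symmetry of the Riemann tensor. -/
theorem riemann_val_pair (x : M) (u v w z : T x) :
    g.val x (P.riemann x u v w) z = g.val x (P.riemann x w z u) v := by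
  have hb : ∀ u v w z, g.val x (P.riemann x u v w) z + g.val x (P.riemann x v w u) z
      + g.val x (P.riemann x w u v) z = 0 := fun u v w z => by
    rw [← _root_.add_apply, ← map_add, ← _root_.add_apply, ← map_add, P.riemann_bianchi, map_zero,
      _root_.zero_apply]
  have hr := P.riemann_val_right x
  have hl := P.riemann_val_left x
  -- The classical octahedron argument: four Bianchi identities combined by the two skew symmetries.
  linarith [hb u v w z, hb u v z w, hb u w z v, hb v w z u, hl w u v z, hr u v z w, hl z u v w,
    hr u w z v, hl z u w v, hr u z w v, hr v w z u, hr w z v u, hl z v w u, hr v z w u]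

/-- Pair symmetry moves the Bianchi identity to the position, with v fixed in the second slot, that
`sum_gamma_sgM` needs. -/
theorem riemann_val_cyclic (x : M) (u v w z : T x) : g.val x (P.riemann x u v w) z
    + g.val x (P.riemann x w v z) u + g.val x (P.riemann x z v u) w = 0 := by
  have h := P.riemann_bianchi x w z u
  have h' := congrArg (fun t => g.val x t v) h
  simp only [map_add, _root_.add_apply, map_zero, _root_.zero_apply] at h'
  rw [P.riemann_val_pair x u v w z, P.riemann_val_pair x w v z u, P.riemann_val_pair x z v u w]
  linarith

variable {P} in
/-- The integrability condition at a point, in the chosen frame. -/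
theorem sgM_riemann {Φ : Fields M} {ε : P.SpinorField} (hε : ε ∈ k1 P Φ) (x : M) (μ ν : Fin 4) :
    sgM (fun ρ => g.cmp (fun μ => P.e x μ x) (P.riemann x (P.e x μ x) (P.e x ν x) (P.e x ρ x)))
      (P.evalSpinor x ε) =
    betaM (Φ.a x) (Φ.b x) (g.cmp (fun μ => P.e x μ x) (Φ.φ x)) (Pi.single μ 1)
      (betaM (Φ.a x) (Φ.b x) (g.cmp (fun μ => P.e x μ x) (Φ.φ x)) (Pi.single ν 1)
        (P.evalSpinor x ε))
    - betaM (Φ.a x) (Φ.b x) (g.cmp (fun μ => P.e x μ x) (Φ.φ x)) (Pi.single ν 1)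
      (betaM (Φ.a x) (Φ.b x) (g.cmp (fun μ => P.e x μ x) (Φ.φ x)) (Pi.single μ 1)
        (P.evalSpinor x ε))
    - betaM (mvfderiv (𝓡 4) Φ.a x (P.e x μ x)) (mvfderiv (𝓡 4) Φ.b x (P.e x μ x))
      (g.cmp (fun μ => P.e x μ x) (P.nabla Φ.φ x (P.e x μ x))) (Pi.single ν 1) (P.evalSpinor x ε)
    + betaM (mvfderiv (𝓡 4) Φ.a x (P.e x ν x)) (mvfderiv (𝓡 4) Φ.b x (P.e x ν x))
      (g.cmp (fun μ => P.e x μ x) (P.nabla Φ.φ x (P.e x ν x))) (Pi.single μ 1)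
        (P.evalSpinor x ε) := by
  obtain ⟨X, hX⟩ := exists_vfield x (P.e x μ x)
  obtain ⟨Y, hY⟩ := exists_vfield x (P.e x ν x)
  have h := congrArg (P.evalSpinor x) (scurv_of_mem_k1 hε X Y)
  rw [eval_scurv, sigma_apply, map_add, map_sub, map_sub] at h
  simp only [eval_betaS, beta_eq_betaM, cov_apply, dirD_apply, hX, hY, cmp_e] at h
  exact h

/-! ### Currents of Killing spinors preserve the background -/

section
variable {P} {Φ : Fields M} {ε : P.SpinorField}

/-- The Clifford trace of the integrability condition. -/
theorem traced_integrability (hε : ε ∈ k1 P Φ) (x : M) (ν : Fin 4) :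
    tracedQuad (Φ.a x) (Φ.b x) (g.cmp (fun μ => P.e x μ x) (Φ.φ x)) ν (P.evalSpinor x ε)
    + tracedDeriv (fun μ => mvfderiv (𝓡 4) Φ.a x (P.e x μ x))
      (fun μ => mvfderiv (𝓡 4) Φ.b x (P.e x μ x))
      (fun μ => g.cmp (fun μ => P.e x μ x) (P.nabla Φ.φ x (P.e x μ x))) ν (P.evalSpinor x ε) =
    clM (fun ρ => -(2⁻¹ * ∑ μ, mink μ * g.cmp (fun μ => P.e x μ x)
      (P.riemann x (P.e x μ x) (P.e x ν x) (P.e x μ x)) ρ)) (P.evalSpinor x ε) := by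
  have hf := P.isONFrame_e x
  rw [← sum_gamma_sgM (W := fun μ ρ => g.cmp (fun μ => P.e x μ x)
    (P.riemann x (P.e x μ x) (P.e x ν x) (P.e x ρ x)))]
  · simp only [sgM_riemann hε, map_add, map_sub, smul_add, smul_sub, Finset.sum_add_distrib,
      Finset.sum_sub_distrib, sum_gamma_betaM, tracedQuad, tracedDeriv]
    abel
  · intro μ ρ τ
    exact LorentzMetric.cmp_skew (f := fun μ => P.e x μ x) (fun ρ τ =>
      LorentzMetric.mem_so.1 (P.riemann_mem_so x _ _) (P.e x ρ x) (P.e x τ x)) ρ τ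
  · intro μ ρ τ
    rw [← LorentzMetric.val_left, ← LorentzMetric.val_left, ← LorentzMetric.val_left]
    exact P.riemann_val_cyclic x _ _ _ _

theorem double_traced_integrability (hε : ε ∈ k1 P Φ) (x : M) :
    ∃ k : ℝ, ∑ ν, mink ν • gamma ν (tracedDeriv (fun μ => mvfderiv (𝓡 4) Φ.a x (P.e x μ x))
      (fun μ => mvfderiv (𝓡 4) Φ.b x (P.e x μ x))
      (fun μ => g.cmp (fun μ => P.e x μ x) (P.nabla Φ.φ x (P.e x μ x))) ν (P.evalSpinor x ε)) =
    k • P.evalSpinor x ε := by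
  set r : Fin 4 → Fin 4 → ℝ := fun ν ρ => -(2⁻¹ * ∑ μ, mink μ * g.cmp (fun μ => P.e x μ x)
      (P.riemann x (P.e x μ x) (P.e x ν x) (P.e x μ x)) ρ) with hr
  -- `r` is a multiple of the Ricci contraction; pair symmetry of the curvature makes it symmetric
  -- once an index is lowered.
  have hsymm : ∀ ν ρ, mink ρ * r ν ρ = mink ν * r ρ ν := fun ν ρ => by
    have h : ∀ ν ρ, mink ρ * r ν ρ = -(2⁻¹ * ∑ μ, mink μ * g.val x
        (P.riemann x (P.e x μ x) (P.e x ν x) (P.e x μ x)) (P.e x ρ x)) := fun ν ρ => by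
      simp only [hr, LorentzMetric.cmp, Finset.mul_sum, mul_neg]
      refine congrArg Neg.neg (Finset.sum_congr rfl fun μ _ => ?_)
      have := mink_mul_self ρ
      linear_combination (2⁻¹ * mink μ * g.val x (P.riemann x (P.e x μ x) (P.e x ν x) (P.e x μ x)) (P.e x ρ x)) * this
    rw [h, h]
    simp only [P.riemann_val_pair x (P.e x _ x) (P.e x ν x)]
  -- The antisymmetric part would produce bivectors; for symmetric `r` the Clifford product
  -- collapses to the trace.
  have hs : ∀ s, ∃ k : ℝ, ∑ ν, mink ν • gamma ν (clM (r ν) s) = k • s := fun s => by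
    have h := fun ν ρ => hsymm ν ρ
    simp [mink, Fin.forall_fin_succ] at h
    have h10 : r 1 0 = -r 0 1 := by linarith
    have h20 : r 2 0 = -r 0 2 := by linarith
    have h30 : r 3 0 = -r 0 3 := by linarith
    have h21 : r 2 1 = r 1 2 := by linarith
    have h31 : r 3 1 = r 1 3 := by linarith
    have h32 : r 3 2 = r 2 3 := by linarith
    refine ⟨-(r 0 0 + r 1 1 + r 2 2 + r 3 3), ?_⟩
    simp only [Fin.sum_univ_four, gamma_zero_apply, gamma_one_apply, gamma_two_apply,
      gamma_three_apply, clM_apply, h10, h20, h30, h21, h31, h32]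
    ext i
    fin_cases i <;>
    · simp [mink]
      ring
  obtain ⟨k, hk⟩ := hs (P.evalSpinor x ε)
  have h := fun ν => traced_integrability hε x ν
  simp only [← h, map_add, smul_add, Finset.sum_add_distrib, sum_gamma_tracedQuad, hr] at hk
  exact ⟨_, (eq_sub_of_add_eq' hk).trans (sub_smul _ _ _).symm⟩

theorem cmp_kappa (x : M) (s t : Spinor) (μ : Fin 4) :
    g.cmp (fun μ => P.e x μ x) (P.kappa x s t) μ = mink μ * Ω.form s (gamma μ t) := by
  rw [LorentzMetric.cmp, val_kappa, cliff_e]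

theorem dirD_curr_eq (ε : P.SpinorField) (f : CF M) (x : M) : dirD (P.curr ε ε) f x =
    Ω.form (P.evalSpinor x ε) (clM (fun μ => mink μ * mvfderiv (𝓡 4) f x (P.e x μ x))
      (P.evalSpinor x ε)) := by
  rw [dirD_apply, curr_apply, ← (P.isONFrame_e x).sum_cmp (P.kappa x _ _)]
  simp only [map_sum, map_smul, cmp_kappa, clM, LinearMap.sum_apply, LinearMap.smul_apply,
    smul_eq_mul]
  exact Finset.sum_congr rfl fun μ _ => by ring

/-- Pairing the double trace with s kills the scalar side and the terms in db and div φ, leaving ⟨s,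
da·s⟩ = da(κ). -/
theorem dirD_curr_a (hε : ε ∈ k1 P Φ) : dirD (P.curr ε ε) Φ.a = 0 := by
  ext x
  obtain ⟨k, hk⟩ := double_traced_integrability hε x
  rw [sum_gamma_tracedDeriv] at hk
  have h := congrArg (Ω.form (P.evalSpinor x ε)) hk
  simp only [map_add, map_sub, map_smul, Ω.form_self_vol, Ω.form_self_clM_vol, Ω.alt,
    smul_eq_mul] at h
  rw [dirD_curr_eq]
  change _ = (0 : ℝ)
  linarith

/-- Pairing instead after multiplication by `vol` exchanges the roles of da and db, since vol·db·vol
= db. -/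
theorem dirD_curr_b (hε : ε ∈ k1 P Φ) : dirD (P.curr ε ε) Φ.b = 0 := by
  ext x
  obtain ⟨k, hk⟩ := double_traced_integrability hε x
  rw [sum_gamma_tracedDeriv] at hk
  have h := congrArg (fun s => Ω.form (P.evalSpinor x ε) (vol s)) hk
  have hv : ∀ v s, vol (clM v (vol s)) = clM v s := fun v s => by
    have h1 := LinearMap.congr_fun (vol_clM v) (vol s)
    have h2 := LinearMap.congr_fun vol_mul_vol s
    simp only [LinearMap.neg_apply, Module.End.mul_apply, Module.End.one_apply] at h1 h2
    rw [h1, h2, map_neg, neg_neg]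
  have hvv : ∀ s, vol (vol s) = -s := fun s => LinearMap.congr_fun vol_mul_vol s
  simp only [map_add, map_sub, map_smul, hv, hvv, map_neg, Ω.form_self_vol_clM, Ω.form_self_vol,
    Ω.alt, smul_eq_mul] at h
  rw [dirD_curr_eq]
  change _ = (0 : ℝ)
  linarith

variable (P Φ) in
/-- The covariant derivative of the Dirac current of Killing spinors. -/
theorem nabla_curr {ε' : P.SpinorField} (hε : ε ∈ k1 P Φ) (hε' : ε' ∈ k1 P Φ) (x : M) (v : T x) :
    P.nabla (P.curr ε ε') x v =
      P.kappa x (beta P Φ x v (P.evalSpinor x ε)) (P.evalSpinor x ε')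
        + P.kappa x (P.evalSpinor x ε) (beta P Φ x v (P.evalSpinor x ε')) := by
  obtain ⟨X, rfl⟩ := exists_vfield x v
  rw [← cov_apply, cov_curr, mem_k1_iff.1 hε, mem_k1_iff.1 hε', ← eval_betaS, ← eval_betaS]
  rfl

/-- Pairing s with vol times the single trace kills the Ricci side. The quadratic part is a multiple
of ∇_φ κ and the derivative part one of ∇_κ φ, with coefficients such that their difference ℒ_κ φ
vanishes. -/
theorem lieV_curr_phi (hε : ε ∈ k1 P Φ) : lieV (P.curr ε ε) Φ.φ = 0 := by
  ext1 x
  refine (P.isONFrame_e x).ext fun ν => ?_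
  obtain ⟨k, hk⟩ := double_traced_integrability hε x
  have h1 := congrArg (fun s => Ω.form (P.evalSpinor x ε) (vol s)) (traced_integrability hε x ν)
  have h2 := Ω.form_vol_tracedDeriv (fun μ => mvfderiv (𝓡 4) Φ.a x (P.e x μ x))
      (fun μ => mvfderiv (𝓡 4) Φ.b x (P.e x μ x))
      (fun μ => g.cmp (fun μ => P.e x μ x) (P.nabla Φ.φ x (P.e x μ x))) (P.evalSpinor x ε) ν
  simp only [map_add, Ω.form_self_vol_clM, Ω.form_vol_tracedQuad] at h1
  rw [hk, map_smul, map_smul, map_smul, ← clM_single, Ω.form_self_vol_clM, smul_zero] at h2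
  have h3 : g.cmp (fun μ => P.e x μ x) (P.nabla Φ.φ x (P.curr ε ε x)) ν =
      ∑ μ, mink μ * Ω.form (P.evalSpinor x ε) (gamma μ (P.evalSpinor x ε)) *
        g.cmp (fun μ => P.e x μ x) (P.nabla Φ.φ x (P.e x μ x)) ν := by
    rw [cmp_map (P.isONFrame_e x)]
    simp only [curr_apply, cmp_kappa]
  have h4 : g.cmp (fun μ => P.e x μ x) (P.nabla (P.curr ε ε) x (Φ.φ x)) ν =
      2 * (mink ν * Ω.form (betaM (Φ.a x) (Φ.b x) (g.cmp (fun μ => P.e x μ x) (Φ.φ x))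
        (g.cmp (fun μ => P.e x μ x) (Φ.φ x)) (P.evalSpinor x ε)) (gamma ν (P.evalSpinor x ε))) := by
    rw [P.nabla_curr Φ hε hε, P.kappa_symm x (P.evalSpinor x ε), LorentzMetric.cmp_add, cmp_kappa,
      beta_eq_betaM]
    ring
  have h5 : lieV (P.curr ε ε) Φ.φ x =
      P.nabla Φ.φ x (P.curr ε ε x) - P.nabla (P.curr ε ε) x (Φ.φ x) :=
    (congrArg (fun V : VField M => V x) (P.cov_sub_cov (P.curr ε ε) Φ.φ)).symm
  rw [h5, LorentzMetric.cmp_sub, h3, h4]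
  change _ = g.cmp (fun μ => P.e x μ x) (0 : T x) ν
  rw [LorentzMetric.cmp_zero]
  have hm := mink_mul_self ν
  set S := ∑ μ, mink μ * Ω.form (P.evalSpinor x ε) (gamma μ (P.evalSpinor x ε)) *
    g.cmp (fun μ => P.e x μ x) (P.nabla Φ.φ x (P.e x μ x)) ν
  linear_combination (mink ν / 2) * h2 - (mink ν / 2) * h1 - S * hm

theorem isKilling_curr {ε' : P.SpinorField} (hε : ε ∈ k1 P Φ) (hε' : ε' ∈ k1 P Φ) :
    g.IsKilling (P.curr ε ε') := by
  rw [P.isKilling_iff]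
  intro Y Z
  ext x
  change g.val x (P.nabla (P.curr ε ε') x (Y x)) (Z x) =
    -g.val x (Y x) (P.nabla (P.curr ε ε') x (Z x))
  rw [P.nabla_curr Φ hε hε', P.nabla_curr Φ hε hε']
  exact P.val_kappa_beta Φ x _ _ _ _

theorem curr_self_mem_k0 (hε : ε ∈ k1 P Φ) : P.curr ε ε ∈ k0 g Φ :=
  mem_k0_iff.2 ⟨isKilling_curr hε hε, dirD_curr_a hε, dirD_curr_b hε, lieV_curr_phi hε⟩

/-- The Dirac current of two Killing spinors preserves all the background fields. -/
theorem curr_mem_k0 {ε' : P.SpinorField} (hε : ε ∈ k1 P Φ) (hε' : ε' ∈ k1 P Φ) :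
    P.curr ε ε' ∈ k0 g Φ := by
  have h : P.curr ε ε' = (2⁻¹ : ℝ) • (P.curr (ε + ε') (ε + ε') - P.curr ε ε - P.curr ε' ε') := by
    ext1 x
    change P.kappa x _ _ = (2⁻¹ : ℝ) • (P.kappa x (P.evalSpinor x (ε + ε'))
      (P.evalSpinor x (ε + ε')) - P.kappa x _ _ - P.kappa x _ _)
    simp only [map_add, LinearMap.add_apply, P.kappa_symm x (P.evalSpinor x ε') (P.evalSpinor x ε)]
    module
  rw [h]
  exact Submodule.smul_mem _ _ (sub_mem (sub_mem (curr_self_mem_k0 (add_mem hε hε'))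
    (curr_self_mem_k0 hε)) (curr_self_mem_k0 hε'))

end

end SpinStructure

end

section

variable {M : Type*} [TopologicalSpace M] [ChartedSpace E4 M] [IsManifold (𝓡 4) ∞ M]

/-! ### Unique continuation for first-order linear systems -/

/-- Coordinate vector fields near a point. -/
theorem exists_coordinate_fields [T2Space M] (x : M) :
    ∃ Y : Fin 4 → VField M, ∀ᶠ y in 𝓝 x, ∀ i, Y i y =
      mfderiv 𝓘(ℝ, E4) (𝓡 4) (extChartAt (𝓡 4) x).symm (extChartAt (𝓡 4) x y)
        (EuclideanSpace.single i 1 : E4) := by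
  let e := trivializationAt E4 (TangentSpace (𝓡 4) : M → Type _) x
  let b := (EuclideanSpace.basisFun (Fin 4) ℝ).toBasis
  have hx : x ∈ e.baseSet := FiberBundle.mem_baseSet_trivializationAt _ _ x
  choose Y hY using fun i => exists_section_eventuallyEq e.open_baseSet
    (e.contMDiffOn_localFrame_baseSet (I := 𝓡 4) ∞ b i) hx
  refine ⟨Y, ?_⟩
  filter_upwards [Filter.eventually_all.2 hY, e.open_baseSet.mem_nhds hx] with y hy hye i
  have hys : y ∈ (chartAt E4 x).source := by simpa [e] using hye
  have h := TangentBundle.symmL_trivializationAt (I := 𝓡 4) (𝕜 := ℝ) (x₀ := x) hys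
  rw [ModelWithCorners.range_eq_univ, mfderivWithin_univ] at h
  rw [hy i, ← h, e.localFrame_apply_of_mem_baseSet b hye]
  have hb : b i = EuclideanSpace.single i 1 := by simp [b]
  rw [← hb]
  refine Eq.trans ?_ (Trivialization.symmL_apply (R := ℝ) e hye (b i)).symm
  simp [Trivialization.basisAt]

/-- In a chart the hypothesis bounds the derivative of u by a constant times |u|; Grönwall's
inequality along segments from the centre then propagates u = 0 to a ball. -/
theorem eventually_eq_zero_of_linear_system [T2Space M] {κ : Type*} [Fintype κ] {x : M}
    (u : κ → CF M)
    (hu : ∀ Y : VField M, ∃ c : κ → κ → M → ℝ, (∀ a b, ContinuousAt (c a b) x) ∧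
      ∀ᶠ y in 𝓝 x, ∀ a, dirD Y (u a) y = ∑ b, c a b y * u b y)
    (h0 : ∀ a, u a x = 0) : ∀ᶠ y in 𝓝 x, ∀ a, u a y = 0 := by
  obtain ⟨Y, hY⟩ := exists_coordinate_fields x
  choose c hc hcu using fun i => hu (Y i)
  have hC : ∀ i a b, ∃ C, ∀ᶠ y in 𝓝 x, |c i a b y| ≤ C := fun i a b => by
    refine ⟨|c i a b x| + 1, ?_⟩
    have := (hc i a b).abs.eventually (gt_mem_nhds (lt_add_one |c i a b x|))
    exact this.mono fun y hy => le_of_lt hy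
  choose C hC using hC
  let φ := extChartAt (𝓡 4) x
  let z₀ := φ x
  let U : E4 → κ → ℝ := fun z a => u a (φ.symm z)
  -- A crude bound for the operator norms of all coefficient matrices near x, from their continuity
  -- there.
  set K : ℝ := ∑ i, ∑ a, ∑ b, |C i a b| with hK
  have hK0 : 0 ≤ K := by positivity
  have htend : Filter.Tendsto φ.symm (𝓝 z₀) (𝓝 x) := by
    have := (continuousAt_extChartAt_symm (I := 𝓡 4) x).tendsto
    rwa [extChartAt_to_inv] at this
  have hev : ∀ᶠ z in 𝓝 z₀, DifferentiableAt ℝ U z ∧ ∀ w : E4, ‖fderiv ℝ U z w‖ ≤ K * ‖w‖ * ‖U z‖ := by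
    filter_upwards [htend.eventually hY, htend.eventually (Filter.eventually_all.2 hcu),
      htend.eventually (Filter.eventually_all.2 fun i => Filter.eventually_all.2 fun a =>
        Filter.eventually_all.2 fun b => hC i a b),
      (isOpen_extChartAt_target (I := 𝓡 4) x).mem_nhds (mem_extChartAt_target x)]
      with z hzY hzu hzC hzt
    have hφ : MDifferentiableAt 𝓘(ℝ, E4) (𝓡 4) φ.symm z := by
      have := mdifferentiableWithinAt_extChartAt_symm (I := 𝓡 4) hzt
      rwa [ModelWithCorners.range_eq_univ, mdifferentiableWithinAt_univ] at this
    have hz : φ (φ.symm z) = z := φ.right_inv hzt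
    have hda : ∀ a, HasMFDerivAt 𝓘(ℝ, E4) 𝓘(ℝ, ℝ) (fun z => U z a) z
        ((mfderiv (𝓡 4) 𝓘(ℝ, ℝ) (u a) (φ.symm z)).comp
          (mfderiv 𝓘(ℝ, E4) (𝓡 4) φ.symm z)) := fun a =>
      HasMFDerivAt.comp z (CF.mdiff (u a) (φ.symm z)).hasMFDerivAt hφ.hasMFDerivAt
    obtain ⟨L, hL, hLi⟩ : ∃ L : κ → E4 →L[ℝ] ℝ, (∀ a, HasFDerivAt (fun z => U z a) (L a) z) ∧
        ∀ a i, L a (EuclideanSpace.single i 1) = dirD (Y i) (u a) (φ.symm z) := by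
      refine ⟨_, fun a => (hda a).hasFDerivAt, fun a i => ?_⟩
      have h1 := hzY i
      rw [hz] at h1
      rw [dirD_apply, h1]
      rfl
    have hdU : HasFDerivAt U (ContinuousLinearMap.pi L) z := hasFDerivAt_pi.2 hL
    refine ⟨hdU.differentiableAt, fun w => ?_⟩
    rw [hdU.fderiv, pi_norm_le_iff_of_nonneg (by positivity)]
    intro a
    have hw : w = ∑ i, w i • (EuclideanSpace.single i 1 : E4) := by
      conv_lhs => rw [← (EuclideanSpace.basisFun (Fin 4) ℝ).sum_repr w]
      simp
    have hval : L a w = ∑ i, w i * ∑ b, c i a b (φ.symm z) * u b (φ.symm z) := by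
      conv_lhs => rw [hw]
      simp only [map_sum, map_smul, smul_eq_mul, hLi, hzu]
    rw [ContinuousLinearMap.pi_apply, hval]
    calc ‖∑ i, w i * ∑ b, c i a b (φ.symm z) * u b (φ.symm z)‖
        ≤ ∑ i, ‖w‖ * ∑ b, |C i a b| * ‖U z‖ := by
          refine (norm_sum_le _ _).trans (Finset.sum_le_sum fun i _ => ?_)
          rw [norm_mul]
          refine mul_le_mul (PiLp.norm_apply_le w i) ((norm_sum_le _ _).trans
            (Finset.sum_le_sum fun b _ => ?_)) (norm_nonneg _) (norm_nonneg _)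
          rw [norm_mul]
          exact mul_le_mul ((hzC i a b).trans (le_abs_self _)) (norm_le_pi_norm (U z) b)
            (norm_nonneg _) (abs_nonneg _)
      _ = (∑ i, ∑ b, |C i a b|) * ‖w‖ * ‖U z‖ := by
          simp only [← Finset.sum_mul, ← Finset.mul_sum]
          ring
      _ ≤ K * ‖w‖ * ‖U z‖ := by
          gcongr
          rw [hK]
          refine Finset.sum_le_sum fun i _ => ?_
          exact Finset.single_le_sum (f := fun a => ∑ b, |C i a b|)
            (fun a _ => Finset.sum_nonneg fun b _ => abs_nonneg _) (Finset.mem_univ a)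
  obtain ⟨r, hr, hball⟩ := Metric.eventually_nhds_iff_ball.1 hev
  have hzero : ∀ z ∈ Metric.ball z₀ r, U z = 0 := fun z hz => by
    let γ : ℝ → E4 := fun t => z₀ + t • (z - z₀)
    have hγ : ∀ t ∈ Set.Icc (0 : ℝ) 1, γ t ∈ Metric.ball z₀ r := fun t ht => by
      rw [mem_ball_iff_norm] at hz ⊢
      have : γ t - z₀ = t • (z - z₀) := by simp [γ]
      rw [this, norm_smul, Real.norm_eq_abs, abs_of_nonneg ht.1]
      exact lt_of_le_of_lt (mul_le_of_le_one_left (norm_nonneg _) ht.2) hz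
    have hγd : ∀ t, HasDerivAt γ (z - z₀) t := fun t => by
      have := ((hasDerivAt_id t).smul_const (z - z₀)).const_add z₀
      rw [one_smul] at this
      exact this
    have hd : ∀ t ∈ Set.Icc (0 : ℝ) 1,
        HasDerivAt (fun t => U (γ t)) (fderiv ℝ U (γ t) (z - z₀)) t := fun t ht =>
      (hball _ (hγ t ht)).1.hasFDerivAt.comp_hasDerivAt t (hγd t)
    -- With initial value and inhomogeneity both 0, the Grönwall bound is 0.
    have h := norm_le_gronwallBound_of_norm_deriv_right_le (f := fun t => U (γ t)) (δ := 0)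
      (ε := 0) (K := K * ‖z - z₀‖) (a := 0) (b := 1)
      (fun t ht => (hd t ht).continuousAt.continuousWithinAt)
      (fun t ht => (hd t (Set.Ico_subset_Icc_self ht)).hasDerivWithinAt)
      (by
        have : U (γ 0) = 0 := by
          ext a
          simp [U, γ, z₀, φ, h0]
        rw [this, norm_zero])
      (fun t ht => by
        rw [add_zero]
        exact (hball _ (hγ t (Set.Ico_subset_Icc_self ht))).2 _) 1 ⟨zero_le_one, le_rfl⟩
    rw [gronwallBound_ε0_δ0, norm_le_zero_iff] at h
    simpa [γ] using h
  have hφc : Filter.Tendsto φ (𝓝 x) (𝓝 z₀) := (continuousAt_extChartAt (I := 𝓡 4) x).tendsto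
  filter_upwards [hφc.eventually (Metric.ball_mem_nhds z₀ hr),
    extChartAt_source_mem_nhds (I := 𝓡 4) x] with y hy hys a
  have := congrFun (hzero _ hy) a
  change u a (φ.symm (φ y)) = 0 at this
  rwa [φ.left_inv hys] at this

/-- The common zero set of solutions of local first-order linear systems is empty or everything. -/
theorem zero_set_eq_univ [T2Space M] [ConnectedSpace M] {κ : Type*} [Fintype κ] (S : Set M)
    (hS : ∀ x, ∃ u : κ → CF M, (∀ᶠ y in 𝓝 x, y ∈ S ↔ ∀ a, u a y = 0) ∧
      ∀ Y : VField M, ∃ c : κ → κ → M → ℝ, (∀ a b, ContinuousAt (c a b) x) ∧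
        ∀ᶠ y in 𝓝 x, ∀ a, dirD Y (u a) y = ∑ b, c a b y * u b y)
    {o : M} (ho : o ∈ S) : S = Set.univ := by
  -- Closed by continuity of the functions `u`, open by unique continuation; connectedness and the
  -- point `o` conclude.
  refine IsClopen.eq_univ ⟨⟨isOpen_iff_mem_nhds.2 fun x hx => ?_⟩,
    isOpen_iff_mem_nhds.2 fun x hx => ?_⟩ ⟨o, ho⟩
  · obtain ⟨u, hu, -⟩ := hS x
    have hx' : ¬∀ a, u a x = 0 := fun h => hx (hu.self_of_nhds.2 h)
    push Not at hx'
    obtain ⟨a, ha⟩ := hx'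
    filter_upwards [hu, (u a).contMDiff.continuous.continuousAt.eventually_ne ha] with y hy hya hyS
    exact hya (hy.1 hyS a)
  · obtain ⟨u, hu, hc⟩ := hS x
    filter_upwards [hu, eventually_eq_zero_of_linear_system u hc (hu.self_of_nhds.1 hx)]
      with y hy hy'
    exact hy.2 hy'

end

section

variable {M : Type*} [TopologicalSpace M] [ChartedSpace E4 M] [IsManifold (𝓡 4) ∞ M]

/-! ### Killing vectors and Killing spinors are determined at a point -/

theorem LorentzMetric.IsONFrame.val_map {g : LorentzMetric M} {x : M} {f : Fin 4 → T x}
    (hf : g.IsONFrame f) (L : Module.End ℝ (T x)) (v w : T x) :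
    g.val x (L v) w = ∑ ρ, mink ρ * g.val x v (f ρ) * g.val x (L (f ρ)) w := by
  conv_lhs => rw [← hf.sum_cmp v]
  simp only [map_sum, map_smul, _root_.sum_apply, _root_.smul_apply, smul_eq_mul,
    LorentzMetric.cmp]

namespace SpinStructure
variable {g : LorentzMetric M} {Ω : SpinorForm} {ι : Type*} (P : SpinStructure g Ω ι)
variable [T2Space M]

/-- Spinor fields which are constant in a given frame near a point. -/
theorem exists_spinor_frame {i : ι} {x : M} (hx : x ∈ P.baseSet i) :
    ∃ B : Fin 4 → P.SpinorField,
      ∀ᶠ y in 𝓝 x, y ∈ P.baseSet i ∧ ∀ a, P.comp i (B a) y = Pi.single a 1 := by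
  let b : Fin 4 → ∀ y, P.toVectorBundleCore.Fiber y := fun a y =>
    P.coordChange i (P.indexAt y) y (Pi.single a 1 : Spinor)
  have hcb : ∀ a, ∀ y ∈ P.baseSet i,
      P.coordChange (P.indexAt y) i y (b a y) = (Pi.single a 1 : Spinor) := fun a y hy => by
    rw [P.coordChange_comp i (P.indexAt y) i y ⟨⟨hy, P.mem_baseSet_at y⟩, hy⟩,
      P.coordChange_self i y hy]
  have hb : ∀ a, ContMDiffOn (𝓡 4) ((𝓡 4).prod 𝓘(ℝ, Spinor)) ∞
      (fun y => TotalSpace.mk' Spinor y (b a y)) (P.baseSet i) := fun a y hy => by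
    refine ContMDiffAt.contMDiffWithinAt ((P.contMDiffAt_section_iff hy).2 ?_)
    refine contMDiffAt_const (c := (Pi.single a 1 : Spinor)) |>.congr_of_eventuallyEq ?_
    filter_upwards [(P.isOpen_baseSet i).mem_nhds hy] with z hz
    exact hcb a z hz
  choose B hB using fun a => exists_section_eventuallyEq (P.isOpen_baseSet i) (hb a) hx
  refine ⟨B, ?_⟩
  filter_upwards [Filter.eventually_all.2 hB, (P.isOpen_baseSet i).mem_nhds hx] with y hy hyi
  refine ⟨hyi, fun a => ?_⟩
  rw [← hcb a y hyi, ← hy a]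
  rfl

theorem evalSpinor_eq_coordChange {i : ι} {y : M} (hy : y ∈ P.baseSet i) (ε : P.SpinorField) :
    P.evalSpinor y ε = P.coordChange i (P.indexAt y) y (P.comp i ε y) := by
  rw [P.coordChange_comp_comp hy (P.mem_baseSet_at y), comp_indexAt]

theorem comp_scov {i : ι} {y : M} (hy : y ∈ P.baseSet i) (Y : VField M) (ε : P.SpinorField) :
    P.comp i (P.scov Y ε) y = P.snab i ε y (Y y) := by
  rw [comp_apply, eval_scov, spinNabla_eq_snab, P.coordChange_snab (P.mem_baseSet_at y) hy]

/-- A Killing spinor vanishing at a point vanishes. -/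
theorem eq_zero_of_mem_k1 [ConnectedSpace M] {Φ : Fields M} {ε : P.SpinorField} (hε : ε ∈ k1 P Φ)
    {o : M} (ho : P.evalSpinor o ε = 0) : ε = 0 := by
  suffices h : {x | P.evalSpinor x ε = 0} = Set.univ from
    SpinorField.ext fun x => (Set.ext_iff.1 h x).2 trivial
  refine zero_set_eq_univ (κ := Fin 4) _ (fun x => ?_) ho
  have hx := P.mem_baseSet_at x
  set i := P.indexAt x with hi
  choose u hu using fun a : Fin 4 => exists_function_eventuallyEq (P.isOpen_baseSet i)
    (fun y hy => ((contMDiffAt_pi_space.1 (P.contMDiffAt_comp hy ε)) a).contMDiffWithinAt) hx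
  obtain ⟨B, hB⟩ := P.exists_spinor_frame hx
  -- In components the Killing equation is du(Y) = (β_Y − σ(θ(Y))) u; the matrix entries are read
  -- off by applying β_Y and ∇_Y to the locally constant spinors `B b`.
  refine ⟨u, ?_, fun Y => ⟨fun a b y => P.comp i (P.betaS Φ Y (B b)) y a
    - P.comp i (P.scov Y (B b)) y a, fun a b => ?_, ?_⟩⟩
  · filter_upwards [Filter.eventually_all.2 hu, hB] with y hy hyB
    constructor
    · intro h a
      have h' : P.evalSpinor y ε = 0 := h
      rw [hy, comp_apply, h', map_zero]
      rfl
    · intro h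
      have h' : P.comp i ε y = 0 := by
        ext a
        rw [← hy, h]
        rfl
      change P.evalSpinor y ε = 0
      rw [P.evalSpinor_eq_coordChange hyB.1, h', map_zero]
  · have h : ∀ ε' : P.SpinorField, ContinuousAt (fun y => P.comp i ε' y a) x := fun ε' =>
      (continuousAt_pi.1 (P.contMDiffAt_comp hx ε').continuousAt) a
    exact (h _).sub (h _)
  · filter_upwards [Filter.eventually_all.2 fun a => (hu a).eventually_nhds, hB,
      hB.eventually_nhds] with y hy hyB hyB' a
    have hcomp : ∀ b, u b y = P.comp i ε y b := fun b => (hy b).self_of_nhds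
    have hsum : P.comp i ε y = ∑ b, u b y • (Pi.single b 1 : Spinor) := by
      ext a; simp [hcomp, Finset.sum_apply, Pi.single_apply]
    have heval : P.evalSpinor y ε = ∑ b, u b y • P.evalSpinor y (B b) := by
      rw [P.evalSpinor_eq_coordChange hyB.1, hsum, map_sum]
      refine Finset.sum_congr rfl fun b _ => ?_
      rw [map_smul, P.evalSpinor_eq_coordChange hyB.1 (B b), hyB.2 b]
    have h1 : dirD Y (u a) y = mvfderiv (𝓡 4) (P.comp i ε) y (Y y) a := by
      have h3 := mvfderiv_linearMap (LinearMap.proj a : Spinor →ₗ[ℝ] ℝ) (P.mdiffAt_comp hyB.1 ε)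
        (Y y)
      rw [dirD_apply, mvfderiv_congr (hy a)]
      exact h3
    have h2 : ∀ b, P.comp i (P.scov Y (B b)) y = sgM (fun μ => g.cmp (fun ν => P.frame i ν y)
        (P.nabla (P.frame i μ) y (Y y))) (Pi.single b 1) := fun b => by
      have hc : P.comp i (B b) =ᶠ[𝓝 y] fun _ => (Pi.single b 1 : Spinor) :=
        hyB'.mono fun z hz => hz.2 b
      rw [P.comp_scov hyB.1, snab, mvfderiv_congr hc, mvfderiv_const, hyB.2 b]
      change (0 : Spinor) + _ = _
      rw [zero_add]
    have h3 : P.comp i (P.betaS Φ Y ε) y = ∑ b, u b y • P.comp i (P.betaS Φ Y (B b)) y := by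
      simp only [comp_apply, eval_betaS, heval, map_sum, map_smul]
    have h4 := P.comp_scov hyB.1 Y ε
    rw [mem_k1_iff.1 hε, snab, h3] at h4
    have h5 : sgM (fun μ => g.cmp (fun ν => P.frame i ν y)
        (P.nabla (P.frame i μ) y (Y y))) (P.comp i ε y) =
        ∑ b, u b y • P.comp i (P.scov Y (B b)) y := by
      rw [hsum, map_sum]
      exact Finset.sum_congr rfl fun b _ => by rw [map_smul, h2]
    rw [h5, ← sub_eq_iff_eq_add] at h4
    rw [h1, ← h4, ← Finset.sum_sub_distrib, Finset.sum_apply]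
    refine Finset.sum_congr rfl fun b _ => ?_
    simp only [Pi.sub_apply, Pi.smul_apply, smul_eq_mul]
    ring

/-- A Killing vector vanishing to first order at a point vanishes. -/
theorem eq_zero_of_isKilling [ConnectedSpace M] {X : VField M} (hX : g.IsKilling X) {o : M}
    (ho : X o = 0) (ho' : P.aMap X o = 0) : X = 0 := by
  suffices h : {x | X x = 0 ∧ P.aMap X x = 0} = Set.univ by
    ext1 x
    exact ((Set.ext_iff.1 h x).2 trivial).1
  refine zero_set_eq_univ (κ := Fin 4 ⊕ Fin 4 × Fin 4) _ (fun x => ?_) ⟨ho, ho'⟩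
  obtain ⟨E, hE⟩ := P.exists_frame (P.mem_baseSet_at x)
  have hON : ∀ᶠ y in 𝓝 x, g.IsONFrame fun μ => E μ y := hE.mono fun y hy μ ν => by
    beta_reduce; rw [hy.2, hy.2]; exact P.isONFrame hy.1 μ ν
  -- Prolongation: the unknowns are the components of X and of ∇X. The derivative of X is in ∇X, and
  -- that of ∇X is given by the curvature applied to X, so the system closes.
  let u : Fin 4 ⊕ Fin 4 × Fin 4 → CF M :=
    Sum.elim (fun μ => g.inn X (E μ)) fun p => g.inn (P.cov (E p.1) X) (E p.2)
  refine ⟨u, ?_, fun Y => ⟨Sum.elim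
    (fun μ => Sum.elim (fun ρ y => mink ρ * g.inn (P.cov Y (E μ)) (E ρ) y)
      (fun p y => if p.2 = μ then mink p.1 * g.inn Y (E p.1) y else 0))
    (fun q => Sum.elim (fun ρ y => mink ρ * g.inn (P.curv (E q.1) (E q.2) (E ρ)) Y y)
      (fun p y => (if p.2 = q.2 then mink p.1 * g.inn (P.cov Y (E q.1)) (E p.1) y else 0)
        + if p.1 = q.1 then mink p.2 * g.inn (P.cov Y (E q.2)) (E p.2) y else 0)), ?_, ?_⟩⟩
  · filter_upwards [hON] with y hy
    constructor
    · rintro ⟨h1, h2⟩ (μ | ⟨μ, ν⟩)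
      · change g.val y (X y) (E μ y) = 0
        rw [h1, map_zero, _root_.zero_apply]
      · change g.val y (P.cov (E μ) X y) (E ν y) = 0
        rw [← neg_neg (P.cov (E μ) X y), ← aMap_cov, h2, LinearMap.zero_apply, neg_zero, map_zero,
          _root_.zero_apply]
    · intro h
      refine ⟨hy.ext fun μ => ?_, LinearMap.ext fun v => hy.ext fun ν => ?_⟩
      · have : g.val y (X y) (E μ y) = 0 := h (Sum.inl μ)
        rw [LorentzMetric.cmp, this, LorentzMetric.cmp_zero, mul_zero]
      · have h' : ∀ μ, g.val y (P.aMap X y (E μ y)) (E ν y) = 0 := fun μ => by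
          have : g.val y (P.cov (E μ) X y) (E ν y) = 0 := h (Sum.inr (μ, ν))
          rw [aMap_cov, map_neg, _root_.neg_apply, this, neg_zero]
        rw [LorentzMetric.cmp, hy.val_map, LinearMap.zero_apply, LorentzMetric.cmp_zero]
        simp [h']
  · have hc : ∀ f : CF M, ContinuousAt f x := fun f => f.contMDiff.continuous.continuousAt
    rintro (μ | q) (ρ | p)
    · exact continuousAt_const.mul (hc _)
    · by_cases h : p.2 = μ
      · simp only [Sum.elim_inl, Sum.elim_inr, h, if_true]
        exact continuousAt_const.mul (hc _)
      · simpa [h] using continuousAt_const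
    · exact continuousAt_const.mul (hc _)
    · refine ContinuousAt.add ?_ ?_
      · by_cases h : p.2 = q.2
        · simp only [h, if_true]; exact continuousAt_const.mul (hc _)
        · simpa [h] using continuousAt_const
      · by_cases h : p.1 = q.1
        · simp only [h, if_true]; exact continuousAt_const.mul (hc _)
        · simpa [h] using continuousAt_const
  · filter_upwards [hON] with y hy
    have hcov : ∀ V W : VField M, g.inn (P.cov V X) W y =
        ∑ ρ, mink ρ * g.inn V (E ρ) y * g.inn (P.cov (E ρ) X) W y := fun V W =>
      hy.val_map (P.nabla X y) (V y) (W y)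
    have hinn : ∀ V W : VField M, g.inn V W y =
        ∑ ρ, mink ρ * g.inn V (E ρ) y * g.inn W (E ρ) y := fun V W => by
      have := hy.val_map LinearMap.id (V y) (W y)
      simp only [LinearMap.id_apply] at this
      rw [g.inn_apply, this]
      simp only [g.symm y (E _ y) (W y)]
      rfl
    -- Pair symmetry moves X from the first slot to the third, where its frame expansion gives
    -- coefficients that involve only Y and the frame.
    have hcurv : ∀ μ ν, g.inn (P.curv X Y (E μ)) (E ν) y =
        ∑ ρ, mink ρ * g.inn X (E ρ) y * g.inn (P.curv (E μ) (E ν) (E ρ)) Y y := fun μ ν => by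
      rw [g.inn_apply, ← riemann_apply, P.riemann_val_pair,
        hy.val_map (P.riemann y (E μ y) (E ν y))]
      simp only [riemann_apply]
      rfl
    rintro (μ | ⟨μ, ν⟩)
    · have h1 : dirD Y (u (Sum.inl μ)) y =
          g.inn (P.cov Y X) (E μ) y + g.inn X (P.cov Y (E μ)) y :=
        congrArg (fun f : CF M => f y) (P.dirD_inn Y X (E μ))
      rw [h1, hcov Y, hinn X, Fintype.sum_sum_type, Fintype.sum_prod_type]
      simp only [Sum.elim_inl, Sum.elim_inr, ite_mul, zero_mul, Finset.sum_ite_eq',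
        Finset.mem_univ, if_true, u]
      rw [add_comm]
      refine congrArg₂ (· + ·) (Finset.sum_congr rfl fun ρ _ => by ring)
        (Finset.sum_congr rfl fun ρ _ => by ring)
    · have h1 : dirD Y (u (Sum.inr (μ, ν))) y = g.inn (P.cov Y (P.cov (E μ) X)) (E ν) y
          + g.inn (P.cov (E μ) X) (P.cov Y (E ν)) y :=
        congrArg (fun f : CF M => f y) (P.dirD_inn Y (P.cov (E μ) X) (E ν))
      have h2 : g.inn (P.cov Y (P.cov (E μ) X)) (E ν) y =
          g.inn (P.cov (P.cov Y (E μ)) X) (E ν) y + g.inn (P.curv X Y (E μ)) (E ν) y := by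
        rw [cov_cov_of_isKilling hX, g.inn_add_left]
        rfl
      rw [h1, h2, hcov (P.cov Y (E μ)), hinn (P.cov (E μ) X), hcurv, Fintype.sum_sum_type,
        Fintype.sum_prod_type]
      simp only [Sum.elim_inl, Sum.elim_inr, add_mul, ite_mul, zero_mul, Finset.sum_add_distrib,
        Finset.sum_ite_eq', Finset.mem_univ, if_true, u]
      have h3 : ∑ ρ, ∑ τ, (if ρ = μ then mink τ * g.inn (P.cov Y (E ν)) (E τ) y *
          g.inn (P.cov (E ρ) X) (E τ) y else 0) =
          ∑ τ, mink τ * g.inn (P.cov Y (E ν)) (E τ) y * g.inn (P.cov (E μ) X) (E τ) y := by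
        rw [Finset.sum_comm]
        simp only [Finset.sum_ite_eq', Finset.mem_univ, if_true]
      rw [h3, add_comm (∑ ρ, _) (∑ ρ, mink ρ * g.inn X (E ρ) y * _), add_assoc]
      refine congrArg₂ (· + ·) (Finset.sum_congr rfl fun ρ _ => by ring)
        (congrArg₂ (· + ·) rfl (Finset.sum_congr rfl fun ρ _ => by ring))

end SpinStructure

end

section

variable {M : Type*} [TopologicalSpace M] [ChartedSpace E4 M] [IsManifold (𝓡 4) ∞ M]

/-! ### Local transitivity -/

theorem SpinorForm.nondegenerate (Ω : SpinorForm) : LinearMap.BilinForm.Nondegenerate Ω.form :=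
  ⟨fun s h => Ω.nondeg s h, fun s h => Ω.nondeg s fun t => by rw [Ω.neg, h, neg_zero]⟩

/-- A map sending a subspace of dimension more than half into its symplectic complement has a
kernel there. -/
theorem SpinorForm.exists_mem_ker (Ω : SpinorForm) {W : Submodule ℝ Spinor}
    (hW : 2 < Module.finrank ℝ W) (L : Module.End ℝ Spinor)
    (hL : ∀ s ∈ W, ∀ t ∈ W, Ω.form s (L t) = 0) : ∃ t, t ≠ 0 ∧ L t = 0 := by
  by_contra! hc
  have hinj : Function.Injective L := (injective_iff_map_eq_zero L).2 fun t ht => by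
    by_contra h0
    exact hc t h0 ht
  -- If L were injective, its image of W would have dimension dim W > 2 inside a complement of
  -- dimension 4 − dim W < 2.
  have h1 : W.map L ≤ LinearMap.BilinForm.orthogonal Ω.form W := by
    rintro _ ⟨t, ht, rfl⟩ s hs
    exact hL s hs t ht
  have h2 := Submodule.finrank_mono h1
  have h3 : Module.finrank ℝ (W.map L) = Module.finrank ℝ W :=
    (Submodule.equivMapOfInjective L hinj W).finrank_eq.symm
  have h4 := LinearMap.BilinForm.finrank_orthogonal Ω.nondegenerate W
  have h5 : Module.finrank ℝ Spinor = 4 := by simp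
  omega

theorem etaM_eq (v w : Fin 4 → ℝ) : etaM v w = v 0 * w 0 - v 1 * w 1 - v 2 * w 2 - v 3 * w 3 := by
  simp [etaM, Fin.sum_univ_four, mink]
  ring

/-- Orthogonal null vectors are proportional. -/
theorem etaM_null_proportional {v w : Fin 4 → ℝ} (hv : etaM v v = 0) (hw : etaM w w = 0)
    (hvw : etaM v w = 0) (μ : Fin 4) : v 0 * w μ = w 0 * v μ := by
  rw [etaM_eq] at *
  -- The squared Euclidean length of the spatial part of v₀w − w₀v, which vanishes when v and w are
  -- null and orthogonal.
  have h : (v 0 * w 1 - w 0 * v 1) ^ 2 + (v 0 * w 2 - w 0 * v 2) ^ 2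
      + (v 0 * w 3 - w 0 * v 3) ^ 2 = 0 := by
    linear_combination (-(v 0) ^ 2) * hw - (w 0) ^ 2 * hv + 2 * v 0 * w 0 * hvw
  have hsq : ∀ {p q r : ℝ}, p ^ 2 + q ^ 2 + r ^ 2 = 0 → p = 0 ∧ q = 0 ∧ r = 0 := fun {p q r} h =>
    ⟨by nlinarith [sq_nonneg p, sq_nonneg q, sq_nonneg r],
      by nlinarith [sq_nonneg p, sq_nonneg q, sq_nonneg r],
      by nlinarith [sq_nonneg p, sq_nonneg q, sq_nonneg r]⟩
  obtain ⟨h1, h2, h3⟩ := hsq h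
  fin_cases μ <;> simp <;> linarith

theorem etaM_null_zero {v : Fin 4 → ℝ} (hv : etaM v v = 0) (h0 : v 0 = 0) : v = 0 := by
  rw [etaM_eq, h0] at hv
  ext μ
  fin_cases μ <;> simp
  · exact h0
  all_goals nlinarith [sq_nonneg (v 1), sq_nonneg (v 2), sq_nonneg (v 3)]

theorem exists_spacelike_orthogonal (v : Fin 4 → ℝ) :
    ∃ u : Fin 4 → ℝ, etaM u u ≠ 0 ∧ etaM v u = 0 := by
  by_cases h : v 1 ^ 2 + v 2 ^ 2 = 0
  · have h1 : v 1 = 0 := by nlinarith [sq_nonneg (v 1), sq_nonneg (v 2)]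
    exact ⟨![0, 1, 0, 0], by simp [etaM_eq], by simp [etaM_eq, h1]⟩
  · refine ⟨![0, v 2, -v 1, 0], fun h' => h ?_, by simp [etaM_eq]; ring⟩
    simp [etaM_eq] at h'
    linarith

namespace SpinStructure
variable {g : LorentzMetric M} {Ω : SpinorForm} {ι : Type*} (P : SpinStructure g Ω ι)

/-- The Dirac current of a spinor is null. -/
theorem val_kappa_self (x : M) (s : Spinor) :
    g.val x (P.kappa x s s) (P.kappa x s s) = 0 := by
  obtain ⟨c, -, hc⟩ := Ω.exists_eq
  have h : ∀ μ, g.cmp (fun μ => P.e x μ x) (P.kappa x s s) μ = mink μ * Ω.form s (gamma μ s) :=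
    fun μ => by rw [LorentzMetric.cmp, val_kappa, cliff_e]
  rw [(P.isONFrame_e x).val_eq, etaM_eq, h, h, h, h]
  simp [mink, hc, gamma_zero_apply, gamma_one_apply, gamma_two_apply, gamma_three_apply]
  ring

/-- Clifford multiplication by v sends W into its symplectic complement, so it kills some t ≠ 0;
then 0 = v·v·t = −g(v, v) t. -/
theorem null_of_form_cliff {x : M} {W : Submodule ℝ Spinor} (hW : 2 < Module.finrank ℝ W)
    {v : T x} (hv : ∀ s ∈ W, ∀ t ∈ W, Ω.form s (P.cliff x v t) = 0) : g.val x v v = 0 := by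
  obtain ⟨t, ht, h⟩ := Ω.exists_mem_ker hW (P.cliff x v) hv
  have h' := P.cliff_swap x v v t
  rw [h, map_zero, neg_zero, zero_sub, zero_eq_neg] at h'
  have := (smul_eq_zero.1 h').resolve_right ht
  linarith

/-- The Dirac currents of a space of spinors of more than half the dimension span the tangent
space. -/
theorem eq_top_of_kappa_mem {x : M} {W : Submodule ℝ Spinor} (hW : 2 < Module.finrank ℝ W)
    {V : Submodule ℝ (T x)} (hV : ∀ s ∈ W, ∀ t ∈ W, P.kappa x s t ∈ V) : V = ⊤ := by
  by_contra hne
  have hf := P.isONFrame_e x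
  -- A proper subspace lies in the kernel of a nonzero covector; v is its metric dual.
  obtain ⟨v, hv0, hv⟩ : ∃ v : T x, v ≠ 0 ∧ ∀ w ∈ V, g.val x w v = 0 := by
    obtain ⟨f, hf0, hfV⟩ := Submodule.exists_le_ker_of_lt_top V (lt_top_iff_ne_top.2 hne)
    have hv : ∀ w, g.val x w (∑ μ, (mink μ * f (P.e x μ x)) • P.e x μ x) = f w := fun w => by
      conv_rhs => rw [← hf.sum_cmp w, map_sum]
      simp only [map_sum, map_smul, smul_eq_mul, LorentzMetric.cmp]
      exact Finset.sum_congr rfl fun μ _ => by ring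
    refine ⟨_, fun h => hf0 (LinearMap.ext fun w => ?_), fun w hw => (hv w).trans (hfV hw)⟩
    rw [← hv w, h, map_zero, LinearMap.zero_apply]
  have hn := P.null_of_form_cliff hW fun s hs t ht => by
    rw [← val_kappa]; exact hv _ (hV s hs t ht)
  rw [hf.val_eq] at hn
  have hv00 : g.cmp (fun μ => P.e x μ x) v 0 ≠ 0 := fun h => hv0 <| hf.ext fun μ => by
    rw [etaM_null_zero hn h, LorentzMetric.cmp_zero]; rfl
  obtain ⟨u', hu, hvu⟩ := exists_spacelike_orthogonal (g.cmp (fun μ => P.e x μ x) v)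
  obtain ⟨u, rfl⟩ : ∃ u : T x, g.cmp (fun μ => P.e x μ x) u = u' := by
    refine ⟨∑ μ, u' μ • P.e x μ x, funext fun ν => ?_⟩
    simp [LorentzMetric.cmp_sum, hf.cmp_self]
  -- κ(s, s) is null and orthogonal to the null vector v, hence proportional to v, and u ⊥ v.
  have hself : ∀ s ∈ W, g.val x (P.kappa x s s) u = 0 := fun s hs => by
    have h1 := P.val_kappa_self x s
    have h2 := hv _ (hV s hs s hs)
    rw [g.symm] at h2
    rw [hf.val_eq] at h1 h2 ⊢
    have h3 := etaM_null_proportional hn h1 h2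
    refine (mul_eq_zero.1 (?_ : g.cmp (fun μ => P.e x μ x) v 0 * _ = 0)).resolve_left hv00
    rw [etaM_eq] at hvu ⊢
    linear_combination g.cmp (fun μ => P.e x μ x) (P.kappa x s s) 0 * hvu
      - g.cmp (fun μ => P.e x μ x) u 1 * h3 1
      - g.cmp (fun μ => P.e x μ x) u 2 * h3 2 - g.cmp (fun μ => P.e x μ x) u 3 * h3 3
  -- By polarisation u is orthogonal to all currents, so the argument that made v null also makes u
  -- null.
  refine hu (hf.val_eq u u ▸ P.null_of_form_cliff hW fun s hs t ht => ?_)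
  have h := hself (s + t) (W.add_mem hs ht)
  simp only [map_add, LinearMap.add_apply, _root_.add_apply, hself s hs, hself t ht,
    P.kappa_symm x t s] at h
  rw [← val_kappa]
  linarith

variable [T2Space M]

/-- Evaluation of Killing spinors is injective at every point, so dim S' does not depend on the
point; this spreads a hypothesis at `o` over all of M. -/
theorem finrank_S' [ConnectedSpace M] (Φ : Fields M) (p : M) :
    Module.finrank ℝ (S' P Φ p) = Module.finrank ℝ (k1 P Φ) := by
  have h : Function.Injective ((P.evalSpinor p).comp (k1 P Φ).subtype) :=
    (injective_iff_map_eq_zero _).2 fun ε hε => Subtype.ext (P.eq_zero_of_mem_k1 ε.2 hε)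
  rw [← LinearMap.finrank_range_of_inj h, LinearMap.range_comp, Submodule.range_subtype]
  rfl

theorem V'_eq_top [ConnectedSpace M] {Φ : Fields M} {o : M}
    (ho : 2 < Module.finrank ℝ (S' P Φ o)) (p : M) : V' g Φ p = ⊤ := by
  rw [P.finrank_S' Φ o, ← P.finrank_S' Φ p] at ho
  refine P.eq_top_of_kappa_mem ho ?_
  rintro _ ⟨ε, hε, rfl⟩ _ ⟨ε', hε', rfl⟩
  exact ⟨_, curr_mem_k0 hε hε', rfl⟩

end SpinStructure

end

section

/-! ### Generalities on Lie superalgebras -/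

section Super

theorem zmod_two_cases (p : ZMod 2) : p = 0 ∨ p = 1 := by
  fin_cases p
  · exact Or.inl rfl
  · exact Or.inr rfl

theorem superSign_zero_left (j : ZMod 2) : superSign 0 j = 1 := by simp [superSign]

theorem superSign_zero_right (i : ZMod 2) : superSign i 0 = 1 := by simp [superSign]

theorem superSign_one_one : superSign 1 1 = -1 := by simp [superSign]

theorem isInternal_of_isCompl {L : Type*} [AddCommGroup L] [Module ℝ L]
    {par : ZMod 2 → Submodule ℝ L} (h : IsCompl (par 0) (par 1)) : DirectSum.IsInternal par :=
  (DirectSum.isInternal_submodule_iff_isCompl par (i := 0) (j := 1) (by decide) (by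
    ext p
    simpa using zmod_two_cases p)).2 h

/-- A Lie superalgebra structure can be pulled back along an injective even map. -/
theorem IsLieSuperalgebra.of_injective {L L' : Type*} [AddCommGroup L] [Module ℝ L]
    [AddCommGroup L'] [Module ℝ L'] {par : ZMod 2 → Submodule ℝ L} {br : L →ₗ[ℝ] L →ₗ[ℝ] L}
    {par' : ZMod 2 → Submodule ℝ L'} {br' : L' →ₗ[ℝ] L' →ₗ[ℝ] L'} (h : IsLieSuperalgebra par' br')
    (f : L →ₗ[ℝ] L') (hf : Function.Injective f) (hpar : ∀ p x, x ∈ par p ↔ f x ∈ par' p)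
    (hbr : ∀ x y, f (br x y) = br' (f x) (f y)) (hint : DirectSum.IsInternal par) :
    IsLieSuperalgebra par br where
  internal := hint
  bracket_mem i j x y hx hy := by
    rw [hpar] at *
    rw [hbr]
    exact h.bracket_mem i j _ _ hx hy
  skew i j x y hx hy := hf <| by
    rw [hpar] at hx hy
    rw [map_neg, map_smul, hbr, hbr]
    exact h.skew i j _ _ hx hy
  jacobi i j x y z hx hy := hf <| by
    rw [hpar] at hx hy
    simp only [map_add, map_smul, hbr]
    exact h.jacobi i j _ _ _ hx hy

/-- Restricting a bilinear map to a subspace closed under it. -/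
theorem exists_bilinear_restriction {L L' : Type*} [AddCommGroup L] [Module ℝ L]
    [AddCommGroup L'] [Module ℝ L'] {br' : L' →ₗ[ℝ] L' →ₗ[ℝ] L'} {f : L →ₗ[ℝ] L'}
    (hf : Function.Injective f) (h : ∀ x y, ∃ z, f z = br' (f x) (f y)) :
    ∃ br : L →ₗ[ℝ] L →ₗ[ℝ] L, ∀ x y, f (br x y) = br' (f x) (f y) := by
  choose b hb using h
  exact ⟨LinearMap.mk₂ ℝ b (fun x x' y => hf (by simp [hb])) (fun c x y => hf (by simp [hb]))
    (fun x y y' => hf (by simp [hb])) (fun c x y => hf (by simp [hb])), hb⟩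

/-! ### The super Jacobi identity in components -/

section Product
variable {L₀ L₁ : Type*} [AddCommGroup L₀] [Module ℝ L₀] [AddCommGroup L₁] [Module ℝ L₁]
  (B : L₀ →ₗ[ℝ] L₀ →ₗ[ℝ] L₀) (L : L₀ →ₗ[ℝ] L₁ →ₗ[ℝ] L₁) (C : L₁ →ₗ[ℝ] L₁ →ₗ[ℝ] L₀)

/-- The bracket on `L₀ ⊕ L₁` with components `B`, `L` and `C`. -/
def superBracket : L₀ × L₁ →ₗ[ℝ] L₀ × L₁ →ₗ[ℝ] L₀ × L₁ :=
  LinearMap.mk₂ ℝ (fun x y => (B x.1 y.1 + C x.2 y.2, L x.1 y.2 - L y.1 x.2))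
    (fun x x' y => Prod.ext (by simp; abel) (by simp; abel))
    (fun c x y => Prod.ext (by simp) (by simp [smul_sub]))
    (fun x y y' => Prod.ext (by simp; abel) (by simp; abel))
    (fun c x y => Prod.ext (by simp) (by simp [smul_sub]))

theorem superBracket_apply (x y : L₀ × L₁) :
    superBracket B L C x y = (B x.1 y.1 + C x.2 y.2, L x.1 y.2 - L y.1 x.2) := rfl

/-- The super Jacobi identity in terms of the components of the bracket. -/
theorem isLieSuperalgebra_superBracket (par : ZMod 2 → Submodule ℝ (L₀ × L₁))
    (h0 : par 0 = Submodule.prod ⊤ ⊥) (h1 : par 1 = Submodule.prod ⊥ ⊤)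
    (hB : ∀ x y, B x y = -B y x) (hBB : ∀ x y z, B x (B y z) = B (B x y) z + B y (B x z))
    (hL : ∀ x y s, L (B x y) s = L x (L y s) - L y (L x s)) (hC : ∀ s t, C s t = C t s)
    (hBC : ∀ x s t, B x (C s t) = C (L x s) t + C s (L x t)) (hLC : ∀ s, L (C s s) s = 0) :
    IsLieSuperalgebra par (superBracket B L C) := by
  have m0 : ∀ {x : L₀ × L₁}, x ∈ par 0 → ∃ a, x = (a, 0) := by
    rintro ⟨a, s⟩ h
    rw [h0] at h
    exact ⟨a, Prod.ext rfl ((Submodule.mem_bot ℝ).1 h.2)⟩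
  have m1 : ∀ {x : L₀ × L₁}, x ∈ par 1 → ∃ s, x = (0, s) := by
    rintro ⟨a, s⟩ h
    rw [h1] at h
    exact ⟨s, Prod.ext ((Submodule.mem_bot ℝ).1 h.1) rfl⟩
  have e0 : ∀ a, (a, 0) ∈ par 0 := fun a => by rw [h0]; exact ⟨trivial, rfl⟩
  have e1 : ∀ s, (0, s) ∈ par 1 := fun a => by rw [h1]; exact ⟨rfl, trivial⟩
  -- Full polarisation of the cubic map s ↦ L(C s s)s: half the difference of its values at s + t
  -- and s − t is the part linear in t, which is then polarised in s.
  have hcyc : ∀ s t u, L (C s t) u + L (C s u) t + L (C t u) s = 0 := fun s t u => by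
    have h2 : ∀ s t, L (C s s) t + (2 : ℝ) • L (C s t) s = 0 := fun s t => by
      have k1 := hLC (s + t)
      have k2 := hLC (s - t)
      simp only [map_add, map_sub, LinearMap.add_apply, LinearMap.sub_apply, hC t s, hLC] at k1 k2
      linear_combination (norm := module) (2⁻¹ : ℝ) • k1 - (2⁻¹ : ℝ) • k2
    have k := h2 (s + t) u
    simp only [map_add, LinearMap.add_apply, hC t s] at k
    linear_combination (norm := module)
      (2⁻¹ : ℝ) • k - (2⁻¹ : ℝ) • h2 s u - (2⁻¹ : ℝ) • h2 t u
  refine ⟨isInternal_of_isCompl ?_, ?_, ?_, ?_⟩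
  · rw [h0, h1]
    refine ⟨Submodule.disjoint_def.2 ?_, codisjoint_iff_le_sup.2 ?_⟩
    · rintro ⟨a, s⟩ h h'
      exact Prod.ext ((Submodule.mem_bot ℝ).1 h'.1) ((Submodule.mem_bot ℝ).1 h.2)
    · rintro ⟨a, s⟩ -
      exact Submodule.mem_sup.2 ⟨(a, 0), ⟨trivial, rfl⟩, (0, s), ⟨rfl, trivial⟩, by simp⟩
  · intro i j x y hx hy
    rcases zmod_two_cases i with rfl | rfl <;> rcases zmod_two_cases j with rfl | rfl
    · obtain ⟨a, rfl⟩ := m0 hx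
      obtain ⟨b, rfl⟩ := m0 hy
      simpa [superBracket_apply] using e0 _
    · obtain ⟨a, rfl⟩ := m0 hx
      obtain ⟨b, rfl⟩ := m1 hy
      simpa [superBracket_apply] using e1 _
    · obtain ⟨a, rfl⟩ := m1 hx
      obtain ⟨b, rfl⟩ := m0 hy
      have := e1 (-L b a)
      simpa [superBracket_apply] using this
    · obtain ⟨a, rfl⟩ := m1 hx
      obtain ⟨b, rfl⟩ := m1 hy
      have := e0 (C a b)
      rw [show (1 + 1 : ZMod 2) = 0 from rfl]
      simpa [superBracket_apply] using this
  · intro i j x y hx hy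
    rcases zmod_two_cases i with rfl | rfl <;> rcases zmod_two_cases j with rfl | rfl
    · obtain ⟨a, rfl⟩ := m0 hx
      obtain ⟨b, rfl⟩ := m0 hy
      simpa [superBracket_apply, superSign_zero_left] using hB a b
    · obtain ⟨a, rfl⟩ := m0 hx
      obtain ⟨b, rfl⟩ := m1 hy
      simp [superBracket_apply, superSign_zero_left]
    · obtain ⟨a, rfl⟩ := m1 hx
      obtain ⟨b, rfl⟩ := m0 hy
      simp [superBracket_apply, superSign_zero_right]
    · obtain ⟨a, rfl⟩ := m1 hx
      obtain ⟨b, rfl⟩ := m1 hy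
      simpa [superBracket_apply, superSign_one_one] using hC a b
  · rintro i j x y ⟨c, u⟩ hx hy
    rcases zmod_two_cases i with rfl | rfl <;> rcases zmod_two_cases j with rfl | rfl
    · obtain ⟨a, rfl⟩ := m0 hx
      obtain ⟨b, rfl⟩ := m0 hy
      simp [superBracket_apply, superSign_zero_left, hBB a b c, hL]
    · obtain ⟨a, rfl⟩ := m0 hx
      obtain ⟨s, rfl⟩ := m1 hy
      simp [superBracket_apply, superSign_zero_left, hBC, hL]
      abel
    · obtain ⟨s, rfl⟩ := m1 hx
      obtain ⟨b, rfl⟩ := m0 hy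
      simp [superBracket_apply, superSign_zero_right, hBC, hL]
      abel
    · obtain ⟨s, rfl⟩ := m1 hx
      obtain ⟨t, rfl⟩ := m1 hy
      have k := hcyc s t u
      have k' : L (C t u) s = -(L (C s t) u + L (C s u) t) := by
        rw [eq_neg_iff_add_eq_zero, ← k]; abel
      simp [superBracket_apply, superSign_one_one, hBC, hB (C s t) c, k', hC t (L c s)]

end Product

/-! ### Graded superalgebras on V ⊕ S ⊕ H -/

section Triple
variable {V S H : Type*} [AddCommGroup V] [Module ℝ V] [AddCommGroup S] [Module ℝ S]
    [AddCommGroup H] [Module ℝ H]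

theorem mem_triplePar_zero {x : V × S × H} : x ∈ triplePar V S H 0 ↔ x.2.1 = 0 := by
  simp [triplePar, Submodule.mem_prod]

theorem mem_triplePar_one {x : V × S × H} : x ∈ triplePar V S H 1 ↔ x.1 = 0 ∧ x.2.2 = 0 := by
  simp [triplePar, Submodule.mem_prod]

theorem triplePar_internal : DirectSum.IsInternal (triplePar V S H) := by
  refine isInternal_of_isCompl ⟨Submodule.disjoint_def.2 ?_, codisjoint_iff_le_sup.2 ?_⟩
  · rintro ⟨v, s, A⟩ h h'
    rw [mem_triplePar_zero] at h
    rw [mem_triplePar_one] at h'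
    exact Prod.ext h'.1 (Prod.ext h h'.2)
  · rintro ⟨v, s, A⟩ -
    exact Submodule.mem_sup.2 ⟨(v, 0, A), mem_triplePar_zero.2 rfl, (0, s, 0),
      mem_triplePar_one.2 ⟨rfl, rfl⟩, by simp⟩

variable (V S H) in
/-- The projection of `V ⊕ S ⊕ H` to its component of degree `i`. -/
def tripleProj (i : ℤ) : V × S × H →ₗ[ℝ] V × S × H :=
  if i = -2 then LinearMap.prodMap LinearMap.id 0
  else if i = -1 then LinearMap.prodMap 0 (LinearMap.prodMap LinearMap.id 0)
  else if i = 0 then LinearMap.prodMap 0 (LinearMap.prodMap 0 LinearMap.id)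
  else 0

theorem tripleProj_neg_two (x : V × S × H) : tripleProj V S H (-2) x = (x.1, 0, 0) := rfl

theorem tripleProj_neg_one (x : V × S × H) : tripleProj V S H (-1) x = (0, x.2.1, 0) := rfl

theorem tripleProj_zero (x : V × S × H) : tripleProj V S H 0 x = (0, 0, x.2.2) := rfl

theorem tripleProj_of_lt {i : ℤ} (h : i < -2) (x : V × S × H) : tripleProj V S H i x = 0 := by
  rw [tripleProj, if_neg (by omega), if_neg (by omega), if_neg (by omega), LinearMap.zero_apply]

theorem tripleProj_of_pos {i : ℤ} (h : 0 < i) (x : V × S × H) : tripleProj V S H i x = 0 := by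
  rw [tripleProj, if_neg (by omega), if_neg (by omega), if_neg (by omega), LinearMap.zero_apply]

/-- Describing the graded pieces as fixed spaces of projections treats all integers i uniformly,
including those where the piece is zero. -/
theorem mem_tripleDeg {i : ℤ} {x : V × S × H} : x ∈ tripleDeg V S H i ↔ tripleProj V S H i x = x := by
  obtain ⟨v, s, A⟩ := x
  unfold tripleDeg tripleProj
  split_ifs <;> simp [Submodule.mem_prod, eq_comm]

theorem tripleDeg_internal : DirectSum.IsInternal (tripleDeg V S H) := by
  rw [DirectSum.isInternal_submodule_iff_iSupIndep_and_iSup_eq_top]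
  constructor
  · intro i
    have hle : (⨆ j, ⨆ _ : j ≠ i, tripleDeg V S H j) ≤ LinearMap.ker (tripleProj V S H i) := by
      refine iSup₂_le fun j hj x hx => ?_
      rw [mem_tripleDeg] at hx
      rw [LinearMap.mem_ker, ← hx]
      unfold tripleProj
      split_ifs <;> simp_all
    refine Submodule.disjoint_def.2 fun x hx hx' => ?_
    rw [mem_tripleDeg] at hx
    rw [← hx]
    exact hle hx'
  · refine eq_top_iff.2 ?_
    rintro ⟨v, s, A⟩ -
    have h : (v, s, A) = (v, 0, 0) + (0, s, 0) + (0, 0, A) := by simp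
    rw [h]
    exact add_mem (add_mem (Submodule.mem_iSup_of_mem (-2) (mem_tripleDeg.2 rfl))
      (Submodule.mem_iSup_of_mem (-1) (mem_tripleDeg.2 rfl)))
      (Submodule.mem_iSup_of_mem 0 (mem_tripleDeg.2 rfl))

theorem tripleDeg_le_triplePar (i : ℤ) : tripleDeg V S H i ≤ triplePar V S H (i : ZMod 2) := by
  unfold tripleDeg
  split_ifs with h1 h2 h3
  · subst h1
    rintro x ⟨-, hx⟩
    rw [show (((-2 : ℤ)) : ZMod 2) = 0 from rfl, mem_triplePar_zero]
    rw [(Submodule.mem_bot ℝ).1 hx]; rfl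
  · subst h2
    rintro x ⟨hx, -, hx'⟩
    rw [show (((-1 : ℤ)) : ZMod 2) = 1 from rfl, mem_triplePar_one]
    exact ⟨(Submodule.mem_bot ℝ).1 hx, (Submodule.mem_bot ℝ).1 hx'⟩
  · subst h3
    rintro x ⟨-, hx, -⟩
    rw [show (((0 : ℤ)) : ZMod 2) = 0 from rfl, mem_triplePar_zero]
    exact (Submodule.mem_bot ℝ).1 hx
  · exact bot_le

/-- The Poincaré-type bracket on `V ⊕ S ⊕ H` built from actions `a`, `r` of a Lie algebra `(H, c)` on
`V` and `S` and an equivariant symmetric map `k : S × S → V`. -/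
theorem isGradedLieSuperalgebra_triple {a : H → V →ₗ[ℝ] V} {r : H → S →ₗ[ℝ] S}
    {k : S →ₗ[ℝ] S →ₗ[ℝ] V} {c : H → H → H} {br : V × S × H →ₗ[ℝ] V × S × H →ₗ[ℝ] V × S × H}
    (hbr : ∀ x y, br x y = (a x.2.2 y.1 - a y.2.2 x.1 + k x.2.1 y.2.1,
      r x.2.2 y.2.1 - r y.2.2 x.2.1, c x.2.2 y.2.2))
    (a0 : a 0 = 0) (r0 : r 0 = 0) (c0 : ∀ A, c 0 A = 0) (c0' : ∀ A, c A 0 = 0) (hS : ∀ A B, c A B = -c B A)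
    (hJ : ∀ A B C, c A (c B C) = c (c A B) C + c B (c A C))
    (ha : ∀ A B v, a (c A B) v = a A (a B v) - a B (a A v))
    (hr : ∀ A B s, r (c A B) s = r A (r B s) - r B (r A s))
    (hk : ∀ A s t, a A (k s t) = k (r A s) t + k s (r A t)) (hk' : ∀ s t, k s t = k t s) :
    IsGradedLieSuperalgebra (triplePar V S H) (tripleDeg V S H) br := by
  have m0 : ∀ {x}, x ∈ triplePar V S H 0 → ∃ v A, x = (v, 0, A) := by
    rintro ⟨v, s, A⟩ h
    exact ⟨v, A, Prod.ext rfl (Prod.ext (mem_triplePar_zero.1 h) rfl)⟩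
  have m1 : ∀ {x}, x ∈ triplePar V S H 1 → ∃ s, x = (0, s, 0) := by
    rintro ⟨v, s, A⟩ h
    exact ⟨s, Prod.ext (mem_triplePar_one.1 h).1 (Prod.ext rfl (mem_triplePar_one.1 h).2)⟩
  refine ⟨⟨triplePar_internal, ?_, ?_, ?_⟩, tripleDeg_internal, ?_, tripleDeg_le_triplePar⟩
  · intro i j x y hx hy
    rcases zmod_two_cases i with rfl | rfl <;> rcases zmod_two_cases j with rfl | rfl
    · obtain ⟨v, A, rfl⟩ := m0 hx
      obtain ⟨w, B, rfl⟩ := m0 hy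
      exact mem_triplePar_zero.2 (by simp [hbr])
    · obtain ⟨v, A, rfl⟩ := m0 hx
      obtain ⟨t, rfl⟩ := m1 hy
      exact mem_triplePar_one.2 (by simp [a0, r0, hbr, c0'])
    · obtain ⟨s, rfl⟩ := m1 hx
      obtain ⟨w, B, rfl⟩ := m0 hy
      exact mem_triplePar_one.2 (by simp [a0, r0, hbr, c0])
    · obtain ⟨s, rfl⟩ := m1 hx
      obtain ⟨t, rfl⟩ := m1 hy
      exact mem_triplePar_zero.2 (by simp [a0, r0, hbr])
  · intro i j x y hx hy
    rcases zmod_two_cases i with rfl | rfl <;> rcases zmod_two_cases j with rfl | rfl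
    · obtain ⟨v, A, rfl⟩ := m0 hx
      obtain ⟨w, B, rfl⟩ := m0 hy
      simpa [a0, r0, hbr, superSign_zero_left] using hS A B
    · obtain ⟨v, A, rfl⟩ := m0 hx
      obtain ⟨t, rfl⟩ := m1 hy
      simp [a0, r0, hbr, superSign_zero_left, c0, c0']
    · obtain ⟨s, rfl⟩ := m1 hx
      obtain ⟨w, B, rfl⟩ := m0 hy
      simp [a0, r0, hbr, superSign_zero_right, c0, c0']
    · obtain ⟨s, rfl⟩ := m1 hx
      obtain ⟨t, rfl⟩ := m1 hy
      simpa [a0, r0, hbr, superSign_one_one, c0] using hk' s t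
  · rintro i j x y ⟨u, q, C⟩ hx hy
    rcases zmod_two_cases i with rfl | rfl <;> rcases zmod_two_cases j with rfl | rfl
    · obtain ⟨v, A, rfl⟩ := m0 hx
      obtain ⟨w, B, rfl⟩ := m0 hy
      simp only [hbr, superSign_zero_left, one_smul]
      refine Prod.ext ?_ (Prod.ext ?_ (hJ A B C))
      · simp [ha]
        abel
      · simp [hr]
    · obtain ⟨v, A, rfl⟩ := m0 hx
      obtain ⟨t, rfl⟩ := m1 hy
      simp only [hbr, superSign_zero_left, one_smul]
      refine Prod.ext ?_ (Prod.ext ?_ ?_)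
      · simp [a0, r0, hk, c0, c0']
      · simp [a0, r0, hr]
        abel
      · simp [a0, r0, c0, c0']
    · obtain ⟨s, rfl⟩ := m1 hx
      obtain ⟨w, B, rfl⟩ := m0 hy
      simp only [hbr, superSign_zero_right, one_smul]
      refine Prod.ext ?_ (Prod.ext ?_ ?_)
      · simp [a0, r0, hk, c0]
      · simp [a0, r0, hr]
        abel
      · simp [a0, r0, c0, c0']
    · obtain ⟨s, rfl⟩ := m1 hx
      obtain ⟨t, rfl⟩ := m1 hy
      simp only [hbr, superSign_one_one]
      refine Prod.ext ?_ (Prod.ext ?_ ?_)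
      · simp [a0, r0, hk, c0, hk' t]
      · simp [a0, r0, c0]
      · simp [a0, r0, c0]
  · intro i j x y hx hy
    rw [mem_tripleDeg] at hx hy ⊢
    rcases lt_or_ge i (-2) with hi | hi
    · rw [← hx, tripleProj_of_lt hi, map_zero, LinearMap.zero_apply, map_zero]
    rcases lt_or_ge 0 i with hi' | hi'
    · rw [← hx, tripleProj_of_pos hi', map_zero, LinearMap.zero_apply, map_zero]
    rcases lt_or_ge j (-2) with hj | hj
    · rw [← hy, tripleProj_of_lt hj, map_zero, map_zero]
    rcases lt_or_ge 0 j with hj' | hj'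
    · rw [← hy, tripleProj_of_pos hj', map_zero, map_zero]
    rw [← hx, ← hy, hbr]
    obtain rfl | rfl | rfl : i = -2 ∨ i = -1 ∨ i = 0 := by omega
    all_goals obtain rfl | rfl | rfl : j = -2 ∨ j = -1 ∨ j = 0 := by omega
    all_goals simp [a0, r0, tripleProj, c0, c0', Prod.ext_iff]

section Incl
variable {V₁ S₁ H₁ : Type*} [AddCommGroup V₁] [Module ℝ V₁] [AddCommGroup S₁] [Module ℝ S₁]
    [AddCommGroup H₁] [Module ℝ H₁] (iV : V₁ →ₗ[ℝ] V) (iS : S₁ →ₗ[ℝ] S) (iH : H₁ →ₗ[ℝ] H)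

theorem prodMap_tripleProj (i : ℤ) (x : V₁ × S₁ × H₁) :
    iV.prodMap (iS.prodMap iH) (tripleProj V₁ S₁ H₁ i x) =
      tripleProj V S H i (iV.prodMap (iS.prodMap iH) x) := by
  unfold tripleProj
  split_ifs <;> simp

variable {iV iS iH}

theorem prodMap_mem_triplePar (hV : Function.Injective iV) (hS : Function.Injective iS)
    (hH : Function.Injective iH) (p : ZMod 2) (x : V₁ × S₁ × H₁) :
    x ∈ triplePar V₁ S₁ H₁ p ↔ iV.prodMap (iS.prodMap iH) x ∈ triplePar V S H p := by
  rcases zmod_two_cases p with rfl | rfl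
  · rw [mem_triplePar_zero, mem_triplePar_zero]
    exact (map_eq_zero_iff iS hS).symm
  · rw [mem_triplePar_one, mem_triplePar_one]
    exact and_congr (map_eq_zero_iff iV hV).symm (map_eq_zero_iff iH hH).symm

theorem prodMap_injective (hV : Function.Injective iV) (hS : Function.Injective iS)
    (hH : Function.Injective iH) : Function.Injective (iV.prodMap (iS.prodMap iH)) :=
  hV.prodMap (hS.prodMap hH)

theorem prodMap_mem_tripleDeg (hV : Function.Injective iV) (hS : Function.Injective iS)
    (hH : Function.Injective iH) (i : ℤ) (x : V₁ × S₁ × H₁) :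
    x ∈ tripleDeg V₁ S₁ H₁ i ↔ iV.prodMap (iS.prodMap iH) x ∈ tripleDeg V S H i := by
  rw [mem_tripleDeg, mem_tripleDeg, ← prodMap_tripleProj, (prodMap_injective hV hS hH).eq_iff]

theorem IsGradedLieSuperalgebra.of_prodMap {br : V × S × H →ₗ[ℝ] V × S × H →ₗ[ℝ] V × S × H}
    (h : IsGradedLieSuperalgebra (triplePar V S H) (tripleDeg V S H) br)
    (hV : Function.Injective iV) (hS : Function.Injective iS) (hH : Function.Injective iH)
    {br₁ : V₁ × S₁ × H₁ →ₗ[ℝ] V₁ × S₁ × H₁ →ₗ[ℝ] V₁ × S₁ × H₁}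
    (hbr : ∀ x y, iV.prodMap (iS.prodMap iH) (br₁ x y) =
      br (iV.prodMap (iS.prodMap iH) x) (iV.prodMap (iS.prodMap iH) y)) :
    IsGradedLieSuperalgebra (triplePar V₁ S₁ H₁) (tripleDeg V₁ S₁ H₁) br₁ :=
  { h.toIsLieSuperalgebra.of_injective _ (prodMap_injective hV hS hH)
      (prodMap_mem_triplePar hV hS hH) hbr triplePar_internal with
    deg_internal := tripleDeg_internal
    deg_bracket_mem := fun i j x y hx hy => by
      rw [prodMap_mem_tripleDeg hV hS hH] at *
      rw [hbr]
      exact h.deg_bracket_mem i j _ _ hx hy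
    deg_le_par := tripleDeg_le_triplePar }

end Incl

end Triple

/-- The pieces of an associated graded space, identified through maps with the right kernels. -/
theorem exists_gr_equiv {L L' N : Type*} [AddCommGroup L] [Module ℝ L] [AddCommGroup L']
    [Module ℝ L'] [AddCommGroup N] [Module ℝ N] {F : ℤ → Submodule ℝ L} {i : ℤ} (φ : L →ₗ[ℝ] N)
    {f : L' →ₗ[ℝ] N} (hf : Function.Injective f) (D : Submodule ℝ L')
    (hker : ∀ x ∈ F i, φ x = 0 ↔ x ∈ F (i + 1)) (hmem : ∀ x ∈ F i, ∃ y ∈ D, f y = φ x)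
    (hsurj : ∀ y ∈ D, ∃ x ∈ F i, φ x = f y) :
    ∃ e : Gr F i ≃ₗ[ℝ] D, ∀ x hx, f (e (Gr.mk F i x hx)) = φ x := by
  let ψ : F i →ₗ[ℝ] D.map f := (φ.comp (F i).subtype).codRestrict _ fun x => hmem x.1 x.2
  have hψ : Function.Surjective ψ := by
    rintro ⟨_, y, hy, rfl⟩
    obtain ⟨x, hx, h⟩ := hsurj y hy
    exact ⟨⟨x, hx⟩, Subtype.ext h⟩
  -- The map from F i onto the image of D has kernel F (i + 1), so the first isomorphism theorem
  -- applies.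
  have hk : (F (i + 1)).submoduleOf (F i) = LinearMap.ker ψ := by
    ext x
    rw [LinearMap.mem_ker, ← Submodule.coe_eq_zero]
    exact (hker x.1 x.2).symm
  let e := (Submodule.quotEquivOfEq _ _ hk).trans (ψ.quotKerEquivOfSurjective hψ)
  refine ⟨e.trans (Submodule.equivMapOfInjective f hf D).symm, fun x hx => ?_⟩
  have h := congrArg Subtype.val
    ((Submodule.equivMapOfInjective f hf D).apply_symm_apply (e (Gr.mk F i x hx)))
  rw [Submodule.coe_equivMapOfInjective_apply] at h
  exact h

end Super

end

section

variable {M : Type*} [TopologicalSpace M] [ChartedSpace E4 M] [IsManifold (𝓡 4) ∞ M]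

/-! ### The Killing superalgebra -/

section
variable {g : LorentzMetric M} {Ω : SpinorForm} {ι : Type*} (P : SpinStructure g Ω ι) (Φ : Fields M)
variable [T2Space M]

theorem aMap_mem_so {X : VField M} (hX : X ∈ k0 g Φ) (x : M) : P.aMap X x ∈ g.so x :=
  P.isKilling_iff_aMap.1 (mem_k0_iff.1 hX).1 x

/-- The commutator of infinitesimal automorphisms. -/
def kEvenEven : k0 g Φ →ₗ[ℝ] k0 g Φ →ₗ[ℝ] k0 g Φ :=
  LinearMap.mk₂ ℝ (fun X Y => ⟨lieV X.1 Y.1, lieV_mem_k0 X.2 Y.2⟩)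
    (fun X X' Y => Subtype.ext (lieV_add_left _ _ _))
    (fun c X Y => Subtype.ext (ContMDiffSection.ext fun x => by
      change lieV (c • X.1) Y.1 x = c • lieV X.1 Y.1 x
      rw [P.lieV_eq_aMap, P.lieV_eq_aMap, P.aMap_smul, ContMDiffSection.coe_smul, Pi.smul_apply,
        map_smul, LinearMap.smul_apply, smul_sub]))
    (fun X Y Y' => Subtype.ext (lieV_add_right _ _ _))
    (fun c X Y => Subtype.ext (ContMDiffSection.ext fun x => by
      change lieV X.1 (c • Y.1) x = c • lieV X.1 Y.1 x
      rw [P.lieV_eq_aMap, P.lieV_eq_aMap, P.aMap_smul, ContMDiffSection.coe_smul, Pi.smul_apply,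
        map_smul, LinearMap.smul_apply, smul_sub]))

/-- The action of infinitesimal automorphisms on Killing spinors. -/
def kEvenOdd : k0 g Φ →ₗ[ℝ] k1 P Φ →ₗ[ℝ] k1 P Φ :=
  LinearMap.mk₂ ℝ (fun X ε => ⟨P.sLie (mem_k0_iff.1 X.2).1 ε.1, P.sLie_mem_k1 X.2 ε.2⟩)
    (fun X X' ε => Subtype.ext (SpinStructure.SpinorField.ext fun x => by
      change P.spinNabla ε.1 x (X.1 x + X'.1 x) + P.sigma x (P.aMap (X.1 + X'.1 : VField M) x) _ =
        (P.spinNabla ε.1 x (X.1 x) + P.sigma x (P.aMap X.1 x) _)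
          + (P.spinNabla ε.1 x (X'.1 x) + P.sigma x (P.aMap X'.1 x) _)
      rw [P.spinNabla_add_vec, P.aMap_add, map_add, LinearMap.add_apply]
      abel))
    (fun c X ε => Subtype.ext (SpinStructure.SpinorField.ext fun x => by
      change P.spinNabla ε.1 x (c • X.1 x) + P.sigma x (P.aMap (c • X.1 : VField M) x) _ =
        c • (P.spinNabla ε.1 x (X.1 x) + P.sigma x (P.aMap X.1 x) _)
      rw [P.spinNabla_smul_vec, P.aMap_smul, map_smul, LinearMap.smul_apply, smul_add]))
    (fun X ε ε' => Subtype.ext (P.sLie_add _ _ (mem_k0_iff.1 X.2).1))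
    (fun c X ε => Subtype.ext (SpinStructure.SpinorField.ext fun x => by
      change P.spinNabla (c • ε.1) x (X.1 x) + P.sigma x (P.aMap X.1 x) (P.evalSpinor x (c • ε.1)) =
        c • (P.spinNabla ε.1 x (X.1 x) + P.sigma x (P.aMap X.1 x) (P.evalSpinor x ε.1))
      rw [P.spinNabla_smul, map_smul, map_smul, smul_add]))

/-- The Dirac current of Killing spinors. -/
def kOddOdd : k1 P Φ →ₗ[ℝ] k1 P Φ →ₗ[ℝ] k0 g Φ :=
  LinearMap.mk₂ ℝ (fun ε ε' => ⟨P.curr ε.1 ε'.1, SpinStructure.curr_mem_k0 ε.2 ε'.2⟩)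
    (fun _ _ _ => Subtype.ext (ContMDiffSection.ext fun x => LinearMap.map_add₂ (P.kappa x) _ _ _))
    (fun _ _ _ => Subtype.ext (ContMDiffSection.ext fun x => LinearMap.map_smul₂ (P.kappa x) _ _ _))
    (fun _ _ _ => Subtype.ext (ContMDiffSection.ext fun x => map_add (P.kappa x _) _ _))
    (fun _ _ _ => Subtype.ext (ContMDiffSection.ext fun x => map_smul (P.kappa x _) _ _))

/-- The bracket of the Killing superalgebra. -/
def killingBracket : K P Φ →ₗ[ℝ] K P Φ →ₗ[ℝ] K P Φ :=
  superBracket (kEvenEven P Φ) (kEvenOdd P Φ) (kOddOdd P Φ)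

theorem isKillingBracket_killingBracket : IsKillingBracket P Φ (killingBracket P Φ) where
  even_even X Y := by
    constructor
    · simp [killingBracket, superBracket_apply]
    · intro x
      change lieV X.1 Y.1 x + (kOddOdd P Φ 0 0).1 x = lieV X.1 Y.1 x
      rw [map_zero]
      exact add_zero _
  even_odd X ε := by
    constructor
    · simp [killingBracket, superBracket_apply]
    · intro x
      have h : (killingBracket P Φ (X, 0) (0, ε)).2 = kEvenOdd P Φ X ε := by
        simp [killingBracket, superBracket_apply]
      rw [h]
      rfl
  odd_even X ε := by simp [killingBracket, superBracket_apply]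
  odd_odd ε ε' := by
    constructor
    · simp [killingBracket, superBracket_apply]
    · intro x
      have h : (killingBracket P Φ (0, ε) (0, ε')).1 = kOddOdd P Φ ε ε' := by
        simp [killingBracket, superBracket_apply]
      rw [h]
      rfl

/-- On Killing spinors β replaces the covariant derivative, so the Lie derivative at a point depends
only on the values there of X, A_X and ε. -/
theorem eval_sLie_of_mem_k1 {ε : P.SpinorField} (hε : ε ∈ k1 P Φ) {X : VField M}
    (hX : g.IsKilling X) (x : M) : P.evalSpinor x (P.sLie hX ε) =
      beta P Φ x (X x) (P.evalSpinor x ε) + P.sigma x (P.aMap X x) (P.evalSpinor x ε) := by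
  rw [P.eval_sLie, SpinStructure.mem_k1_iff.1 hε, P.eval_betaS]

/-- The odd-odd-odd Jacobi identity on the diagonal: pointwise it is the cubic identity, because A_κ
of the current is expressed through β. -/
theorem sLie_curr_self {ε : P.SpinorField} (hε : ε ∈ k1 P Φ) (h : g.IsKilling (P.curr ε ε)) :
    P.sLie h ε = 0 := SpinStructure.SpinorField.ext fun x => by
  rw [eval_sLie_of_mem_k1 P Φ hε, map_zero, P.curr_apply]
  refine P.beta_kappa_add_sigma Φ x _ fun v => ?_
  change -P.nabla (P.curr ε ε) x v = _
  rw [P.nabla_curr Φ hε hε]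

theorem isLieSuperalgebra_killingBracket :
    IsLieSuperalgebra (kPar P Φ) (killingBracket P Φ) := by
  refine isLieSuperalgebra_superBracket _ _ _ _ rfl rfl (fun X Y => Subtype.ext (lieV_swap _ _))
    (fun X Y Z => Subtype.ext (lieV_jacobi _ _ _)) (fun X Y ε => Subtype.ext ?_)
    (fun ε ε' => Subtype.ext (P.curr_symm _ _)) (fun X ε ε' => Subtype.ext ?_)
    (fun ε => Subtype.ext (sLie_curr_self P Φ ε.2 (P.isKilling_curr ε.2 ε.2)))
  · exact P.sLie_lieV _ (mem_k0_iff.1 X.2).1 (mem_k0_iff.1 Y.2).1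
      (mem_k0_iff.1 (lieV_mem_k0 X.2 Y.2)).1
  · exact P.lieV_curr _ _ (mem_k0_iff.1 X.2).1

/-- Evaluation at a point, `(X, ε) ↦ (X, ε, A_X)|_o`. -/
def kEval (o : M) : K P Φ →ₗ[ℝ] Poincare g o where
  toFun x := (x.1.1 o, P.evalSpinor o x.2.1, ⟨P.aMap x.1.1 o, aMap_mem_so P Φ x.1.2 o⟩)
  map_add' _ _ := Prod.ext rfl (Prod.ext rfl (Subtype.ext (P.aMap_add _ _ _)))
  map_smul' _ _ := Prod.ext rfl (Prod.ext rfl (Subtype.ext (P.aMap_smul _ _ _)))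

theorem kEval_apply (o : M) (x : K P Φ) : kEval P Φ o x =
    (x.1.1 o, P.evalSpinor o x.2.1, ⟨P.aMap x.1.1 o, aMap_mem_so P Φ x.1.2 o⟩) := rfl

theorem kEval_injective [ConnectedSpace M] (o : M) : Function.Injective (kEval P Φ o) := by
  refine (injective_iff_map_eq_zero _).2 fun x hx => ?_
  rw [kEval_apply, Prod.mk_eq_zero, Prod.mk_eq_zero] at hx
  exact Prod.ext (Subtype.ext (P.eq_zero_of_isKilling (mem_k0_iff.1 x.1.2).1 hx.1
    (congrArg Subtype.val hx.2.2))) (Subtype.ext (P.eq_zero_of_mem_k1 x.2.2 hx.2.1))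

theorem aMap_curr {ε ε' : P.SpinorField} (hε : ε ∈ k1 P Φ) (hε' : ε' ∈ k1 P Φ) (x : M) (v : T x) :
    P.aMap (P.curr ε ε') x v =
      -P.kappa x (beta P Φ x v (P.evalSpinor x ε)) (P.evalSpinor x ε')
        - P.kappa x (P.evalSpinor x ε) (beta P Φ x v (P.evalSpinor x ε')) := by
  change -P.nabla (P.curr ε ε') x v = _
  rw [P.nabla_curr Φ hε hε', neg_add']

/-- This and the next two statements compare the brackets through evaluation: they agree on the
vector part, differ by β on the spinor part, and by the curvature and the polarised γ on the
endomorphism part. -/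
theorem kEval_bracket_fst (o : M) (x y : K P Φ) : (kEval P Φ o (killingBracket P Φ x y)).1 =
    (poincareBracket P o (kEval P Φ o x) (kEval P Φ o y)).1 := by
  change (lieV x.1.1 y.1.1) o + P.curr x.2.1 y.2.1 o = _
  rw [P.lieV_eq_aMap, P.curr_apply]
  rfl

theorem kEval_bracket_snd (o : M) (x y : K P Φ) : (kEval P Φ o (killingBracket P Φ x y)).2.1 =
    (poincareBracket P o (kEval P Φ o x) (kEval P Φ o y)).2.1
      + (beta P Φ o (kEval P Φ o x).1 (kEval P Φ o y).2.1
        - beta P Φ o (kEval P Φ o y).1 (kEval P Φ o x).2.1) := by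
  change P.evalSpinor o (P.sLie (mem_k0_iff.1 x.1.2).1 y.2.1
    - P.sLie (mem_k0_iff.1 y.1.2).1 x.2.1) = _
  rw [map_sub, eval_sLie_of_mem_k1 P Φ x.2.2, eval_sLie_of_mem_k1 P Φ y.2.2]
  change _ = P.sigma o (P.aMap x.1.1 o) (P.evalSpinor o y.2.1)
    - P.sigma o (P.aMap y.1.1 o) (P.evalSpinor o x.2.1)
    + (beta P Φ o (x.1.1 o) (P.evalSpinor o y.2.1) - beta P Φ o (y.1.1 o) (P.evalSpinor o x.2.1))
  abel

theorem kEval_bracket_trd (o : M) (x y : K P Φ) (v : T o) :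
    ((kEval P Φ o (killingBracket P Φ x y)).2.2 : Module.End ℝ (T o)) v =
    ((poincareBracket P o (kEval P Φ o x) (kEval P Φ o y)).2.2 : Module.End ℝ (T o)) v
      + P.riemann o (kEval P Φ o x).1 (kEval P Φ o y).1 v
      + (-P.kappa o (beta P Φ o v (kEval P Φ o x).2.1) (kEval P Φ o y).2.1
        - P.kappa o (kEval P Φ o x).2.1 (beta P Φ o v (kEval P Φ o y).2.1)) := by
  change P.aMap (lieV x.1.1 y.1.1 + P.curr x.2.1 y.2.1 : VField M) o v = _
  rw [P.aMap_add, LinearMap.add_apply, P.aMap_lieV (mem_k0_iff.1 x.1.2).1 (mem_k0_iff.1 y.1.2).1,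
    aMap_curr P Φ x.2.2 y.2.2]
  rfl

end

end

section

variable {M : Type*} [TopologicalSpace M] [ChartedSpace E4 M] [IsManifold (𝓡 4) ∞ M]

/-! ### The Poincaré superalgebra and its graded subalgebra -/

section
variable {g : LorentzMetric M} {Ω : SpinorForm} {ι : Type*} (P : SpinStructure g Ω ι) (Φ : Fields M)

theorem poincareBracket_apply (o : M) (x y : Poincare g o) : poincareBracket P o x y =
    ((x.2.2 : Module.End ℝ (T o)) y.1 - (y.2.2 : Module.End ℝ (T o)) x.1 + P.kappa o x.2.1 y.2.1,
      P.sigma o x.2.2 y.2.1 - P.sigma o y.2.2 x.2.1, g.comm o x.2.2 y.2.2) := rfl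

theorem comm_apply (o : M) (A B : g.so o) (v : T o) : (g.comm o A B : Module.End ℝ (T o)) v =
    (A : Module.End ℝ (T o)) ((B : Module.End ℝ (T o)) v)
      - (B : Module.End ℝ (T o)) ((A : Module.End ℝ (T o)) v) := rfl

theorem sigma_comm_apply (o : M) (A B : g.so o) (s : Spinor) : P.sigma o (g.comm o A B) s =
    P.sigma o A (P.sigma o B s) - P.sigma o B (P.sigma o A s) :=
  LinearMap.congr_fun (P.sigma_comm o A B) s

theorem comm_zero_left (o : M) (A : g.so o) : g.comm o 0 A = 0 :=
  Subtype.ext (by simp [LorentzMetric.comm])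

theorem comm_zero_right (o : M) (A : g.so o) : g.comm o A 0 = 0 :=
  Subtype.ext (by simp [LorentzMetric.comm])

theorem comm_swap (o : M) (A B : g.so o) : g.comm o A B = -g.comm o B A :=
  Subtype.ext (neg_sub _ _).symm

theorem comm_jacobi (o : M) (A B C : g.so o) :
    g.comm o A (g.comm o B C) = g.comm o (g.comm o A B) C + g.comm o B (g.comm o A C) := by
  refine Subtype.ext ?_
  simp only [LorentzMetric.comm, Submodule.coe_add]
  noncomm_ring

theorem isGradedLieSuperalgebra_poincareBracket (o : M) :
    IsGradedLieSuperalgebra (triplePar (T o) Spinor (g.so o)) (tripleDeg (T o) Spinor (g.so o))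
      (poincareBracket P o) :=
  isGradedLieSuperalgebra_triple (a := fun A : g.so o => (A : Module.End ℝ (T o)))
    (r := fun A : g.so o => P.sigma o A) (k := P.kappa o) (c := g.comm o)
    (poincareBracket_apply P o) rfl (map_zero _) (comm_zero_left o) (comm_zero_right o)
    (comm_swap o) (comm_jacobi o) (comm_apply o) (sigma_comm_apply P o)
    (fun A s t => P.map_kappa A.2 s t) (P.kappa_symm o)

theorem incl_apply (o : M) (x : Alg P Φ o) : incl P Φ o x = ((x.1 : T o), (x.2.1 : Spinor), x.2.2.1) :=
  rfl

theorem incl_injective (o : M) : Function.Injective (incl P Φ o) := fun x y h => by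
  rw [incl_apply, incl_apply, Prod.mk.injEq, Prod.mk.injEq] at h
  exact Prod.ext (Subtype.ext h.1) (Prod.ext (Subtype.ext h.2.1) (Subtype.ext h.2.2))

theorem beta_zero_vec (o : M) : beta P Φ o 0 = 0 := by simp [beta]

theorem riemann_zero_left (o : M) (v : T o) : P.riemann o 0 v = 0 := by
  simp [SpinStructure.riemann]

variable [T2Space M]

-- An element of 𝔥 comes from a field ξ vanishing at `o`. In brackets with ξ the correction terms
-- carry the factor ξ(o) = 0, so the Poincaré action on values at `o` is realised inside 𝔨; the next
-- two statements use the same reason.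
variable {P Φ} in
theorem map_mem_V' {o : M} {A : g.so o} (hA : A ∈ h P Φ o) {v : T o} (hv : v ∈ V' g Φ o) :
    (A : Module.End ℝ (T o)) v ∈ V' g Φ o := by
  obtain ⟨ξ, hξ, h0, hA⟩ := hA
  obtain ⟨X, hX, rfl⟩ := hv
  refine ⟨lieV ξ X, lieV_mem_k0 hξ hX, ?_⟩
  change lieV ξ X o = (A : Module.End ℝ (T o)) (X o)
  rw [P.lieV_eq_aMap, h0, map_zero, sub_zero, hA]

variable {P Φ} in
theorem sigma_mem_S' {o : M} {A : g.so o} (hA : A ∈ h P Φ o) {s : Spinor} (hs : s ∈ S' P Φ o) :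
    P.sigma o A s ∈ S' P Φ o := by
  obtain ⟨ξ, hξ, h0, hA⟩ := hA
  obtain ⟨ε, hε, rfl⟩ := hs
  refine ⟨_, P.sLie_mem_k1 hξ hε, ?_⟩
  rw [eval_sLie_of_mem_k1 P Φ hε, h0, beta_zero_vec, LinearMap.zero_apply, zero_add, hA]

variable {P Φ} in
theorem comm_mem_h {o : M} {A B : g.so o} (hA : A ∈ h P Φ o) (hB : B ∈ h P Φ o) :
    g.comm o A B ∈ h P Φ o := by
  obtain ⟨ξ, hξ, h0, hA⟩ := hA
  obtain ⟨ζ, hζ, h0', hB⟩ := hB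
  refine ⟨lieV ξ ζ, lieV_mem_k0 hξ hζ, ?_, ?_⟩
  · rw [P.lieV_eq_aMap, h0, h0', map_zero, map_zero, sub_zero]
  · rw [P.aMap_lieV (mem_k0_iff.1 hξ).1 (mem_k0_iff.1 hζ).1, h0, riemann_zero_left, add_zero, hA,
      hB]
    rfl

variable {P Φ} in
theorem kappa_mem_V' {o : M} {s t : Spinor} (hs : s ∈ S' P Φ o) (ht : t ∈ S' P Φ o) :
    P.kappa o s t ∈ V' g Φ o := by
  obtain ⟨ε, hε, rfl⟩ := hs
  obtain ⟨ε', hε', rfl⟩ := ht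
  exact ⟨_, P.curr_mem_k0 hε hε', rfl⟩

/-- `V' ⊕ S' ⊕ 𝔥` is a subalgebra of the Poincaré superalgebra. -/
theorem exists_algBracket (o : M) : ∃ brA : Alg P Φ o →ₗ[ℝ] Alg P Φ o →ₗ[ℝ] Alg P Φ o,
    ∀ x y, incl P Φ o (brA x y) = poincareBracket P o (incl P Φ o x) (incl P Φ o y) := by
  refine exists_bilinear_restriction (incl_injective P Φ o) ?_
  rintro ⟨v, s, A⟩ ⟨w, t, B⟩
  exact ⟨(⟨_, add_mem (sub_mem (map_mem_V' A.2 w.2) (map_mem_V' B.2 v.2)) (kappa_mem_V' s.2 t.2)⟩,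
    ⟨_, sub_mem (sigma_mem_S' A.2 t.2) (sigma_mem_S' B.2 s.2)⟩, ⟨_, comm_mem_h A.2 B.2⟩), rfl⟩

end

end

section

/-! ### Filtered deformations inside `V ⊕ S ⊕ H` -/

section Filtration
variable {V S H : Type*} [AddCommGroup V] [Module ℝ V] [AddCommGroup S] [Module ℝ S]
    [AddCommGroup H] [Module ℝ H]

variable (V S H) in
/-- The filtration of `V ⊕ S ⊕ H` by degree. -/
def tripleFil (i : ℤ) : Submodule ℝ (V × S × H) :=
  if i ≤ -2 then ⊤
  else if i = -1 then Submodule.prod ⊥ ⊤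
  else if i = 0 then Submodule.prod ⊥ (Submodule.prod ⊥ ⊤)
  else ⊥

theorem tripleFil_of_le {i : ℤ} (hi : i ≤ -2) : tripleFil V S H i = ⊤ := if_pos hi

theorem mem_tripleFil_neg_one {x : V × S × H} : x ∈ tripleFil V S H (-1) ↔ x.1 = 0 := by
  simp [tripleFil, Submodule.mem_prod]

theorem mem_tripleFil_zero {x : V × S × H} : x ∈ tripleFil V S H 0 ↔ x.1 = 0 ∧ x.2.1 = 0 := by
  simp [tripleFil, Submodule.mem_prod]

theorem tripleFil_of_pos {i : ℤ} (hi : 0 < i) : tripleFil V S H i = ⊥ := by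
  rw [tripleFil, if_neg (by omega), if_neg (by omega), if_neg (by omega)]

theorem int_cases (i : ℤ) : i < -2 ∨ i = -2 ∨ i = -1 ∨ i = 0 ∨ 0 < i := by omega

theorem tripleProj_eq_zero_iff {i : ℤ} {x : V × S × H} (hx : x ∈ tripleFil V S H i) :
    tripleProj V S H i x = 0 ↔ x ∈ tripleFil V S H (i + 1) := by
  rcases int_cases i with hi | rfl | rfl | rfl | hi
  · rw [tripleProj_of_lt hi, tripleFil_of_le (by omega)]
    simp
  · rw [tripleProj_neg_two, show (-2 + 1 : ℤ) = -1 from rfl, mem_tripleFil_neg_one]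
    simp
  · rw [mem_tripleFil_neg_one] at hx
    rw [tripleProj_neg_one, show (-1 + 1 : ℤ) = 0 from rfl, mem_tripleFil_zero]
    simp [hx]
  · rw [mem_tripleFil_zero] at hx
    rw [tripleProj_zero, tripleFil_of_pos (by omega), Submodule.mem_bot]
    simp [Prod.ext_iff, hx]
  · rw [tripleFil_of_pos hi, Submodule.mem_bot] at hx
    rw [tripleFil_of_pos (by omega), hx]
    simp

theorem tripleFil_antitone : Antitone (tripleFil V S H) := by
  refine antitone_int_of_succ_le fun i x hx => ?_
  rcases int_cases i with hi | rfl | rfl | rfl | hi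
  · rw [tripleFil_of_le (by omega)]; trivial
  · rw [tripleFil_of_le le_rfl]; trivial
  · exact mem_tripleFil_neg_one.2 (mem_tripleFil_zero.1 hx).1
  · rw [tripleFil_of_pos (by omega), Submodule.mem_bot] at hx
    rw [hx]; exact zero_mem _
  · rw [tripleFil_of_pos (by omega), Submodule.mem_bot] at hx
    rw [hx]; exact zero_mem _

theorem tripleFil_even {i : ℤ} {x : V × S × H} (hx : x ∈ tripleFil V S H i) :
    (x.1, 0, x.2.2) ∈ tripleFil V S H i := by
  rcases int_cases i with hi | rfl | rfl | rfl | hi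
  · rw [tripleFil_of_le (by omega)]; trivial
  · rw [tripleFil_of_le le_rfl]; trivial
  · exact mem_tripleFil_neg_one.2 (mem_tripleFil_neg_one.1 hx)
  · exact mem_tripleFil_zero.2 ⟨(mem_tripleFil_zero.1 hx).1, rfl⟩
  · rw [tripleFil_of_pos hi, Submodule.mem_bot] at hx ⊢
    rw [hx]; rfl

/-- A map of Lie superalgebras up to terms of higher filtration degree. -/
structure IsFilteredHom {L : Type*} [AddCommGroup L] [Module ℝ L] (br : L →ₗ[ℝ] L →ₗ[ℝ] L)
    (br' : V × S × H →ₗ[ℝ] V × S × H →ₗ[ℝ] V × S × H) (ev : L →ₗ[ℝ] V × S × H) : Prop where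
  fst : ∀ x y, (ev (br x y)).1 = (br' (ev x) (ev y)).1
  snd : ∀ x y, (ev x).1 = 0 → (ev y).1 = 0 → (ev (br x y)).2.1 = (br' (ev x) (ev y)).2.1
  trd : ∀ x y, (ev x).1 = 0 → (ev y).1 = 0 → (ev x).2.1 = 0 → (ev y).2.1 = 0 →
    (ev (br x y)).2.2 = (br' (ev x) (ev y)).2.2

section
variable {a : H → V →ₗ[ℝ] V} {r : H → S →ₗ[ℝ] S} {k : S →ₗ[ℝ] S →ₗ[ℝ] V} {c : H → H → H}
  {br' : V × S × H →ₗ[ℝ] V × S × H →ₗ[ℝ] V × S × H}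
  {L : Type*} [AddCommGroup L] [Module ℝ L] {br : L →ₗ[ℝ] L →ₗ[ℝ] L} {ev : L →ₗ[ℝ] V × S × H}

theorem IsFilteredHom.bracket_mem (h : IsFilteredHom br br' ev) (hev : Function.Injective ev)
    (hbr : ∀ x y, br' x y = (a x.2.2 y.1 - a y.2.2 x.1 + k x.2.1 y.2.1,
      r x.2.2 y.2.1 - r y.2.2 x.2.1, c x.2.2 y.2.2))
    {i j : ℤ} {x y : L} (hx : ev x ∈ tripleFil V S H i) (hy : ev y ∈ tripleFil V S H j) :
    ev (br x y) ∈ tripleFil V S H (i + j) := by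
  rcases lt_or_ge 0 i with hi | hi
  · rw [tripleFil_of_pos hi, Submodule.mem_bot] at hx
    rw [hev (hx.trans (map_zero ev).symm), map_zero, LinearMap.zero_apply, map_zero]
    exact zero_mem _
  rcases lt_or_ge 0 j with hj | hj
  · rw [tripleFil_of_pos hj, Submodule.mem_bot] at hy
    rw [hev (hy.trans (map_zero ev).symm), map_zero, map_zero]
    exact zero_mem _
  rcases le_or_gt (i + j) (-2) with hij | hij
  · rw [tripleFil_of_le hij]; trivial
  -- With i, j ≤ 0 and i + j > −2 only three pairs of degrees remain.
  obtain ⟨rfl, rfl⟩ | ⟨rfl, rfl⟩ | ⟨rfl, rfl⟩ : (i = -1 ∧ j = 0) ∨ (i = 0 ∧ j = -1) ∨ i = 0 ∧ j = 0 := by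
    omega
  · rw [mem_tripleFil_neg_one] at hx
    rw [mem_tripleFil_zero] at hy
    rw [show (-1 + 0 : ℤ) = -1 from rfl, mem_tripleFil_neg_one, h.fst, hbr]
    simp [hx, hy]
  · rw [mem_tripleFil_neg_one] at hy
    rw [mem_tripleFil_zero] at hx
    rw [show (0 + -1 : ℤ) = -1 from rfl, mem_tripleFil_neg_one, h.fst, hbr]
    simp [hx, hy]
  · rw [mem_tripleFil_zero] at hx hy
    rw [show (0 + 0 : ℤ) = 0 from rfl, mem_tripleFil_zero, h.fst, h.snd x y hx.1 hy.1, hbr]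
    simp [hx, hy]

/-- The discrepancy between `br` and `br'` lies in filtration degree above i + j, so it is invisible
to the leading symbols. -/
theorem IsFilteredHom.tripleProj_bracket (h : IsFilteredHom br br' ev) (hev : Function.Injective ev)
    (hbr : ∀ x y, br' x y = (a x.2.2 y.1 - a y.2.2 x.1 + k x.2.1 y.2.1,
      r x.2.2 y.2.1 - r y.2.2 x.2.1, c x.2.2 y.2.2))
    (a0 : a 0 = 0) (r0 : r 0 = 0) (c0 : ∀ A, c 0 A = 0) (c0' : ∀ A, c A 0 = 0)
    {i j : ℤ} {x y : L} (hx : ev x ∈ tripleFil V S H i) (hy : ev y ∈ tripleFil V S H j) :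
    tripleProj V S H (i + j) (ev (br x y)) =
      br' (tripleProj V S H i (ev x)) (tripleProj V S H j (ev y)) := by
  rcases lt_or_ge 0 i with hi | hi
  · rw [tripleProj_of_pos hi, map_zero, LinearMap.zero_apply]
    rw [tripleFil_of_pos hi, Submodule.mem_bot] at hx
    rw [hev (hx.trans (map_zero ev).symm), map_zero, LinearMap.zero_apply, map_zero, map_zero]
  rcases lt_or_ge 0 j with hj | hj
  · rw [tripleProj_of_pos hj, map_zero]
    rw [tripleFil_of_pos hj, Submodule.mem_bot] at hy
    rw [hev (hy.trans (map_zero ev).symm), map_zero, map_zero, map_zero]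
  rcases lt_or_ge i (-2) with hi' | hi'
  · rw [tripleProj_of_lt hi', map_zero, LinearMap.zero_apply, tripleProj_of_lt (by omega)]
  rcases lt_or_ge j (-2) with hj' | hj'
  · rw [tripleProj_of_lt hj', map_zero, tripleProj_of_lt (by omega)]
  have h1 := h.fst x y
  have h2 := h.snd x y
  have h3 := h.trd x y
  rw [hbr] at h1 h2 h3
  rw [hbr]
  obtain rfl | rfl | rfl : i = -2 ∨ i = -1 ∨ i = 0 := by omega
  all_goals obtain rfl | rfl | rfl : j = -2 ∨ j = -1 ∨ j = 0 := by omega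
  all_goals try simp only [mem_tripleFil_neg_one, mem_tripleFil_zero] at hx hy
  all_goals
    simp_all [tripleProj, Prod.ext_iff]

variable {V₁ S₁ H₁ : Type*} [AddCommGroup V₁] [Module ℝ V₁] [AddCommGroup S₁] [Module ℝ S₁]
  [AddCommGroup H₁] [Module ℝ H₁] {iV : V₁ →ₗ[ℝ] V} {iS : S₁ →ₗ[ℝ] S} {iH : H₁ →ₗ[ℝ] H}
  {br₁ : V₁ × S₁ × H₁ →ₗ[ℝ] V₁ × S₁ × H₁ →ₗ[ℝ] V₁ × S₁ × H₁}

theorem IsFilteredHom.isFilteredLieSuperalgebra {par : ZMod 2 → Submodule ℝ L}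
    {F : ℤ → Submodule ℝ L} (h : IsFilteredHom br br' ev) (hev : Function.Injective ev)
    (hbr : ∀ x y, br' x y = (a x.2.2 y.1 - a y.2.2 x.1 + k x.2.1 y.2.1,
      r x.2.2 y.2.1 - r y.2.2 x.2.1, c x.2.2 y.2.2))
    (hL : IsLieSuperalgebra par br) (hpar : ∀ p, ∀ x ∈ par p, ev x ∈ triplePar V S H p)
    (hF : ∀ i x, x ∈ F i ↔ ev x ∈ tripleFil V S H i) : IsFilteredLieSuperalgebra par F br :=
  { hL with
    antitone := fun i j hij x hx => by
      rw [hF] at *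
      exact tripleFil_antitone hij hx
    exhaustive := fun x => ⟨-2, by rw [hF, tripleFil_of_le le_rfl]; trivial⟩
    separated := fun x hx => by
      have h1 := (hF 1 x).1 (hx 1)
      rw [tripleFil_of_pos one_pos, Submodule.mem_bot] at h1
      exact hev (h1.trans (map_zero ev).symm)
    fil_bracket_mem := fun i j x y hx hy => by
      rw [hF] at *
      exact h.bracket_mem hev hbr hx hy
    homogeneous := fun i => by
      refine le_antisymm (fun x hx => ?_) (sup_le inf_le_left inf_le_left)
      have hc : IsCompl (par 0) (par 1) := (DirectSum.isInternal_submodule_iff_isCompl par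
        (i := 0) (j := 1) (by decide) (by ext p; simpa using zmod_two_cases p)).1 hL.internal
      obtain ⟨x₀, h₀, x₁, h₁, rfl⟩ := Submodule.mem_sup.1
        (hc.sup_eq_top ▸ Submodule.mem_top : x ∈ par 0 ⊔ par 1)
      have e₀ := mem_triplePar_zero.1 (hpar 0 x₀ h₀)
      have e₁ := mem_triplePar_one.1 (hpar 1 x₁ h₁)
      have hx₀ : x₀ ∈ F i := by
        rw [hF] at hx ⊢
        have h2 := tripleFil_even hx
        have h3 : ev x₀ = ((ev (x₀ + x₁)).1, 0, (ev (x₀ + x₁)).2.2) := by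
          simp [Prod.ext_iff, e₀, e₁]
        rwa [h3]
      have hx₁ : x₁ ∈ F i := by simpa using sub_mem hx hx₀
      exact Submodule.add_mem_sup ⟨hx₀, h₀⟩ ⟨hx₁, h₁⟩ }

/-- A filtered Lie superalgebra whose symbols fill a graded subalgebra of `V ⊕ S ⊕ H` is a
filtered deformation of the latter. -/
theorem IsFilteredHom.isFilteredDeformation {par : ZMod 2 → Submodule ℝ L}
    {F : ℤ → Submodule ℝ L} (h : IsFilteredHom br br' ev) (hev : Function.Injective ev)
    (hbr : ∀ x y, br' x y = (a x.2.2 y.1 - a y.2.2 x.1 + k x.2.1 y.2.1,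
      r x.2.2 y.2.1 - r y.2.2 x.2.1, c x.2.2 y.2.2))
    (a0 : a 0 = 0) (r0 : r 0 = 0) (c0 : ∀ A, c 0 A = 0) (c0' : ∀ A, c A 0 = 0)
    (hL : IsLieSuperalgebra par br) (hpar : ∀ p, ∀ x ∈ par p, ev x ∈ triplePar V S H p)
    (hF : ∀ i x, x ∈ F i ↔ ev x ∈ tripleFil V S H i)
    (hL' : IsGradedLieSuperalgebra (triplePar V S H) (tripleDeg V S H) br')
    (hV : Function.Injective iV) (hS : Function.Injective iS) (hH : Function.Injective iH)
    (hbr₁ : ∀ x y, iV.prodMap (iS.prodMap iH) (br₁ x y) =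
      br' (iV.prodMap (iS.prodMap iH) x) (iV.prodMap (iS.prodMap iH) y))
    (rV : ∀ x, ∃ v, iV v = (ev x).1) (rS : ∀ x, ∃ s, iS s = (ev x).2.1)
    (rH : ∀ x, (ev x).1 = 0 → ∃ A, iH A = (ev x).2.2)
    (sV : ∀ v, ∃ x, (ev x).1 = iV v) (sS : ∀ s, ∃ x, ev x = (0, iS s, 0))
    (sH : ∀ A, ∃ x, ev x = (0, 0, iH A)) :
    IsFilteredDeformation par F br (triplePar V₁ S₁ H₁) (tripleDeg V₁ S₁ H₁) br₁ := by
  have hinj := prodMap_injective hV hS hH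
  have hgr : ∀ i, ∃ e : Gr F i ≃ₗ[ℝ] tripleDeg V₁ S₁ H₁ i, ∀ x hx,
      iV.prodMap (iS.prodMap iH) (e (Gr.mk F i x hx)) = tripleProj V S H i (ev x) := fun i => by
    refine exists_gr_equiv ((tripleProj V S H i).comp ev) hinj _ (fun x hx => ?_) (fun x hx => ?_)
      fun y hy => ?_
    · rw [hF] at hx ⊢
      exact tripleProj_eq_zero_iff hx
    · rw [hF] at hx
      rw [LinearMap.comp_apply]
      rcases int_cases i with hi | rfl | rfl | rfl | hi
      · exact ⟨0, zero_mem _, by rw [tripleProj_of_lt hi, map_zero]⟩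
      · obtain ⟨v, hv⟩ := rV x
        refine ⟨(v, 0, 0), mem_tripleDeg.2 rfl, ?_⟩
        rw [tripleProj_neg_two, ← hv]
        simp
      · obtain ⟨s, hs⟩ := rS x
        refine ⟨(0, s, 0), mem_tripleDeg.2 rfl, ?_⟩
        rw [tripleProj_neg_one, ← hs]
        simp
      · obtain ⟨A, hA⟩ := rH x (mem_tripleFil_zero.1 hx).1
        refine ⟨(0, 0, A), mem_tripleDeg.2 rfl, ?_⟩
        rw [tripleProj_zero, ← hA]
        simp
      · exact ⟨0, zero_mem _, by rw [tripleProj_of_pos hi, map_zero]⟩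
    · rw [mem_tripleDeg] at hy
      simp only [hF, LinearMap.comp_apply]
      rcases int_cases i with hi | rfl | rfl | rfl | hi
      · rw [tripleProj_of_lt hi] at hy
        exact ⟨0, by simp, by rw [← hy, map_zero, map_zero, map_zero]⟩
      · rw [tripleProj_neg_two] at hy
        obtain ⟨x, hx⟩ := sV y.1
        exact ⟨x, by rw [tripleFil_of_le le_rfl]; trivial, by
          rw [tripleProj_neg_two, hx, ← hy]; simp⟩
      · rw [tripleProj_neg_one] at hy
        obtain ⟨x, hx⟩ := sS y.2.1
        exact ⟨x, mem_tripleFil_neg_one.2 (by rw [hx]), by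
          rw [tripleProj_neg_one, hx, ← hy]; simp⟩
      · rw [tripleProj_zero] at hy
        obtain ⟨x, hx⟩ := sH y.2.2
        exact ⟨x, mem_tripleFil_zero.2 (by simp [hx]), by
          rw [tripleProj_zero, hx, ← hy]; simp⟩
      · rw [tripleProj_of_pos hi] at hy
        exact ⟨0, by simp, by rw [← hy, map_zero, map_zero, map_zero]⟩
  choose f hf using hgr
  refine ⟨h.isFilteredLieSuperalgebra hev hbr hL hpar hF, hL'.of_prodMap hV hS hH hbr₁, f,
    fun i p x hx hp => ?_, fun i j x y hx hy hxy => hinj ?_⟩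
  · rw [prodMap_mem_triplePar hV hS hH, hf]
    have := hpar p x hp
    rcases zmod_two_cases p with rfl | rfl
    · rw [mem_triplePar_zero] at *
      unfold tripleProj
      split_ifs <;> simp [this]
    · rw [mem_triplePar_one] at *
      unfold tripleProj
      split_ifs <;> simp [this]
  · rw [hbr₁, hf, hf, hf]
    exact h.tripleProj_bracket hev hbr a0 r0 c0 c0' ((hF _ _).1 hx) ((hF _ _).1 hy)

end
end Filtration

end

section

theorem exists_linearEquiv_of_range {A B N : Type*} [AddCommGroup A] [Module ℝ A] [AddCommGroup B]
    [Module ℝ B] [AddCommGroup N] [Module ℝ N] {p : B →ₗ[ℝ] N} {m : A →ₗ[ℝ] N}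
    (hp : Function.Injective p) (hm : Function.Injective m) (h : ∀ x, ∃ y, p y = m x)
    (h' : ∀ y, ∃ x, m x = p y) : ∃ f : A ≃ₗ[ℝ] B, ∀ x, p (f x) = m x := by
  have hr : LinearMap.range m = LinearMap.range p :=
    le_antisymm (by rintro _ ⟨x, rfl⟩; exact h x) (by rintro _ ⟨y, rfl⟩; exact h' y)
  refine ⟨((LinearEquiv.ofInjective m hm).trans (LinearEquiv.ofEq _ _ hr)).trans
    (LinearEquiv.ofInjective p hp).symm, fun x => ?_⟩
  exact congrArg Subtype.val ((LinearEquiv.ofInjective p hp).apply_symm_apply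
    (LinearEquiv.ofEq _ _ hr (LinearEquiv.ofInjective m hm x)))

variable {M : Type*} [TopologicalSpace M] [ChartedSpace E4 M] [IsManifold (𝓡 4) ∞ M]

/-! ### The Killing superalgebra as a filtered deformation -/

section
variable {g : LorentzMetric M} {Ω : SpinorForm} {ι : Type*} (P : SpinStructure g Ω ι) (Φ : Fields M)
variable [T2Space M]

/-- The β-terms are linear in the vector values, which vanish here. -/
theorem kEval_bracket_snd_of_zero (o : M) (x y : K P Φ) (hx : (kEval P Φ o x).1 = 0)
    (hy : (kEval P Φ o y).1 = 0) : (kEval P Φ o (killingBracket P Φ x y)).2.1 =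
      (poincareBracket P o (kEval P Φ o x) (kEval P Φ o y)).2.1 := by
  refine (kEval_bracket_snd P Φ o x y).trans ?_
  generalize poincareBracket P o (kEval P Φ o x) (kEval P Φ o y) = z
  generalize kEval P Φ o x = u at hx ⊢
  generalize kEval P Φ o y = w at hy ⊢
  rw [hx, hy, beta_zero_vec, LinearMap.zero_apply, LinearMap.zero_apply, sub_zero, add_zero]

theorem kEval_bracket_trd_of_zero (o : M) (x y : K P Φ) (hx : (kEval P Φ o x).1 = 0)
    (hx' : (kEval P Φ o x).2.1 = 0) (hy' : (kEval P Φ o y).2.1 = 0) :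
    (kEval P Φ o (killingBracket P Φ x y)).2.2 =
      (poincareBracket P o (kEval P Φ o x) (kEval P Φ o y)).2.2 := by
  refine Subtype.ext (LinearMap.ext fun v => (kEval_bracket_trd P Φ o x y v).trans ?_)
  generalize poincareBracket P o (kEval P Φ o x) (kEval P Φ o y) = z
  generalize kEval P Φ o x = u at hx hx' ⊢
  generalize kEval P Φ o y = w at hy' ⊢
  rw [hx, hx', hy', riemann_zero_left, LinearMap.zero_apply, map_zero, map_zero,
    LinearMap.zero_apply, neg_zero, sub_zero, add_zero, add_zero]

theorem isFilteredHom_kEval (o : M) :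
    IsFilteredHom (killingBracket P Φ) (poincareBracket P o) (kEval P Φ o) where
  fst := kEval_bracket_fst P Φ o
  snd := kEval_bracket_snd_of_zero P Φ o
  trd x y hx _ hx' hy' := kEval_bracket_trd_of_zero P Φ o x y hx hx' hy'

theorem kEval_mem_triplePar (o : M) (p : ZMod 2) (x : K P Φ) (hx : x ∈ kPar P Φ p) :
    kEval P Φ o x ∈ triplePar (T o) Spinor (g.so o) p := by
  rcases zmod_two_cases p with rfl | rfl
  · have h : x.2 = 0 := (Submodule.mem_bot ℝ).1 hx.2
    rw [mem_triplePar_zero]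
    change P.evalSpinor o x.2.1 = 0
    rw [h]
    exact map_zero _
  · have h : x.1 = 0 := (Submodule.mem_bot ℝ).1 hx.1
    have h' : x = (0, x.2) := Prod.ext h rfl
    rw [mem_triplePar_one, h']
    refine ⟨rfl, Subtype.ext ?_⟩
    have := P.aMap_smul 0 (0 : VField M) o
    rwa [zero_smul, zero_smul] at this

/-- The filtration is defined by conditions partly on whole fields (ε = 0, or X and ε both 0);
injectivity of evaluation turns these into conditions on the values at `o`. -/
theorem mem_kFil_iff [ConnectedSpace M] (o : M) (i : ℤ) (x : K P Φ) :
    x ∈ kFil P Φ o i ↔ kEval P Φ o x ∈ tripleFil (T o) Spinor (g.so o) i := by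
  rcases int_cases i with hi | rfl | rfl | rfl | hi
  · rw [tripleFil_of_le hi.le, kFil, if_pos hi.le]
    exact ⟨fun _ => trivial, fun _ => trivial⟩
  · rw [tripleFil_of_le le_rfl, kFil, if_pos le_rfl]
    exact ⟨fun _ => trivial, fun _ => trivial⟩
  · rw [mem_tripleFil_neg_one]
    exact ⟨fun h => h.1, fun h => ⟨h, trivial⟩⟩
  · rw [mem_tripleFil_zero]
    refine ⟨fun h => ⟨h.1, ?_⟩, fun h => ⟨h.1, ?_⟩⟩
    · have h2 : x.2 = 0 := (Submodule.mem_bot ℝ).1 h.2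
      change P.evalSpinor o x.2.1 = 0
      rw [h2]
      exact map_zero _
    · exact (Submodule.mem_bot ℝ).2 (Subtype.ext (P.eq_zero_of_mem_k1 x.2.2 h.2))
  · rw [tripleFil_of_pos hi, kFil, if_neg (by omega), if_neg (by omega), if_neg (by omega),
      Submodule.mem_bot, Submodule.mem_bot, map_eq_zero_iff _ (kEval_injective P Φ o)]

theorem isFilteredDeformation_killing [ConnectedSpace M] (o : M)
    {brA : Alg P Φ o →ₗ[ℝ] Alg P Φ o →ₗ[ℝ] Alg P Φ o}
    (hbr : ∀ x y, incl P Φ o (brA x y) = poincareBracket P o (incl P Φ o x) (incl P Φ o y)) :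
    IsFilteredDeformation (kPar P Φ) (kFil P Φ o) (killingBracket P Φ)
      (triplePar (V' g Φ o) (S' P Φ o) (h P Φ o)) (tripleDeg (V' g Φ o) (S' P Φ o) (h P Φ o))
      brA := by
  refine (isFilteredHom_kEval P Φ o).isFilteredDeformation (kEval_injective P Φ o)
    (a := fun A : g.so o => (A : Module.End ℝ (T o))) (r := fun A : g.so o => P.sigma o A)
    (k := P.kappa o) (c := g.comm o) (poincareBracket_apply P o) rfl (map_zero _)
    (comm_zero_left o) (comm_zero_right o) (isLieSuperalgebra_killingBracket P Φ)
    (kEval_mem_triplePar P Φ o) (mem_kFil_iff P Φ o) (isGradedLieSuperalgebra_poincareBracket P o)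
    (V' g Φ o).subtype_injective (S' P Φ o).subtype_injective (h P Φ o).subtype_injective hbr
    (fun x => ⟨⟨_, x.1.1, x.1.2, rfl⟩, rfl⟩) (fun x => ⟨⟨_, x.2.1, x.2.2, rfl⟩, rfl⟩)
    (fun x hx => ⟨⟨_, x.1.1, x.1.2, hx, rfl⟩, rfl⟩) ?_ ?_ ?_
  · rintro ⟨_, X, hX, rfl⟩
    exact ⟨(⟨X, hX⟩, 0), rfl⟩
  · rintro ⟨_, ε, hε, rfl⟩
    refine ⟨(0, ⟨ε, hε⟩), Prod.ext rfl (Prod.ext rfl ?_)⟩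
    exact (mem_triplePar_one.1 (kEval_mem_triplePar P Φ o 1 (0, ⟨ε, hε⟩) ⟨rfl, trivial⟩)).2
  · rintro ⟨A, ξ, hξ, h0, hA⟩
    exact ⟨(⟨ξ, hξ⟩, 0), Prod.ext h0 (Prod.ext (map_zero (P.evalSpinor o)) (Subtype.ext hA))⟩

/-- A linear section of the evaluation 𝔨₀ → V', followed by X ↦ A_X at `o`. -/
theorem exists_isSplitting (o : M) : ∃ Sig, IsSplitting P Φ o Sig := by
  let e : k0 g Φ →ₗ[ℝ] V' g Φ o := (evalVector o).submoduleMap (k0 g Φ)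
  obtain ⟨s, hs⟩ := e.exists_rightInverse_of_surjective
    (LinearMap.range_eq_top.2 (LinearMap.submoduleMap_surjective _ _))
  refine ⟨{ toFun := fun v => ⟨P.aMap (s v).1 o, aMap_mem_so P Φ (s v).2 o⟩,
            map_add' := fun v w => ?_, map_smul' := fun c v => ?_ }, fun v => ⟨s v, (s v).2, ?_, rfl⟩⟩
  · rw [map_add]
    exact Subtype.ext (P.aMap_add _ _ _)
  · rw [map_smul]
    exact Subtype.ext (P.aMap_smul _ _ _)
  · exact congrArg Subtype.val (LinearMap.congr_fun hs v)

variable {P Φ}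

/-- The map `(v, s, A) ↦ (v, s, A + Σ_v)` defined by a splitting. -/
def splittingMap {o : M} (Sig : V' g Φ o →ₗ[ℝ] g.so o) : Alg P Φ o →ₗ[ℝ] Poincare g o :=
  incl P Φ o + (LinearMap.inr ℝ (T o) (Spinor × g.so o)).comp ((LinearMap.inr ℝ Spinor (g.so o)).comp
    (Sig.comp (LinearMap.fst ℝ (V' g Φ o) (S' P Φ o × h P Φ o))))

theorem splittingMap_apply {o : M} (Sig : V' g Φ o →ₗ[ℝ] g.so o) (x : Alg P Φ o) :
    splittingMap Sig x = ((x.1 : T o), (x.2.1 : Spinor), x.2.2.1 + Sig x.1) :=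
  Prod.ext (add_zero _) (Prod.ext (add_zero _) rfl)

theorem splittingMap_injective {o : M} (Sig : V' g Φ o →ₗ[ℝ] g.so o) :
    Function.Injective (splittingMap Sig : Alg P Φ o →ₗ[ℝ] Poincare g o) := fun x y hxy => by
  rw [splittingMap_apply, splittingMap_apply, Prod.mk.injEq, Prod.mk.injEq] at hxy
  have h1 : x.1 = y.1 := Subtype.ext hxy.1
  have h3 := hxy.2.2
  rw [h1, add_left_inj] at h3
  exact Prod.ext h1 (Prod.ext (Subtype.ext hxy.2.1) (Subtype.ext h3))

theorem exists_kEval_eq {o : M} {Sig : V' g Φ o →ₗ[ℝ] g.so o} (hSig : IsSplitting P Φ o Sig)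
    (x : Alg P Φ o) : ∃ y, kEval P Φ o y = splittingMap Sig x := by
  obtain ⟨v, ⟨_, ε, hε, rfl⟩, A⟩ := x
  obtain ⟨X, hX, hX0, hXA⟩ := hSig v
  obtain ⟨ξ, hξ, hξ0, hξA⟩ := A.2
  refine ⟨(⟨ξ + X, add_mem hξ hX⟩, ⟨ε, hε⟩), ?_⟩
  rw [splittingMap_apply]
  refine Prod.ext ?_ (Prod.ext rfl (Subtype.ext ?_))
  · change ξ o + X o = v
    rw [hξ0, hX0, zero_add]
  · change P.aMap (ξ + X : VField M) o = _
    rw [P.aMap_add, hξA, hXA]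
    rfl

/-- Two fields with the same value at `o` differ by one that vanishes there; thus A_X differs from Σ
at X(o) by an element of 𝔥. -/
theorem exists_splittingMap_eq {o : M} {Sig : V' g Φ o →ₗ[ℝ] g.so o} (hSig : IsSplitting P Φ o Sig)
    (y : K P Φ) : ∃ x : Alg P Φ o, splittingMap Sig x = kEval P Φ o y := by
  have hv : y.1.1 o ∈ V' g Φ o := ⟨y.1.1, y.1.2, rfl⟩
  obtain ⟨X, hX, hX0, hXA⟩ := hSig ⟨_, hv⟩
  have hA : (kEval P Φ o y).2.2 - Sig ⟨_, hv⟩ ∈ h P Φ o := by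
    refine ⟨y.1.1 + (-1 : ℝ) • X, add_mem y.1.2 ((k0 g Φ).smul_mem _ hX), ?_, ?_⟩
    · change y.1.1 o + (-1 : ℝ) • X o = 0
      rw [hX0, neg_one_smul, add_neg_cancel]
    · rw [P.aMap_add, P.aMap_smul, hXA, neg_one_smul, ← sub_eq_add_neg]
      rfl
  refine ⟨(⟨_, hv⟩, ⟨_, y.2.1, y.2.2, rfl⟩, ⟨_, hA⟩), ?_⟩
  rw [splittingMap_apply]
  exact Prod.ext rfl (Prod.ext rfl (sub_add_cancel _ _))

/-- The isomorphism `𝔞 → 𝔨` defined by a splitting. -/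
theorem exists_splitting_equiv [ConnectedSpace M] {o : M} {Sig : V' g Φ o →ₗ[ℝ] g.so o}
    (hSig : IsSplitting P Φ o Sig) : ∃ f : Alg P Φ o ≃ₗ[ℝ] K P Φ,
      ∀ x, kEval P Φ o (f x) = splittingMap Sig x :=
  exists_linearEquiv_of_range (kEval_injective P Φ o) (splittingMap_injective Sig)
    (exists_kEval_eq hSig) (exists_splittingMap_eq hSig)

end

end

section

variable {M : Type*} [TopologicalSpace M] [ChartedSpace E4 M] [IsManifold (𝓡 4) ∞ M]

/-! ### The deformed bracket -/

section
variable {g : LorentzMetric M} {Ω : SpinorForm} {ι : Type*} {P : SpinStructure g Ω ι} {Φ : Fields M}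

/-- The bracket of `𝔨` transported to `𝔞`. -/
def transportBracket {o : M} (br : K P Φ →ₗ[ℝ] K P Φ →ₗ[ℝ] K P Φ) (f : Alg P Φ o ≃ₗ[ℝ] K P Φ) :
    Alg P Φ o →ₗ[ℝ] Alg P Φ o →ₗ[ℝ] Alg P Φ o :=
  (br.compl₁₂ (f : Alg P Φ o →ₗ[ℝ] K P Φ) (f : Alg P Φ o →ₗ[ℝ] K P Φ)).compr₂
    (f.symm : K P Φ →ₗ[ℝ] Alg P Φ o)

theorem transportBracket_apply {o : M} (br : K P Φ →ₗ[ℝ] K P Φ →ₗ[ℝ] K P Φ)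
    (f : Alg P Φ o ≃ₗ[ℝ] K P Φ) (x y : Alg P Φ o) :
    transportBracket br f x y = f.symm (br (f x) (f y)) := rfl

variable [T2Space M]

section
variable {o : M} {Sig : V' g Φ o →ₗ[ℝ] g.so o} {f : Alg P Φ o ≃ₗ[ℝ] K P Φ}

theorem splittingMap_transportBracket (hf : ∀ x, kEval P Φ o (f x) = splittingMap Sig x) (x y : Alg P Φ o)
    (br : K P Φ →ₗ[ℝ] K P Φ →ₗ[ℝ] K P Φ) :
    splittingMap Sig (transportBracket br f x y) = kEval P Φ o (br (f x) (f y)) := by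
  rw [← hf, transportBracket_apply, LinearEquiv.apply_symm_apply]

theorem transportBracket_fst (hf : ∀ x, kEval P Φ o (f x) = splittingMap Sig x) (x y : Alg P Φ o) :
    ((transportBracket (killingBracket P Φ) f x y).1 : T o) =
      ((x.2.2.1 : Module.End ℝ (T o)) y.1.1 + (Sig x.1 : Module.End ℝ (T o)) y.1.1)
        - ((y.2.2.1 : Module.End ℝ (T o)) x.1.1 + (Sig y.1 : Module.End ℝ (T o)) x.1.1)
        + P.kappa o x.2.1.1 y.2.1.1 := by
  have key : ∀ X Y Z, kEval P Φ o (f x) = X → kEval P Φ o (f y) = Y →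
      kEval P Φ o (killingBracket P Φ (f x) (f y)) = Z → Z.1 = (poincareBracket P o X Y).1 := by
    rintro _ _ _ rfl rfl rfl
    exact kEval_bracket_fst P Φ o (f x) (f y)
  have e := key _ _ _ (hf x) (hf y) (splittingMap_transportBracket hf x y _).symm
  simp only [splittingMap_apply, poincareBracket_apply] at e
  exact e

theorem transportBracket_snd (hf : ∀ x, kEval P Φ o (f x) = splittingMap Sig x) (x y : Alg P Φ o) :
    ((transportBracket (killingBracket P Φ) f x y).2.1 : Spinor) =
      (P.sigma o x.2.2.1 y.2.1.1 + P.sigma o (Sig x.1) y.2.1.1)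
        - (P.sigma o y.2.2.1 x.2.1.1 + P.sigma o (Sig y.1) x.2.1.1)
        + (beta P Φ o x.1.1 y.2.1.1 - beta P Φ o y.1.1 x.2.1.1) := by
  have key : ∀ X Y Z, kEval P Φ o (f x) = X → kEval P Φ o (f y) = Y →
      kEval P Φ o (killingBracket P Φ (f x) (f y)) = Z → Z.2.1 =
        (poincareBracket P o X Y).2.1 + (beta P Φ o X.1 Y.2.1 - beta P Φ o Y.1 X.2.1) := by
    rintro _ _ _ rfl rfl rfl
    exact kEval_bracket_snd P Φ o (f x) (f y)
  have e := key _ _ _ (hf x) (hf y) (splittingMap_transportBracket hf x y _).symm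
  simp only [splittingMap_apply, poincareBracket_apply, Submodule.coe_add, map_add,
    LinearMap.add_apply] at e
  exact e

theorem transportBracket_trd (hf : ∀ x, kEval P Φ o (f x) = splittingMap Sig x) (x y : Alg P Φ o)
    (u : T o) :
    ((transportBracket (killingBracket P Φ) f x y).2.2.1 : Module.End ℝ (T o)) u
        + (Sig (transportBracket (killingBracket P Φ) f x y).1 : Module.End ℝ (T o)) u =
      (g.comm o (x.2.2.1 + Sig x.1) (y.2.2.1 + Sig y.1) : Module.End ℝ (T o)) u
        + P.riemann o x.1.1 y.1.1 u
        + (-P.kappa o (beta P Φ o u x.2.1.1) y.2.1.1 - P.kappa o x.2.1.1 (beta P Φ o u y.2.1.1)) := by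
  have key : ∀ X Y Z, kEval P Φ o (f x) = X → kEval P Φ o (f y) = Y →
      kEval P Φ o (killingBracket P Φ (f x) (f y)) = Z → (Z.2.2 : Module.End ℝ (T o)) u =
        ((poincareBracket P o X Y).2.2 : Module.End ℝ (T o)) u + P.riemann o X.1 Y.1 u
        + (-P.kappa o (beta P Φ o u X.2.1) Y.2.1 - P.kappa o X.2.1 (beta P Φ o u Y.2.1)) := by
    rintro _ _ _ rfl rfl rfl
    exact kEval_bracket_trd P Φ o (f x) (f y) u
  have e := key _ _ _ (hf x) (hf y) (splittingMap_transportBracket hf x y _).symm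
  simp only [splittingMap_apply, poincareBracket_apply] at e
  exact e

end

theorem comm_add_add_apply {o : M} (A B C D : g.so o) (u : T o) :
    (g.comm o (A + B) (C + D) : Module.End ℝ (T o)) u =
      (g.comm o A C : Module.End ℝ (T o)) u + (g.comm o A D : Module.End ℝ (T o)) u
        - (g.comm o C B : Module.End ℝ (T o)) u + (g.comm o B D : Module.End ℝ (T o)) u := by
  simp only [comm_apply, Submodule.coe_add, LinearMap.add_apply, map_add]
  abel

end

end

/-! ### Components of the transported bracket -/

section

variable {M : Type*} [TopologicalSpace M] [ChartedSpace E4 M] [IsManifold (𝓡 4) ∞ M]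

section
variable {g : LorentzMetric M} {Ω : SpinorForm} {ι : Type*}

/-- The components of a bracket on `𝔞` which the splitting `Sig` identifies with that of `𝔨`. -/
structure IsDeformedBracket (P : SpinStructure g Ω ι) (Φ : Fields M) (o : M)
    (Sig : V' g Φ o →ₗ[ℝ] g.so o) (D : Alg P Φ o →ₗ[ℝ] Alg P Φ o →ₗ[ℝ] Alg P Φ o) : Prop where
  fst : ∀ (v w : V' g Φ o) (s t : S' P Φ o) (A B : h P Φ o), ((D (v, s, A) (w, t, B)).1 : T o) =
      ((A.1 : Module.End ℝ (T o)) w.1 + (Sig v : Module.End ℝ (T o)) w.1)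
        - ((B.1 : Module.End ℝ (T o)) v.1 + (Sig w : Module.End ℝ (T o)) v.1)
        + P.kappa o s.1 t.1
  snd : ∀ (v w : V' g Φ o) (s t : S' P Φ o) (A B : h P Φ o),
    ((D (v, s, A) (w, t, B)).2.1 : Spinor) =
      (P.sigma o A.1 t.1 + P.sigma o (Sig v) t.1) - (P.sigma o B.1 s.1 + P.sigma o (Sig w) s.1)
        + (beta P Φ o v.1 t.1 - beta P Φ o w.1 s.1)
  trd : ∀ (v w : V' g Φ o) (s t : S' P Φ o) (A B : h P Φ o) (u : V' g Φ o),
    (D (v, s, A) (w, t, B)).1 = u → ∀ z : T o,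
    ((D (v, s, A) (w, t, B)).2.2.1 : Module.End ℝ (T o)) z =
      (g.comm o A.1 B.1 : Module.End ℝ (T o)) z + (g.comm o A.1 (Sig w) : Module.End ℝ (T o)) z
        - (g.comm o B.1 (Sig v) : Module.End ℝ (T o)) z
        + (g.comm o (Sig v) (Sig w) : Module.End ℝ (T o)) z + P.riemann o v.1 w.1 z
        + (-P.kappa o (beta P Φ o z s.1) t.1 - P.kappa o s.1 (beta P Φ o z t.1))
        - (Sig u : Module.End ℝ (T o)) z

variable {P : SpinStructure g Ω ι} {Φ : Fields M}

theorem isDeformedBracket_transportBracket [T2Space M] {o : M} {Sig : V' g Φ o →ₗ[ℝ] g.so o}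
    {f : Alg P Φ o ≃ₗ[ℝ] K P Φ} (hf : ∀ x, kEval P Φ o (f x) = splittingMap Sig x) :
    IsDeformedBracket P Φ o Sig (transportBracket (killingBracket P Φ) f) where
  fst v w s t A B := transportBracket_fst hf (v, s, A) (w, t, B)
  snd v w s t A B := transportBracket_snd hf (v, s, A) (w, t, B)
  trd v w s t A B u hu z := by
    subst hu
    refine eq_sub_of_add_eq ((transportBracket_trd hf (v, s, A) (w, t, B) z).trans ?_)
    rw [comm_add_add_apply]

section
variable {o : M} {Sig : V' g Φ o →ₗ[ℝ] g.so o} {D : Alg P Φ o →ₗ[ℝ] Alg P Φ o →ₗ[ℝ] Alg P Φ o}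

theorem IsDeformedBracket.vector_vector (hD : IsDeformedBracket P Φ o Sig D) (v w : V' g Φ o) :
    ((D (v, 0, 0) (w, 0, 0)).1 : T o) =
      (Sig v : Module.End ℝ (T o)) w - (Sig w : Module.End ℝ (T o)) v := by
  rw [hD.fst]
  simp only [Submodule.coe_zero, LinearMap.zero_apply, map_zero, zero_add, add_zero]

theorem IsDeformedBracket.vector_spinor (hD : IsDeformedBracket P Φ o Sig D) (v : V' g Φ o)
    (s : S' P Φ o) : ((D (v, 0, 0) (0, s, 0)).2.1 : Spinor) =
      beta P Φ o v s + P.sigma o (Sig v) s := by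
  rw [hD.snd]
  simp only [Submodule.coe_zero, LinearMap.zero_apply, map_zero, zero_add, add_zero, sub_zero]
  exact add_comm _ _

theorem IsDeformedBracket.spinor_spinor (hD : IsDeformedBracket P Φ o Sig D) (s t : S' P Φ o)
    (u : V' g Φ o) (hu : (u : T o) = P.kappa o s t) (v : T o) :
      (((D (0, s, 0) (0, t, 0)).2.2 : g.so o) : Module.End ℝ (T o)) v =
        -P.kappa o (beta P Φ o v s) t - P.kappa o s (beta P Φ o v t)
          - (Sig u : Module.End ℝ (T o)) v := by
  have hu' : (D (0, s, 0) (0, t, 0)).1 = u := Subtype.ext (by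
    rw [hD.fst, hu]
    simp only [Submodule.coe_zero, map_zero, zero_add, sub_zero])
  rw [hD.trd _ _ _ _ _ _ u hu']
  simp only [Submodule.coe_zero, LinearMap.zero_apply, map_zero, zero_add, sub_zero,
    comm_zero_left, riemann_zero_left]

theorem IsDeformedBracket.endo_vector (hD : IsDeformedBracket P Φ o Sig D) (A : h P Φ o)
    (v u : V' g Φ o) (hu : (u : T o) = ((A : g.so o) : Module.End ℝ (T o)) v) :
      ((D (0, 0, A) (v, 0, 0)).2.2 : g.so o) = g.comm o A (Sig v) - Sig u := by
  have hu' : (D (0, 0, A) (v, 0, 0)).1 = u := Subtype.ext (by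
    rw [hD.fst, hu]
    simp only [Submodule.coe_zero, LinearMap.zero_apply, map_zero, add_zero, sub_zero])
  refine Subtype.ext (LinearMap.ext fun z => ?_)
  rw [hD.trd _ _ _ _ _ _ u hu']
  simp only [Submodule.coe_zero, LinearMap.zero_apply, map_zero, zero_add, sub_zero, add_zero,
    neg_zero, comm_zero_left, comm_zero_right, riemann_zero_left, Submodule.coe_sub,
    LinearMap.sub_apply]

theorem IsDeformedBracket.vector_vector_endo (hD : IsDeformedBracket P Φ o Sig D) (v w : V' g Φ o) :
    (((D (v, 0, 0) (w, 0, 0)).2.2 : g.so o) : Module.End ℝ (T o)) =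
      g.comm o (Sig v) (Sig w) + P.riemann o v w - Sig (D (v, 0, 0) (w, 0, 0)).1 := by
  refine LinearMap.ext fun z => ?_
  rw [hD.trd _ _ _ _ _ _ _ rfl]
  simp only [Submodule.coe_zero, LinearMap.zero_apply, map_zero, zero_add, sub_zero, add_zero,
    neg_zero, comm_zero_left, LinearMap.sub_apply, LinearMap.add_apply]

variable {brA : Alg P Φ o →ₗ[ℝ] Alg P Φ o →ₗ[ℝ] Alg P Φ o}

theorem IsDeformedBracket.fst_eq (hD : IsDeformedBracket P Φ o Sig D)
    (hbr : ∀ x y, incl P Φ o (brA x y) = poincareBracket P o (incl P Φ o x) (incl P Φ o y))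
    (v w : V' g Φ o) (s t : S' P Φ o) (A B : h P Φ o) : (D (v, s, A) (w, t, B)).1 =
      (brA (v, s, A) (w, t, B)).1 + (D (v, 0, 0) (w, 0, 0)).1 := by
  have b : ((brA (v, s, A) (w, t, B)).1 : T o) = (A.1 : Module.End ℝ (T o)) w.1
    - (B.1 : Module.End ℝ (T o)) v.1 + P.kappa o s.1 t.1 := congrArg Prod.fst (hbr (v, s, A) (w, t, B))
  refine Subtype.ext ((hD.fst v w s t A B).trans
    (Eq.trans ?_ (congrArg₂ (· + ·) b (hD.vector_vector v w)).symm))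
  abel

theorem IsDeformedBracket.snd_eq (hD : IsDeformedBracket P Φ o Sig D)
    (hbr : ∀ x y, incl P Φ o (brA x y) = poincareBracket P o (incl P Φ o x) (incl P Φ o y))
    (v w : V' g Φ o) (s t : S' P Φ o) (A B : h P Φ o) : (D (v, s, A) (w, t, B)).2.1 =
      (brA (v, s, A) (w, t, B)).2.1 + ((D (v, 0, 0) (0, t, 0)).2.1 - (D (w, 0, 0) (0, s, 0)).2.1) := by
  have b : ((brA (v, s, A) (w, t, B)).2.1 : Spinor) = P.sigma o A.1 t.1 - P.sigma o B.1 s.1 :=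
    congrArg (fun z : Poincare g o => z.2.1) (hbr (v, s, A) (w, t, B))
  refine Subtype.ext ((hD.snd v w s t A B).trans (Eq.trans ?_ (congrArg₂ (· + ·) b
    (congrArg₂ (· - ·) (hD.vector_spinor v t) (hD.vector_spinor w s))).symm))
  abel

/-- The subtracted Σ of the vector part splits by linearity into the terms for A w, −B v, κ(s, t)
and α(v, w). Each completes one of the four corrections (the two λ-terms, γ and δ) to an element of
𝔥. -/
theorem IsDeformedBracket.trd_eq [T2Space M] (hD : IsDeformedBracket P Φ o Sig D)
    (hbr : ∀ x y, incl P Φ o (brA x y) = poincareBracket P o (incl P Φ o x) (incl P Φ o y))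
    (v w : V' g Φ o) (s t : S' P Φ o) (A B : h P Φ o) : (D (v, s, A) (w, t, B)).2.2 =
      (brA (v, s, A) (w, t, B)).2.2 + ((D (0, 0, A) (w, 0, 0)).2.2 - (D (0, 0, B) (v, 0, 0)).2.2
        + (D (0, s, 0) (0, t, 0)).2.2 + (D (v, 0, 0) (w, 0, 0)).2.2) := by
  refine Subtype.ext (Subtype.ext (LinearMap.ext fun z => ?_))
  have b : ((brA (v, s, A) (w, t, B)).2.2.1 : Module.End ℝ (T o)) z =
      (g.comm o A.1 B.1 : Module.End ℝ (T o)) z :=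
    congrArg (fun y : Poincare g o => (y.2.2 : Module.End ℝ (T o)) z) (hbr (v, s, A) (w, t, B))
  have b1 : (brA (v, s, A) (w, t, B)).1 = ⟨_, map_mem_V' A.2 w.2⟩ - ⟨_, map_mem_V' B.2 v.2⟩
      + ⟨_, kappa_mem_V' s.2 t.2⟩ := Subtype.ext (congrArg Prod.fst (hbr (v, s, A) (w, t, B)))
  have bA := congrArg (fun X : g.so o => (X : Module.End ℝ (T o)) z)
    (hD.endo_vector A w ⟨_, map_mem_V' A.2 w.2⟩ rfl)
  have bB := congrArg (fun X : g.so o => (X : Module.End ℝ (T o)) z)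
    (hD.endo_vector B v ⟨_, map_mem_V' B.2 v.2⟩ rfl)
  have bS := hD.spinor_spinor s t ⟨_, kappa_mem_V' s.2 t.2⟩ rfl z
  have bV := LinearMap.congr_fun (hD.vector_vector_endo v w) z
  refine (hD.trd v w s t A B _ ((hD.fst_eq hbr v w s t A B).trans (congrArg (· + _) b1)) z).trans
    (Eq.trans ?_ (congrArg₂ (· + ·) b (congrArg₂ (· + ·) (congrArg₂ (· + ·)
      (congrArg₂ (· - ·) bA bB) bS) bV)).symm)
  generalize (D (v, 0, 0) (w, 0, 0)).1 = α
  simp only [map_add, map_sub, Submodule.coe_add, Submodule.coe_sub, LinearMap.add_apply,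
    LinearMap.sub_apply]
  abel

end

end

end

/-! ### Assembling the deformed form -/

section

variable {M : Type*} [TopologicalSpace M] [ChartedSpace E4 M] [IsManifold (𝓡 4) ∞ M]

section
variable {g : LorentzMetric M} {Ω : SpinorForm} {ι : Type*} {P : SpinStructure g Ω ι} {Φ : Fields M}

theorem exists_components {V S H : Type*} [AddCommGroup V] [Module ℝ V] [AddCommGroup S]
    [Module ℝ S] [AddCommGroup H] [Module ℝ H]
    (D : V × S × H →ₗ[ℝ] V × S × H →ₗ[ℝ] V × S × H) :
    ∃ (α : V →ₗ[ℝ] V →ₗ[ℝ] V) (β : V →ₗ[ℝ] S →ₗ[ℝ] S) (γ : S →ₗ[ℝ] S →ₗ[ℝ] H)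
      (lam : H →ₗ[ℝ] V →ₗ[ℝ] H) (δ : V →ₗ[ℝ] V →ₗ[ℝ] H),
      (∀ v w, α v w = (D (v, 0, 0) (w, 0, 0)).1) ∧ (∀ v s, β v s = (D (v, 0, 0) (0, s, 0)).2.1) ∧
      (∀ s t, γ s t = (D (0, s, 0) (0, t, 0)).2.2) ∧
      (∀ A v, lam A v = (D (0, 0, A) (v, 0, 0)).2.2) ∧
      ∀ v w, δ v w = (D (v, 0, 0) (w, 0, 0)).2.2 := by
  let jV : V →ₗ[ℝ] V × S × H := LinearMap.inl ℝ _ _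
  let jS : S →ₗ[ℝ] V × S × H := (LinearMap.inr ℝ _ _).comp (LinearMap.inl ℝ _ _)
  let jH : H →ₗ[ℝ] V × S × H := (LinearMap.inr ℝ _ _).comp (LinearMap.inr ℝ _ _)
  let pV : V × S × H →ₗ[ℝ] V := LinearMap.fst ℝ _ _
  let pS : V × S × H →ₗ[ℝ] S := (LinearMap.fst ℝ _ _).comp (LinearMap.snd ℝ _ _)
  let pH : V × S × H →ₗ[ℝ] H := (LinearMap.snd ℝ _ _).comp (LinearMap.snd ℝ _ _)
  exact ⟨(D.compl₁₂ jV jV).compr₂ pV, (D.compl₁₂ jV jS).compr₂ pS, (D.compl₁₂ jS jS).compr₂ pH,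
    (D.compl₁₂ jH jV).compr₂ pH, (D.compl₁₂ jV jV).compr₂ pH, fun _ _ => rfl, fun _ _ => rfl,
    fun _ _ => rfl, fun _ _ => rfl, fun _ _ => rfl⟩

variable [T2Space M]

theorem IsDeformedBracket.hasDeformedForm {o : M} {br : K P Φ →ₗ[ℝ] K P Φ →ₗ[ℝ] K P Φ}
    {brA D : Alg P Φ o →ₗ[ℝ] Alg P Φ o →ₗ[ℝ] Alg P Φ o} {Sig : V' g Φ o →ₗ[ℝ] g.so o}
    (hD : IsDeformedBracket P Φ o Sig D)
    (hbr : ∀ x y, incl P Φ o (brA x y) = poincareBracket P o (incl P Φ o x) (incl P Φ o y))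
    {f : Alg P Φ o ≃ₗ[ℝ] K P Φ} (hf : ∀ x, kEval P Φ o (f x) = splittingMap Sig x)
    (hDf : ∀ x y, D x y = f.symm (br (f x) (f y))) : HasDeformedForm P Φ o br brA Sig := by
  obtain ⟨α, β, γ, lam, δ, hα, hβ, hγ, hlam, hδ⟩ := exists_components D
  refine ⟨f, α, β, γ, lam, δ, fun v s A => ?_, fun v w => ?_, fun v s => ?_, fun s t u hu v => ?_,
    fun A v u hu => ?_, fun v w => ?_, ?_⟩
  · have h := (hf (v, s, A)).trans (splittingMap_apply Sig (v, s, A))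
    exact ⟨congrArg Prod.fst h,
      congrArg (fun z : Poincare g o => (z.2.2 : Module.End ℝ (T o))) h,
      congrArg (fun z : Poincare g o => z.2.1) h⟩
  · exact (congrArg Subtype.val (hα v w)).trans (hD.vector_vector v w)
  · exact (congrArg Subtype.val (hβ v s)).trans (hD.vector_spinor v s)
  · exact (congrArg (fun X : h P Φ o => ((X : g.so o) : Module.End ℝ (T o)) v) (hγ s t)).trans
      (hD.spinor_spinor s t u hu v)
  · exact (congrArg Subtype.val (hlam A v)).trans (hD.endo_vector A v u hu)
  · rw [hα]
    exact (congrArg (fun X : h P Φ o => ((X : g.so o) : Module.End ℝ (T o))) (hδ v w)).trans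
      (hD.vector_vector_endo v w)
  · rintro ⟨v, s, A⟩ ⟨w, t, B⟩
    refine (hDf _ _).symm.trans (Prod.ext ?_ (Prod.ext ?_ ?_))
    · exact (hD.fst_eq hbr v w s t A B).trans (congrArg (_ + ·) (hα v w).symm)
    · exact (hD.snd_eq hbr v w s t A B).trans (congrArg (_ + ·)
        (congrArg₂ (· - ·) (hβ v t).symm (hβ w s).symm))
    · exact (hD.trd_eq hbr v w s t A B).trans (congrArg (_ + ·) (congrArg₂ (· + ·)
        (congrArg₂ (· + ·) (congrArg₂ (· - ·) (hlam A w).symm (hlam B v).symm) (hγ s t).symm)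
        (hδ v w).symm))

theorem hasDeformedForm_killingBracket [ConnectedSpace M] {o : M}
    {brA : Alg P Φ o →ₗ[ℝ] Alg P Φ o →ₗ[ℝ] Alg P Φ o}
    (hbr : ∀ x y, incl P Φ o (brA x y) = poincareBracket P o (incl P Φ o x) (incl P Φ o y))
    {Sig : V' g Φ o →ₗ[ℝ] g.so o} (hSig : IsSplitting P Φ o Sig) :
    HasDeformedForm P Φ o (killingBracket P Φ) brA Sig :=
  let ⟨_, hf⟩ := exists_splitting_equiv hSig
  (isDeformedBracket_transportBracket hf).hasDeformedForm hbr hf (transportBracket_apply _ _)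

end

end

end KSA

end

/-! ### The main theorem -/

open KSA in
theorem proposition3p5 {M : Type*} [TopologicalSpace M] [ChartedSpace E4 M]
    [IsManifold (𝓡 4) ∞ M] [T2Space M] [SecondCountableTopology M] [ConnectedSpace M]
    (g : LorentzMetric M) (Ω : SpinorForm) {ι : Type*} (P : SpinStructure g Ω ι) (Φ : Fields M) :
    ∃ br : K P Φ →ₗ[ℝ] K P Φ →ₗ[ℝ] K P Φ, IsKillingBracket P Φ br ∧
      ∀ o : M,
        (∃ ev : K P Φ →ₗ[ℝ] Poincare g o, Function.Injective ev ∧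
          ∀ X, (ev X).1 = (X.1 : VField M) o ∧ (ev X).2.1 = P.evalSpinor o X.2 ∧
            ((ev X).2.2 : Module.End ℝ (T o)) = P.aMap (X.1 : VField M) o) ∧
        IsGradedLieSuperalgebra (triplePar (T o) Spinor (g.so o))
          (tripleDeg (T o) Spinor (g.so o)) (poincareBracket P o) ∧
        (∃ brA : Alg P Φ o →ₗ[ℝ] Alg P Φ o →ₗ[ℝ] Alg P Φ o,
          (∀ x y, incl P Φ o (brA x y) = poincareBracket P o (incl P Φ o x) (incl P Φ o y)) ∧
          IsFilteredDeformation (kPar P Φ) (kFil P Φ o) br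
            (triplePar (V' g Φ o) (S' P Φ o) (h P Φ o))
            (tripleDeg (V' g Φ o) (S' P Φ o) (h P Φ o)) brA ∧
          (∃ Sig, IsSplitting P Φ o Sig) ∧
          ∀ Sig, IsSplitting P Φ o Sig → HasDeformedForm P Φ o br brA Sig) ∧
        (2 < Module.finrank ℝ (S' P Φ o) → ∀ p : M, LocallyTransitiveAround g Φ p) := by
  refine ⟨killingBracket P Φ, isKillingBracket_killingBracket P Φ, fun o => ⟨?_, ?_, ?_, ?_⟩⟩
  · exact ⟨kEval P Φ o, kEval_injective P Φ o, fun X => ⟨rfl, rfl, rfl⟩⟩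
  · exact isGradedLieSuperalgebra_poincareBracket P o
  · exact (exists_algBracket P Φ o).imp fun brA hbr => ⟨hbr, isFilteredDeformation_killing P Φ o hbr,
      exists_isSplitting P Φ o, fun Sig hSig => hasDeformedForm_killingBracket hbr hSig⟩
  -- Since dim S' is constant, 𝔨₀ spans every tangent space, and the whole manifold serves as
  -- neighbourhood.
  · exact fun ho p => ⟨Set.univ, Filter.univ_mem, fun q _ => P.V'_eq_top ho q⟩
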